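/- **Setting.** Let $k$ be a field of characteristic $0$. A Manin triple $(\mathfrak g,\mathfrak g_+,\mathfrak g_-)$ is a Lie algebra $\mathfrak g$ over $k$ with a nondegenerate symmetric invariant bilinear form $(\,,)$ and isotropic Lie subalgebras $\mathfrak g_\pm$ such that $\mathfrak g=\mathfrak g_-\oplus\mathfrak g_+$, the form identifies $\mathfrak g_+$ with the full dual $\mathfrak g_-^*$, and the bracket of $\mathfrak g$ is continuous for the sum of the discrete topology on $\mathfrak g_-$ and the weak topology on $\mathfrak g_+$. For a basis $(a_i)$ of $\mathfrak g_-$ with dual elements $b^i\in\mathfrak g_+$, put $r=\sum_i a_i\otimes b^i$, $r^{21}=\sum_i b^i\otimes a_i$, $\Omega=r+r^{21}$. Let $\mathfrak g_D=\mathfrak g_{D,-}\oplus\mathfrak g_{D,+}$ be a second Manin triple and $i:\mathfrak g_D\to\mathfrak g$ a split embedding: a continuous Lie algebra homomorphism that preserves the forms, maps $\mathfrak g_{D,\pm}$ to $\mathfrak g_\pm$, and is such that $\mathfrak m_\pm=\mathfrak g_\pm\cap i(\mathfrak g_D)^\perp$ are Lie subalgebras of $\mathfrak g$. Let $r_D,r_D^{21}$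 be the images under $i\otimes i$ of the elements $r,r^{21}$ of $\mathfrak g_D$. Set $\mathfrak p_+=\mathfrak m_+\oplus i(\mathfrak g_D)$. An equicontinuous $\mathfrak g$-module is a complete separated linearly topologized vector space $V$ with a Lie algebra action such that $x\mapsto xv$ is continuous on $\mathfrak g$ for each $v\in V$ and the operators $x\in\mathfrak g$ form an equicontinuous family. Write $V\hat\otimes W=\varprojlim V/U\otimes W/U'$, over open subspaces $U$, $U'$. Then $r$, $r_D$, etc. act on $V\hat\otimes W$. Fix a Lie associator $\Phi$ over $k$. Equicontinuous modules form a braided monoidal category, with morphisms $\mathrm{Hom}_{\mathfrak g}(V,W)[[\hbar]]$, associativity constraint $\Phi(\hbar\Omega_{12},\hbar\Omega_{23})$ and braiding $\beta_{VW}=(12)\circ e^{\hbar\Omega/2}$. Let $L_-=\mathrm{Ind}_{\mathfrak p_+}^{\mathfrak g}k$ (discrete) and $N_+=\mathrm{Ind}_{\mathfrak m_-}^{\mathfrak g}k$, with generators $1_-$, $1_+$, and let $i_-:L_-\to L_-\otimes L_-$, $i_+:N_+\to N_+\otimes N_+$ be the $\mathfrak g$-module maps with $1_\mp\mapsto1_\mp\otimes1_\mp$.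 Let $N_+^*$ be the $\mathfrak g$-module of continuous functionals on $N_+\simeq U(\mathfrak g_+)\otimes U(\mathfrak g_{D,-})$, where each $U(\mathfrak g_+)_n$ has its weak topology and $U(\mathfrak g_{D,-})$ is discrete; a basis of neighbourhoods of $0$ in $N_+^*$ is given by the subspaces $(N_+^*)_n$ of functionals vanishing on the image of $U_n(\mathfrak p_+)$. Let $T\in(U\mathfrak g\hat\otimes U\mathfrak g)[[\hbar]]$ satisfy $$S^{\otimes3}(\Phi^{321})(T\otimes1)(\Delta\otimes1)(T)=(1\otimes T)(1\otimes\Delta)(T)\,\Phi,\qquad T\,\Delta(S(a))=(S\otimes S)(\Delta(a))\,T\quad(a\in U\mathfrak g),$$ and $T\equiv1$ mod $\hbar^2$; it is given through the action of $(S\otimes S)(T)$ by natural transformations of $X\hat\otimes Y$, for equicontinuous $X,Y$. Define $i_+^\vee\in\mathrm{Hom}(N_+^*\hat\otimes N_+^*,N_+^*)[[\hbar]]$ by $i_+^\vee(f\otimes g)(n)=(g\otimes f)(T\, i_+(n))$. For an equicontinuous module $V$ let $\Gamma(V)=\mathrm{Hom}_{\mathfrak g}(L_-,N_+^*\hat\otimes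 V)[[\hbar]]$ and $\alpha_V:\Gamma(V)\to V[[\hbar]]$, $\alpha_V(f)=(1_+\otimes1)f(1_-)$. For $f\in\Gamma(V)$, $f'\in\Gamma(W)$ let $J_{VW}(f\otimes f')$ be the composition $$L_-\xrightarrow{i_-}L_-\otimes L_-\xrightarrow{f\otimes f'}(N_+^*\hat\otimes V)\hat\otimes(N_+^*\hat\otimes W)\xrightarrow{A'\,\beta_{23}^{-1}A}(N_+^*\hat\otimes N_+^*)\hat\otimes(V\hat\otimes W)\xrightarrow{i_+^\vee\otimes1}N_+^*\hat\otimes(V\hat\otimes W),$$ where $\beta_{23}^{-1}$ is the inverse of $\beta_{N_+^*,V}:N_+^*\hat\otimes V\to V\hat\otimes N_+^*$ in the middle factors and $A$, $A'$ are the associativity constraints through $X_1\otimes((X_2\otimes X_3)\otimes X_4)$, or both those through $(X_1\otimes(X_2\otimes X_3))\otimes X_4$. **Statement.** For all equicontinuous $\mathfrak g$-modules $V,W$ and for either choice of $(A,A')$: 1. $\alpha_V$ is injective, and it is a bijection $\Gamma(V)\to V[[\hbar]]$ if $\dim\mathfrak g_D<\infty$; likewise for $\alpha_W$. 2. $J_{VW}(f\otimes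 f')\in\Gamma(V\hat\otimes W)$ for all $f\in\Gamma(V)$ and $f'\in\Gamma(W)$. 3. The relative twist $J_\Gamma=\alpha_{V\otimes W}\circ J_{VW}\circ(\alpha_V^{-1}\otimes\alpha_W^{-1})$ satisfies $$J_\Gamma\equiv1+\frac\hbar2\left(r+r_D^{21}\right)\mod\hbar^2.$$ 4. Consequently $\mathrm{Alt}_2J_\Gamma:=\frac12\left(J_\Gamma-J_\Gamma^{21}\right)$, with $J_\Gamma^{21}=(12)\circ J_\Gamma\circ(12)$, satisfies $$\mathrm{Alt}_2J_\Gamma\equiv\frac\hbar2\left(\frac{r-r^{21}}2-\frac{r_D-r_D^{21}}2\right)\mod\hbar^2.$$ The congruences 3 and 4 are between values at $x\otimes y$, for all $x\in V[[\hbar]]$ and $y\in W[[\hbar]]$ in the images of $\alpha_V$ and $\alpha_W$, hence for all $x$ and $y$ if $\dim\mathfrak g_D<\infty$. -/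

import Mathlib

universe u v v' w w' w''

namespace RelTwist

noncomputable section

open scoped TensorProduct

/-! ### Linear topologies and `g`-modules -/

section LinearUniformity

variable {k : Type*} {E : Type*} {ι : Type*} [Field k] [AddCommGroup E] [Module k E]

/-- The coarsest uniform structure on `E` for which all projections `E → E ⧸ P j` are uniformly
continuous, the quotients being discrete. For a downward directed family `P` it is the linear
topology having the `P j` as a basis of neighbourhoods of zero. -/
@[reducible] def linearUniformity (P : ι → Submodule k E) : UniformSpace E :=
  ⨅ j, UniformSpace.comap (P j).mkQ ⊥

theorem linearUniformity_isUniformAddGroup (P : ι → Submodule k E) :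
    @IsUniformAddGroup E (linearUniformity P) _ := by
  refine isUniformAddGroup_iInf fun j => ?_
  let _ : UniformSpace (E ⧸ P j) := ⊥
  have : DiscreteUniformity (E ⧸ P j) := ⟨rfl⟩
  exact IsUniformAddGroup.comap (P j).mkQ

theorem linearUniformity_uniformContinuousConstSMul (P : ι → Submodule k E) :
    @UniformContinuousConstSMul k E (linearUniformity P) _ := by
  let _ := linearUniformity P
  refine ⟨fun c => ?_⟩
  refine uniformContinuous_iInf_rng.2 fun j => ?_
  let _ : UniformSpace (E ⧸ P j) := ⊥
  have : DiscreteUniformity (E ⧸ P j) := ⟨rfl⟩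
  refine uniformContinuous_comap' ?_
  have h1 : UniformContinuous ((P j).mkQ : E → E ⧸ P j) :=
    uniformContinuous_iInf_dom (i := j) uniformContinuous_comap
  have h2 : UniformContinuous (fun q : E ⧸ P j => c • q) :=
    DiscreteUniformity.uniformContinuous _ _
  exact h2.comp h1

end LinearUniformity

/-- A topological `k`-vector space (`k` is discrete) together with a family of continuous linear
operators indexed by `g`. The equicontinuous `g`-modules are singled out by
`TMod.IsEquicontinuous` below. -/
structure TMod (k : Type u) (g : Type v) [Field k] where
  carrier : Type w
  [addCommGroup : AddCommGroup carrier]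
  [module : Module k carrier]
  [uniformSpace : UniformSpace carrier]
  [isUniformAddGroup : IsUniformAddGroup carrier]
  [uniformContinuousConstSMul : UniformContinuousConstSMul k carrier]
  act : g → carrier →L[k] carrier

attribute [instance] TMod.addCommGroup TMod.module TMod.uniformSpace TMod.isUniformAddGroup
  TMod.uniformContinuousConstSMul

instance (k : Type u) (g : Type v) [Field k] : CoeSort (TMod.{u, v, w} k g) (Type w) :=
  ⟨TMod.carrier⟩

/-! ### Manin triples -/

section Manin

variable {k : Type u} {g : Type v} [Field k] [LieRing g] [LieAlgebra k g]

/-- For `g = gm ⊕ gp` with `gm`, `gp` isotropic and `gp ≃ gm^*`: the topology on `g` which is the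
sum of the discrete topology on `gm` and of the weak topology on `gp`. Pairing with `gp` separates
exactly the `gm`-components, and pairing with `gm` depends on the `gp`-component only. -/
@[reducible] def maninTopology (form : LinearMap.BilinForm k g) (gm gp : LieSubalgebra k g) :
    TopologicalSpace g :=
  TopologicalSpace.induced (fun x => fun y : gp => form x y) ⊥ ⊓
    TopologicalSpace.induced (fun x => fun y : gm => form x y)
      (@Pi.topologicalSpace gm (fun _ => k) (fun _ => ⊥))

variable (k g)

/-- A Manin triple `(g, gp, gm)`. -/
structure ManinTriple where
  form : LinearMap.BilinForm k g
  symm : ∀ x y, form x y = form y x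
  invariant : ∀ x y z, form ⁅x, y⁆ z = form x ⁅y, z⁆
  nondegenerate : ∀ x, (∀ y, form x y = 0) → x = 0
  gm : LieSubalgebra k g
  gp : LieSubalgebra k g
  isotropic_gm : ∀ x ∈ gm, ∀ y ∈ gm, form x y = 0
  isotropic_gp : ∀ x ∈ gp, ∀ y ∈ gp, form x y = 0
  isCompl : IsCompl gm.toSubmodule gp.toSubmodule
  /-- the form identifies `gp` with the full dual of `gm` -/
  dual : Function.Bijective
    (fun y : gp => ((form (y : g)).comp gm.toSubmodule.subtype : Module.Dual k gm))
  continuous_bracket :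
    letI := maninTopology form gm gp
    Continuous (fun p : g × g => ⁅p.1, p.2⁆)

variable {k g}

/-- the topology of the Manin triple -/
@[reducible] def ManinTriple.top (M : ManinTriple k g) : TopologicalSpace g :=
  maninTopology M.form M.gm M.gp

/-- index set of a basis of `gm` -/
def ManinTriple.Index (M : ManinTriple k g) : Type _ := Module.Basis.ofVectorSpaceIndex k M.gm

/-- a basis `(a_i)` of `gm` -/
def ManinTriple.a (M : ManinTriple k g) (i : M.Index) : g :=
  ((Module.Basis.ofVectorSpace k M.gm i : M.gm) : g)

/-- the dual elements `b^i` of `gp`, with `form (b^i) (a_j) = δ_ij` -/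
def ManinTriple.b (M : ManinTriple k g) (i : M.Index) : g :=
  (((Equiv.ofBijective _ M.dual).symm ((Module.Basis.ofVectorSpace k M.gm).coord i) : M.gp) : g)

/-- An equicontinuous module over the Lie algebra of a Manin triple: complete, separated and
linearly topologized, with a Lie algebra action that is continuous in `g` (for the weak topology on
operators) and whose operators form an equicontinuous family. -/
structure TMod.IsEquicontinuous (M : ManinTriple k g) (V : TMod.{u, v, w} k g) : Prop where
  complete : CompleteSpace V
  separated : T2Space V
  linear : ∀ s ∈ nhds (0 : V), ∃ U : Submodule k V, IsOpen (U : Set V) ∧ (U : Set V) ⊆ s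
  act_add : ∀ x y t, V.act (x + y) t = V.act x t + V.act y t
  act_smul : ∀ (c : k) x t, V.act (c • x) t = c • V.act x t
  act_lie : ∀ x y t, V.act ⁅x, y⁆ t = V.act x (V.act y t) - V.act y (V.act x t)
  continuous_act : ∀ t : V, @Continuous g V M.top _ (fun x => V.act x t)
  equicontinuous : ∀ U : Submodule k V, IsOpen (U : Set V) →
    ∃ U' : Submodule k V, IsOpen (U' : Set V) ∧ ∀ x : g, ∀ t ∈ U', V.act x t ∈ U

end Manin

/-! ### The completed tensor product -/

section Tensor

variable {k : Type u} {g : Type v} [Field k]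

/-- the algebraic tensor product, as a carrier of the tensor product topology -/
def AlgTensor (X : TMod.{u, v, w} k g) (Y : TMod.{u, v, w'} k g) : Type (max w w') :=
  TensorProduct k X Y

variable (X : TMod.{u, v, w} k g) (Y : TMod.{u, v, w'} k g)

instance : AddCommGroup (AlgTensor X Y) := inferInstanceAs (AddCommGroup (TensorProduct k X Y))
instance : Module k (AlgTensor X Y) := inferInstanceAs (Module k (TensorProduct k X Y))

/-- the kernel of `X ⊗ Y → X/U ⊗ Y/U'`, for open subspaces `U`, `U'` -/
def AlgTensor.basic (p : {U : Submodule k X // IsOpen (U : Set X)} ×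
    {U : Submodule k Y // IsOpen (U : Set Y)}) : Submodule k (AlgTensor X Y) :=
  LinearMap.ker (TensorProduct.map p.1.1.mkQ p.2.1.mkQ)

instance : UniformSpace (AlgTensor X Y) := linearUniformity (AlgTensor.basic X Y)
instance : IsUniformAddGroup (AlgTensor X Y) := linearUniformity_isUniformAddGroup _
instance : UniformContinuousConstSMul k (AlgTensor X Y) :=
  linearUniformity_uniformContinuousConstSMul _

/-- The topological tensor product `lim X/U ⊗ Y/U'`, as the completion of `X ⊗ Y`. -/
abbrev CTensor : Type (max w w') := UniformSpace.Completion (AlgTensor X Y)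

/-- the canonical map from the algebraic to the topological tensor product -/
def ofAlg : TensorProduct k X Y →ₗ[k] CTensor X Y where
  toFun t := ((show AlgTensor X Y from t : AlgTensor X Y) : CTensor X Y)
  map_add' s t := UniformSpace.Completion.coe_add (α := AlgTensor X Y) s t
  map_smul' c t := UniformSpace.Completion.coe_smul (X := AlgTensor X Y) c t

variable {X Y}

/-- the pure tensor `x ⊗ y` in the topological tensor product -/
def ptens (x : X) (y : Y) : CTensor X Y :=
  ofAlg X Y (TensorProduct.tmul k x y)

open Classical in
/-- The continuous linear map on the topological tensor product given by `x ⊗ y ↦ φ x y` on pure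
tensors. Pure tensors span a dense subspace, so there is at most one such map into a separated
space. (The value is `0` if there is none.) -/
def desc {Z : Type w''} [AddCommGroup Z] [Module k Z] [TopologicalSpace Z] (φ : X → Y → Z) :
    CTensor X Y →L[k] Z :=
  if h : ∃ F : CTensor X Y →L[k] Z, ∀ x y, F (ptens x y) = φ x y then h.choose else 0

/-- `f ⊗ f'` on topological tensor products -/
def mapT {X : TMod.{u, v, w} k g} {X' : TMod.{u, v, w'} k g} {Y : TMod.{u, v, w''} k g}
    {Y' : TMod.{u, v, v'} k g} (f : X →L[k] X') (f' : Y →L[k] Y') :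
    CTensor X Y →L[k] CTensor X' Y' :=
  desc fun x y => ptens (f x) (f' y)

/-- the tensor product of modules, `x ∈ g` acting by `x ⊗ 1 + 1 ⊗ x` -/
@[reducible] def tens (X : TMod.{u, v, w} k g) (Y : TMod.{u, v, w'} k g) : TMod.{u, v, max w w'} k g where
  carrier := CTensor X Y
  act x := mapT (X.act x) (ContinuousLinearMap.id k Y) +
    mapT (ContinuousLinearMap.id k X) (Y.act x)

/-- the flip `x ⊗ y ↦ y ⊗ x` -/
def swapT (X : TMod.{u, v, w} k g) (Y : TMod.{u, v, w'} k g) : tens X Y →L[k] tens Y X :=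
  desc fun x y => ptens y x

/-- `(x ⊗ y) ⊗ z ↦ x ⊗ (y ⊗ z)` -/
def assocT (X : TMod.{u, v, w} k g) (Y : TMod.{u, v, w'} k g) (Z : TMod.{u, v, w''} k g) :
    tens (tens X Y) Z →L[k] tens X (tens Y Z) :=
  desc (X := tens X Y) (Y := Z) fun t z =>
    desc (X := X) (Y := Y) (Z := tens X (tens Y Z))
      (fun x y => ptens (Y := tens Y Z) x (ptens y z)) t

/-- `x ⊗ (y ⊗ z) ↦ (x ⊗ y) ⊗ z` -/
def assocInvT (X : TMod.{u, v, w} k g) (Y : TMod.{u, v, w'} k g) (Z : TMod.{u, v, w''} k g) :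
    tens X (tens Y Z) →L[k] tens (tens X Y) Z :=
  desc (X := X) (Y := tens Y Z) fun x t =>
    desc (X := Y) (Y := Z) (Z := tens (tens X Y) Z)
      (fun y z => ptens (X := tens X Y) (ptens x y) z) t

/-- The operator `∑ a_i ⊗ b_i`; the sum converges in the topological tensor product. -/
def sumOp {ι : Type*} (a b : ι → g) (X : TMod.{u, v, w} k g) (Y : TMod.{u, v, w'} k g) :
    tens X Y →L[k] tens X Y :=
  desc (X := X) (Y := Y) (Z := tens X Y) fun x y => ∑' i, ptens (X.act (a i) x) (Y.act (b i) y)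

end Tensor

/-! ### Formal power series of operators -/

section Series

variable {k : Type u} {g : Type v} [Field k]

/-- `Hom(X, Y)[[ħ]]`, by coefficients -/
abbrev HSeries (X : TMod.{u, v, w} k g) (Y : TMod.{u, v, w'} k g) : Type (max w w') :=
  ℕ → (X →L[k] Y)

namespace HSeries

variable {X : TMod.{u, v, w} k g} {Y : TMod.{u, v, w'} k g} {Z : TMod.{u, v, w''} k g}

/-- an operator as a constant series -/
def const (f : X →L[k] Y) : HSeries X Y := fun n => if n = 0 then f else 0

/-- composition of series, `F` after `G` -/
def comp (F : HSeries Y Z) (G : HSeries X Y) : HSeries X Z :=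
  fun n => ∑ p ∈ Finset.HasAntidiagonal.antidiagonal n, (F p.1).comp (G p.2)

/-- the action of `Hom(X, Y)[[ħ]]` on `X[[ħ]]` -/
def apply (F : HSeries X Y) (t : ℕ → X) : ℕ → Y :=
  fun n => ∑ p ∈ Finset.HasAntidiagonal.antidiagonal n, F p.1 (t p.2)

/-- `F ⊗ 1` -/
def tensRight (F : HSeries X Y) (Z : TMod.{u, v, w''} k g) : HSeries (tens X Z) (tens Y Z) :=
  fun n => mapT (F n) (ContinuousLinearMap.id k Z)

/-- `1 ⊗ F` -/
def tensLeft (Z : TMod.{u, v, w''} k g) (F : HSeries X Y) : HSeries (tens Z X) (tens Z Y) :=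
  fun n => mapT (ContinuousLinearMap.id k Z) (F n)

end HSeries

/-- `v ⊗ w` for `v ∈ V[[ħ]]`, `w ∈ W[[ħ]]` -/
def hptens {V : TMod.{u, v, w} k g} {W : TMod.{u, v, w'} k g} (x : ℕ → V) (y : ℕ → W) :
    ℕ → tens V W :=
  fun n => ∑ p ∈ Finset.HasAntidiagonal.antidiagonal n, ptens (x p.1) (y p.2)

/-- congruence modulo `ħ²` -/
def CongrModSq {A : Type*} (s t : ℕ → A) : Prop := ∀ n < 2, s n = t n

/-- `A + ħ B` -/
def jet {X : TMod.{u, v, w} k g} {Y : TMod.{u, v, w'} k g} (A B : X →L[k] Y) : HSeries X Y :=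
  fun n => if n = 0 then A else if n = 1 then B else 0

end Series

/-! ### Lie associators -/

section Associator

open PowerSeries

/-- the infinitesimal pure braid relations, i.e. the defining relations of the enveloping algebra
of the Drinfeld--Kohno Lie algebra, for elements `t i j` (`i ≠ j`) of an algebra -/
structure IsInfBraid {n : ℕ} {R : Type*} [Ring R] (t : Fin n → Fin n → R) : Prop where
  symm : ∀ i j, i ≠ j → t i j = t j i
  comm : ∀ i j l m, i ≠ j → i ≠ l → i ≠ m → j ≠ l → j ≠ m → l ≠ m → Commute (t i j) (t l m)
  four : ∀ i j l, i ≠ j → i ≠ l → j ≠ l → Commute (t i j) (t i l + t j l)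

variable {k : Type u} [Field k]

/-- the series `F(ħ A, ħ B)` for `A = x`, `B = y` in an algebra; here `F(ħ A, ħ B)` is given as a
series in `ħ` with coefficients in the free algebra on `A`, `B` -/
def evalFree {R : Type*} [Ring R] [Algebra k R] (F : PowerSeries (FreeAlgebra k (Fin 2)))
    (x y : R) : PowerSeries R :=
  PowerSeries.map (FreeAlgebra.lift k ![x, y]).toRingHom F

/-- `exp (ħ x)` -/
def hexp (k : Type*) [Field k] {R : Type*} [Ring R] [Algebra k R] (x : R) : PowerSeries R :=
  PowerSeries.mk fun n => ((n.factorial : k)⁻¹) • x ^ n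

variable (k)

/-- A Lie associator: a group-like noncommutative formal series `Φ(A, B)` satisfying the duality,
pentagon and hexagon equations in the Drinfeld--Kohno algebras, with `R = exp (ħ t / 2)`.
The equations are required for arbitrary elements satisfying the infinitesimal braid relations,
equivalently in the universal case. `Φ` is recorded as the series `Φ(ħ A, ħ B)`. -/
structure LieAssociator where
  series : (PowerSeries (FreeAlgebra k (Fin 2)))ˣ
  /-- the coefficient of `ħ ^ n` is homogeneous of degree `n` -/
  homogeneous : ∀ n, coeff n (series : PowerSeries (FreeAlgebra k (Fin 2))) ∈
    (Submodule.span k (Set.range (FreeAlgebra.ι k : Fin 2 → FreeAlgebra k (Fin 2)))) ^ n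
  /-- group-like for the coproduct for which `A` and `B` are primitive -/
  grouplike :
    evalFree (series : PowerSeries (FreeAlgebra k (Fin 2)))
        ((FreeAlgebra.ι k 0 ⊗ₜ[k] 1 + 1 ⊗ₜ[k] FreeAlgebra.ι k 0 :
          FreeAlgebra k (Fin 2) ⊗[k] FreeAlgebra k (Fin 2)))
        (FreeAlgebra.ι k 1 ⊗ₜ[k] 1 + 1 ⊗ₜ[k] FreeAlgebra.ι k 1) =
      evalFree (series : PowerSeries (FreeAlgebra k (Fin 2)))
        (FreeAlgebra.ι k 0 ⊗ₜ[k] 1) (FreeAlgebra.ι k 1 ⊗ₜ[k] 1) *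
      evalFree (series : PowerSeries (FreeAlgebra k (Fin 2)))
        (1 ⊗ₜ[k] FreeAlgebra.ι k 0) (1 ⊗ₜ[k] FreeAlgebra.ι k 1)
  duality :
    evalFree (series : PowerSeries (FreeAlgebra k (Fin 2))) (FreeAlgebra.ι k 1)
      (FreeAlgebra.ι k 0) = ((series⁻¹ : (PowerSeries (FreeAlgebra k (Fin 2)))ˣ) :
        PowerSeries (FreeAlgebra k (Fin 2)))
  pentagon : ∀ (R : Type u) [Ring R] [Algebra k R] (t : Fin 4 → Fin 4 → R), IsInfBraid t →
    evalFree series.1 (t 0 1) (t 1 2 + t 1 3) * evalFree series.1 (t 0 2 + t 1 2) (t 2 3) =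
      evalFree series.1 (t 1 2) (t 2 3) * evalFree series.1 (t 0 1 + t 0 2) (t 1 3 + t 2 3) *
        evalFree series.1 (t 0 1) (t 1 2)
  hexagon₁ : ∀ (R : Type u) [Ring R] [Algebra k R] (t : Fin 3 → Fin 3 → R), IsInfBraid t →
    hexp k ((2 : k)⁻¹ • (t 0 2 + t 1 2)) =
      evalFree series.1 (t 0 2) (t 0 1) * hexp k ((2 : k)⁻¹ • t 0 2) *
        evalFree series⁻¹.1 (t 0 2) (t 1 2) * hexp k ((2 : k)⁻¹ • t 1 2) *
          evalFree series.1 (t 0 1) (t 1 2)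
  hexagon₂ : ∀ (R : Type u) [Ring R] [Algebra k R] (t : Fin 3 → Fin 3 → R), IsInfBraid t →
    hexp k ((2 : k)⁻¹ • (t 0 1 + t 0 2)) =
      evalFree series⁻¹.1 (t 1 2) (t 0 2) * hexp k ((2 : k)⁻¹ • t 0 2) *
        evalFree series.1 (t 0 1) (t 0 2) * hexp k ((2 : k)⁻¹ • t 0 1) *
          evalFree series⁻¹.1 (t 0 1) (t 1 2)

end Associator

/-! ### The Drinfeld category of equicontinuous modules -/

section Drinfeld

variable {k : Type u} {g : Type v} [Field k] [LieRing g] [LieAlgebra k g]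

namespace ManinTriple

variable (M : ManinTriple k g)

/-- `r = ∑ a_i ⊗ b^i` -/
def r (X : TMod.{u, v, w} k g) (Y : TMod.{u, v, w'} k g) : tens X Y →L[k] tens X Y :=
  sumOp M.a M.b X Y

/-- `r²¹ = ∑ b^i ⊗ a_i` -/
def r21 (X : TMod.{u, v, w} k g) (Y : TMod.{u, v, w'} k g) : tens X Y →L[k] tens X Y :=
  sumOp M.b M.a X Y

/-- the Casimir operator `Ω = r + r²¹` -/
def Omega (X : TMod.{u, v, w} k g) (Y : TMod.{u, v, w'} k g) : tens X Y →L[k] tens X Y :=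
  M.r X Y + M.r21 X Y

/-- the inverse of the braiding `β_{XY} = (12) ∘ exp (ħ Ω / 2) : X ⊗ Y → Y ⊗ X` -/
def braidInv (X : TMod.{u, v, w} k g) (Y : TMod.{u, v, w'} k g) :
    HSeries (tens Y X) (tens X Y) :=
  HSeries.comp (fun n => PowerSeries.coeff n (hexp k (-(2 : k)⁻¹ • M.Omega X Y)))
    (HSeries.const (swapT Y X))

variable (X : TMod.{u, v, w} k g) (Y : TMod.{u, v, w'} k g) (Z : TMod.{u, v, w''} k g)

/-- `Ω₁₂` on `(X ⊗ Y) ⊗ Z` -/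
def Omega12 : tens (tens X Y) Z →L[k] tens (tens X Y) Z :=
  mapT (M.Omega X Y) (ContinuousLinearMap.id k Z)

/-- `Ω₂₃` on `(X ⊗ Y) ⊗ Z` -/
def Omega23 : tens (tens X Y) Z →L[k] tens (tens X Y) Z :=
  (assocInvT X Y Z).comp
    ((mapT (ContinuousLinearMap.id k X) (M.Omega Y Z)).comp (assocT X Y Z))

variable (Φ : LieAssociator k)

/-- the associativity constraint `(X ⊗ Y) ⊗ Z → X ⊗ (Y ⊗ Z)` given by `Φ(ħ Ω₁₂, ħ Ω₂₃)` -/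
def assoc : HSeries (tens (tens X Y) Z) (tens X (tens Y Z)) :=
  HSeries.comp (HSeries.const (assocT X Y Z))
    (fun n => PowerSeries.coeff n (evalFree Φ.series.1 (M.Omega12 X Y Z) (M.Omega23 X Y Z)))

/-- the inverse of the associativity constraint -/
def assocInv : HSeries (tens X (tens Y Z)) (tens (tens X Y) Z) :=
  HSeries.comp
    (fun n => PowerSeries.coeff n (evalFree Φ.series⁻¹.1 (M.Omega12 X Y Z) (M.Omega23 X Y Z)))
    (HSeries.const (assocInvT X Y Z))

end ManinTriple

end Drinfeld

/-! ### Induced modules -/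

section Induced

attribute [local instance 100] LieRing.ofAssociativeRing

variable (k : Type u) {g : Type v} [Field k] [LieRing g] [LieAlgebra k g]

/-- `Ind_h^g k = U(g) / U(g) h`, for a Lie subalgebra `h` (given by its underlying subspace) -/
def Ind (h : Submodule k g) : Type (max u v) :=
  UniversalEnvelopingAlgebra k g ⧸ Ideal.span (UniversalEnvelopingAlgebra.ι k '' (h : Set g))

namespace Ind

variable (h : Submodule k g)

instance : AddCommGroup (Ind k h) := inferInstanceAs (AddCommGroup
  (UniversalEnvelopingAlgebra k g ⧸ Ideal.span (UniversalEnvelopingAlgebra.ι k '' (h : Set g))))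

instance : Module (UniversalEnvelopingAlgebra k g) (Ind k h) :=
  inferInstanceAs (Module (UniversalEnvelopingAlgebra k g)
    (UniversalEnvelopingAlgebra k g ⧸
      Ideal.span (UniversalEnvelopingAlgebra.ι k '' (h : Set g))))

instance : Module k (Ind k h) :=
  inferInstanceAs (Module k (UniversalEnvelopingAlgebra k g ⧸
    Ideal.span (UniversalEnvelopingAlgebra.ι k '' (h : Set g))))

instance : IsScalarTower k (UniversalEnvelopingAlgebra k g) (Ind k h) :=
  inferInstanceAs (IsScalarTower k (UniversalEnvelopingAlgebra k g)
    (UniversalEnvelopingAlgebra k g ⧸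
      Ideal.span (UniversalEnvelopingAlgebra.ι k '' (h : Set g))))

/-- the action of `g` on the induced module -/
instance : LieRingModule g (Ind k h) where
  bracket x m := UniversalEnvelopingAlgebra.ι k x • m
  add_lie x y m := by
    change UniversalEnvelopingAlgebra.ι k (x + y) • m = _ • m + _ • m
    rw [map_add, add_smul]
  lie_add x m n := smul_add _ _ _
  leibniz_lie x y m := by
    change UniversalEnvelopingAlgebra.ι k x • UniversalEnvelopingAlgebra.ι k y • m =
      UniversalEnvelopingAlgebra.ι k ⁅x, y⁆ • m +
        UniversalEnvelopingAlgebra.ι k y • UniversalEnvelopingAlgebra.ι k x • m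
    rw [LieHom.map_lie, LieRing.of_associative_ring_bracket, sub_smul, mul_smul, mul_smul,
      sub_add_cancel]

instance : LieModule k g (Ind k h) where
  smul_lie c x m := by
    change UniversalEnvelopingAlgebra.ι k (c • x) • m = c • UniversalEnvelopingAlgebra.ι k x • m
    rw [map_smul, smul_assoc]
  lie_smul c x m := by
    change UniversalEnvelopingAlgebra.ι k x • c • m = c • UniversalEnvelopingAlgebra.ι k x • m
    rw [← algebraMap_smul (UniversalEnvelopingAlgebra k g) c m,
      ← algebraMap_smul (UniversalEnvelopingAlgebra k g) c
        (UniversalEnvelopingAlgebra.ι k x • m), smul_smul, smul_smul, Algebra.commutes]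

/-- the generating vector -/
def one : Ind k h :=
  Submodule.Quotient.mk (p := Ideal.span (UniversalEnvelopingAlgebra.ι k '' (h : Set g)))
    (1 : UniversalEnvelopingAlgebra k g)

theorem comul_aux :
    (Ideal.span (UniversalEnvelopingAlgebra.ι k '' (h : Set g))).restrictScalars k ≤
      LinearMap.ker ((LinearMap.applyₗ (one k h ⊗ₜ[k] one k h)).comp
        (UniversalEnvelopingAlgebra.lift k
          (LieModule.toEnd k g (Ind k h ⊗[k] Ind k h))).toLinearMap) := by
  intro u hu
  rw [Submodule.restrictScalars_mem] at hu
  rw [LinearMap.mem_ker]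
  change UniversalEnvelopingAlgebra.lift k (LieModule.toEnd k g (Ind k h ⊗[k] Ind k h)) u
    (one k h ⊗ₜ[k] one k h) = 0
  induction hu using Submodule.span_induction with
  | mem u hu =>
    obtain ⟨x, hx, rfl⟩ := hu
    have h0 : ⁅x, one k h⁆ = 0 := by
      change (UniversalEnvelopingAlgebra.ι k x • one k h : Ind k h) = 0
      unfold one
      erw [← Submodule.Quotient.mk_smul]
      rw [smul_eq_mul, mul_one]
      exact (Submodule.Quotient.mk_eq_zero _).2 (Ideal.subset_span ⟨x, hx, rfl⟩)
    rw [UniversalEnvelopingAlgebra.lift_ι_apply, LieModule.toEnd_apply_apply,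
      TensorProduct.LieModule.lie_tmul_right, h0]
    simp
  | zero => simp
  | add u u' _ _ h1 h2 => rw [map_add, LinearMap.add_apply, h1, h2, add_zero]
  | smul a u _ h1 => rw [smul_eq_mul, map_mul, Module.End.mul_apply, h1, map_zero]

/-- the homomorphism of `g`-modules `Ind → Ind ⊗ Ind` mapping the generator `1` to `1 ⊗ 1` -/
def comul : Ind k h →ₗ[k] Ind k h ⊗[k] Ind k h :=
  (Submodule.liftQ _ _ (comul_aux k h)).comp
    (Submodule.Quotient.restrictScalarsEquiv k
      (Ideal.span (UniversalEnvelopingAlgebra.ι k '' (h : Set g)))).symm.toLinearMap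

theorem comul_one : comul k h (one k h) = one k h ⊗ₜ[k] one k h := by
  change UniversalEnvelopingAlgebra.lift k (LieModule.toEnd k g (Ind k h ⊗[k] Ind k h)) 1
    (one k h ⊗ₜ[k] one k h) = _
  rw [map_one, Module.End.one_apply]

theorem comul_lie (x : g) (m : Ind k h) : comul k h ⁅x, m⁆ = ⁅x, comul k h m⁆ := by
  obtain ⟨u, rfl⟩ := Submodule.Quotient.mk_surjective _ m
  change UniversalEnvelopingAlgebra.lift k (LieModule.toEnd k g (Ind k h ⊗[k] Ind k h))
    (UniversalEnvelopingAlgebra.ι k x * u) (one k h ⊗ₜ[k] one k h) =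
    ⁅x, UniversalEnvelopingAlgebra.lift k (LieModule.toEnd k g (Ind k h ⊗[k] Ind k h)) u
      (one k h ⊗ₜ[k] one k h)⁆
  rw [map_mul, Module.End.mul_apply, UniversalEnvelopingAlgebra.lift_ι_apply,
    LieModule.toEnd_apply_apply]

end Ind

end Induced

/-! ### Drinfeld's element `T` -/

section DrinfeldT

open PowerSeries

variable {k : Type u} {g : Type v} [Field k] [LieRing g] [LieAlgebra k g]

/-- The element `T ∈ (U(g) ⊗ U(g))[[ħ]]` (completed tensor product) satisfying
`S^{⊗3}(Φ^{321}) (T ⊗ 1) (Δ ⊗ 1)(T) = (1 ⊗ T) (1 ⊗ Δ)(T) Φ` and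
`T Δ(S(a)) = (S ⊗ S)(Δ(a)) T`, normalized by `T ≡ 1` modulo `ħ²` (so that `T` is invertible).

Elements of the completed tensor square are natural endomorphisms of `(X, Y) ↦ X ⊗ Y` on
equicontinuous modules. Only the action of `T` on functionals is used, that is, the operators
`S^{⊗2}(T)`, which are recorded in `series`; the equations above are written out after applying
the anti-automorphism `S^{⊗3}`, resp. `S^{⊗2}`. As `S^{⊗3}` fixes `Ω₁₂` and `Ω₂₃`, the element
`S^{⊗3}(Φ)` is `Φ` with all words reversed. -/
structure DrinfeldT (M : ManinTriple k g) (Φ : LieAssociator k) where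
  series : ∀ X Y : TMod.{u, v, max u v} k g, PowerSeries (tens X Y →L[k] tens X Y)
  natural : ∀ X Y X' Y' : TMod.{u, v, max u v} k g, X.IsEquicontinuous M → Y.IsEquicontinuous M →
    X'.IsEquicontinuous M → Y'.IsEquicontinuous M →
    ∀ (f : X →L[k] X') (f' : Y →L[k] Y'), (∀ x t, f (X.act x t) = X'.act x (f t)) →
    (∀ x t, f' (Y.act x t) = Y'.act x (f' t)) →
    ∀ n, (mapT f f').comp (coeff n (series X Y)) = (coeff n (series X' Y')).comp (mapT f f')
  invariant : ∀ X Y : TMod.{u, v, max u v} k g, X.IsEquicontinuous M → Y.IsEquicontinuous M →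
    ∀ n x t, coeff n (series X Y) ((tens X Y).act x t) =
      (tens X Y).act x (coeff n (series X Y) t)
  cocycle : ∀ X Y Z : TMod.{u, v, max u v} k g, X.IsEquicontinuous M → Y.IsEquicontinuous M →
    Z.IsEquicontinuous M →
    series (tens X Y) Z *
        PowerSeries.mk (fun n =>
          mapT (coeff n (series X Y)) (ContinuousLinearMap.id k Z)) *
        evalFree Φ.series.1 (M.Omega23 X Y Z) (M.Omega12 X Y Z) =
      evalFree (PowerSeries.mk fun n => star (coeff n Φ.series.1))
          (M.Omega12 X Y Z) (M.Omega23 X Y Z) *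
        PowerSeries.mk (fun n => (assocInvT X Y Z).comp
          ((coeff n (series X (tens Y Z))).comp (assocT X Y Z))) *
        PowerSeries.mk (fun n => (assocInvT X Y Z).comp
          ((mapT (ContinuousLinearMap.id k X) (coeff n (series Y Z))).comp (assocT X Y Z)))
  coeff_zero : ∀ X Y, coeff 0 (series X Y) = ContinuousLinearMap.id k (tens X Y)
  coeff_one : ∀ X Y, coeff 1 (series X Y) = 0

end DrinfeldT

/-! ### Split inclusions of Manin triples -/

section Split

variable {k : Type u} {g : Type v} {gD : Type v'} [Field k] [LieRing g] [LieAlgebra k g]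
  [LieRing gD] [LieAlgebra k gD]

/-- A split embedding of Manin triples: a continuous homomorphism of Lie algebras preserving the
forms and the polarizations, such that `m_± = g_± ∩ i(g_D)^⊥` are Lie subalgebras. -/
structure SplitEmbedding (MD : ManinTriple k gD) (M : ManinTriple k g) where
  hom : gD →ₗ⁅k⁆ g
  form_map : ∀ x y, M.form (hom x) (hom y) = MD.form x y
  map_gm : ∀ x ∈ MD.gm, hom x ∈ M.gm
  map_gp : ∀ x ∈ MD.gp, hom x ∈ M.gp
  continuous : @Continuous gD g MD.top M.top hom
  split_gm : ∀ x ∈ M.gm.toSubmodule ⊓ M.form.orthogonal (LinearMap.range (hom : gD →ₗ[k] g)),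
    ∀ y ∈ M.gm.toSubmodule ⊓ M.form.orthogonal (LinearMap.range (hom : gD →ₗ[k] g)),
      ⁅x, y⁆ ∈ M.gm.toSubmodule ⊓ M.form.orthogonal (LinearMap.range (hom : gD →ₗ[k] g))
  split_gp : ∀ x ∈ M.gp.toSubmodule ⊓ M.form.orthogonal (LinearMap.range (hom : gD →ₗ[k] g)),
    ∀ y ∈ M.gp.toSubmodule ⊓ M.form.orthogonal (LinearMap.range (hom : gD →ₗ[k] g)),
      ⁅x, y⁆ ∈ M.gp.toSubmodule ⊓ M.form.orthogonal (LinearMap.range (hom : gD →ₗ[k] g))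

namespace SplitEmbedding

variable {MD : ManinTriple k gD} {M : ManinTriple k g} (i : SplitEmbedding MD M)

/-- `m_- = g_- ∩ i(g_D)^⊥` -/
def mMinus : Submodule k g :=
  M.gm.toSubmodule ⊓ M.form.orthogonal (LinearMap.range (i.hom : gD →ₗ[k] g))

/-- `m_+ = g_+ ∩ i(g_D)^⊥` -/
def mPlus : Submodule k g :=
  M.gp.toSubmodule ⊓ M.form.orthogonal (LinearMap.range (i.hom : gD →ₗ[k] g))

/-- `p_+ = m_+ ⊕ i(g_D)` -/
def pPlus : Submodule k g := i.mPlus ⊔ LinearMap.range (i.hom : gD →ₗ[k] g)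

/-- the relative Verma module `L_- = Ind_{p_+}^g k` (with the discrete topology) -/
abbrev LMinus : Type (max u v) := Ind k i.pPlus

/-- the relative Verma module `N_+ = Ind_{m_-}^g k` -/
abbrev NPlus : Type (max u v) := Ind k i.mMinus

/-- the vector `x₁ x₂ ⋯ x_n 1_+` of `N_+` -/
def word (l : List g) : i.NPlus := l.foldr (fun x m => ⁅x, m⁆) (Ind.one k i.mMinus)

/-- the image of `U_n(p_+)`, spanned by products of at most `n` elements of `p_+`, in `N_+` -/
def filt (n : ℕ) : Submodule k i.NPlus :=
  Submodule.span k {z | ∃ l : List g, l.length ≤ n ∧ (∀ x ∈ l, x ∈ i.pPlus) ∧ z = i.word l}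

/-- Continuity of a linear functional on `N_+ ≃ U(p_+) ≃ U(g_+) ⊗ U(g_{D,-})`: for all `p`, `q`, its
pull-back along the multiplication map `g_+^{⊗p} ⊗ g_{D,-}^{⊗q} → N_+` is continuous, where `g_+^{⊗p}`
has the weak topology induced from `(g_-^{⊗p})^*` and `g_{D,-}^{⊗q}` is discrete. That is, it vanishes
as soon as one of the factors from `g_+` annihilates a suitable finite subset of `g_-`. -/
def IsCont (f : Module.Dual k i.NPlus) : Prop :=
  ∀ p q : ℕ, ∃ S : Finset g, (∀ s ∈ S, s ∈ M.gm) ∧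
    ∀ lx ly : List g, lx.length = p → ly.length = q → (∀ x ∈ lx, x ∈ M.gp) →
      (∀ y ∈ ly, ∃ z ∈ MD.gm, i.hom z = y) →
      (∃ x ∈ lx, ∀ s ∈ S, M.form x s = 0) → f (i.word (lx ++ ly)) = 0

/-- the space of continuous functionals on `N_+` -/
def NStar : Submodule k (Module.Dual k i.NPlus) where
  carrier := {f | i.IsCont f}
  zero_mem' := fun p q => ⟨∅, by simp, fun _ _ _ _ _ _ _ => rfl⟩
  add_mem' := by
    classical
    intro f f' hf hf' p q
    obtain ⟨S, hS, h⟩ := hf p q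
    obtain ⟨S', hS', h'⟩ := hf' p q
    refine ⟨S ∪ S', fun s hs => ?_, fun lx ly h1 h2 h3 h4 h5 => ?_⟩
    · exact (Finset.mem_union.1 hs).elim (hS s) (hS' s)
    · obtain ⟨x, hx, hxs⟩ := h5
      rw [LinearMap.add_apply,
        h lx ly h1 h2 h3 h4 ⟨x, hx, fun s hs => hxs s (Finset.mem_union_left _ hs)⟩,
        h' lx ly h1 h2 h3 h4 ⟨x, hx, fun s hs => hxs s (Finset.mem_union_right _ hs)⟩, add_zero]
  smul_mem' := by
    intro c f hf p q
    obtain ⟨S, hS, h⟩ := hf p q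
    refine ⟨S, hS, fun lx ly h1 h2 h3 h4 h5 => ?_⟩
    rw [LinearMap.smul_apply, h lx ly h1 h2 h3 h4 h5, smul_zero]

/-- the subspace `(N_+^*)_n` of functionals vanishing on `U_n(p_+)` -/
def NStarFilt (n : ℕ) : Submodule k i.NStar where
  carrier := {f | ∀ z ∈ i.filt n, f.1 z = 0}
  zero_mem' := fun _ _ => rfl
  add_mem' := fun {f f'} hf hf' z hz => by
    change f.1 z + f'.1 z = 0
    rw [hf z hz, hf' z hz, add_zero]
  smul_mem' := fun c f hf z hz => by
    change c • f.1 z = 0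
    rw [hf z hz, smul_zero]

instance : UniformSpace i.NStar := linearUniformity i.NStarFilt
instance : IsUniformAddGroup i.NStar := linearUniformity_isUniformAddGroup _
instance : UniformContinuousConstSMul k i.NStar := linearUniformity_uniformContinuousConstSMul _

open Classical in
/-- the contragredient action of `x ∈ g`: the continuous operator on `N_+^*` with
`(x f)(n) = - f (x n)` -/
def actNStar (x : g) : i.NStar →L[k] i.NStar :=
  if h : ∃ F : i.NStar →L[k] i.NStar, ∀ f n, (F f).1 n = - f.1 ⁅x, n⁆ then h.choose else 0

/-- the `g`-module `N_+^*` of continuous functionals on `N_+`, topologized by the `(N_+^*)_n` -/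
@[reducible] def P : TMod.{u, v, max u v} k g where
  carrier := i.NStar
  act := i.actNStar

open Classical in
/-- the continuous extension `N_+^* ⊗ N_+^* → N_+^*` of `(f ⊗ f') ↦ (n ↦ (f ⊗ f')(i_+(n)))` -/
def iPlusStar : tens i.P i.P →L[k] i.P :=
  if h : ∃ F : CTensor i.P i.P →L[k] i.NStar, ∀ (f f' : i.NStar) n, (F (ptens f f')).1 n =
    TensorProduct.lid k k (TensorProduct.map f.1 f'.1 (Ind.comul k i.mMinus n))
  then h.choose else 0

/-- `i_+^∨ ∈ Hom(N_+^* ⊗ N_+^*, N_+^*)[[ħ]]`, `i_+^∨(f ⊗ f')(n) = (f' ⊗ f)(T · i_+(n))` -/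
def iPlusVee {Φ : LieAssociator k} (T : DrinfeldT M Φ) : HSeries (tens i.P i.P) i.P :=
  HSeries.comp (HSeries.const i.iPlusStar)
    (HSeries.comp (fun n => PowerSeries.coeff n (T.series i.P i.P))
      (HSeries.const (swapT i.P i.P)))

/-! ### The functor `Γ` and its tensor structure -/

variable (V : TMod.{u, v, w} k g) (W : TMod.{u, v, w'} k g)

/-- `Hom_k(L_-, N_+^* ⊗ V)[[ħ]]`; since `L_-` is discrete, all linear maps are continuous -/
abbrev HomL : Type (max u v w) := ℕ → (i.LMinus →ₗ[k] tens i.P V)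

/-- `Γ(V) = Hom_g(L_-, N_+^* ⊗ V)[[ħ]]` -/
def Gam : Set (i.HomL V) :=
  {f | ∀ n x l, f n ⁅x, l⁆ = (tens i.P V).act x (f n l)}

/-- evaluation `f ⊗ v ↦ f(1_+) v` at the generator of `N_+` -/
def evOne : tens i.P V →L[k] V :=
  desc (X := i.P) (Y := V) fun f t => (f : i.NStar).1 (Ind.one k i.mMinus) • t

/-- `α_V(f) = (1_+ ⊗ 1) f(1_-)` -/
def alpha (f : i.HomL V) : ℕ → V := fun n => i.evOne V (f n (Ind.one k i.pPlus))

variable {V W}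

/-- the composition `L_- → L_- ⊗ L_- → (N_+^* ⊗ V) ⊗ (N_+^* ⊗ W)` of `i_-` and `f ⊗ f'` -/
def preJ (f : i.LMinus →ₗ[k] tens i.P V) (f' : i.LMinus →ₗ[k] tens i.P W) :
    i.LMinus →ₗ[k] tens (tens i.P V) (tens i.P W) :=
  ((ofAlg (tens i.P V) (tens i.P W)).comp (TensorProduct.map f f')).comp (Ind.comul k i.pPlus)

variable (V W)

/-- the two possible ways of rebracketing a fourfold tensor product -/
inductive Bracketing
  /-- through `X₁ ⊗ ((X₂ ⊗ X₃) ⊗ X₄)` -/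
  | inner
  /-- through `(X₁ ⊗ (X₂ ⊗ X₃)) ⊗ X₄` -/
  | outer

/-- the morphism `(N_+^* ⊗ V) ⊗ (N_+^* ⊗ W) → (N_+^* ⊗ N_+^*) ⊗ (V ⊗ W)` obtained by rebracketing,
applying the inverse braiding to the middle factors, and rebracketing back -/
def middle (Φ : LieAssociator k) : Bracketing →
    HSeries (tens (tens i.P V) (tens i.P W)) (tens (tens i.P i.P) (tens V W))
  | .inner =>
    HSeries.comp (M.assocInv i.P i.P (tens V W) Φ) <|
    HSeries.comp (HSeries.tensLeft i.P (M.assoc i.P V W Φ)) <|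
    HSeries.comp (HSeries.tensLeft i.P (HSeries.tensRight (M.braidInv i.P V) W)) <|
    HSeries.comp (HSeries.tensLeft i.P (M.assocInv V i.P W Φ)) <|
    M.assoc i.P V (tens i.P W) Φ
  | .outer =>
    HSeries.comp (M.assoc (tens i.P i.P) V W Φ) <|
    HSeries.comp (HSeries.tensRight (M.assocInv i.P i.P V Φ) W) <|
    HSeries.comp (HSeries.tensRight (HSeries.tensLeft i.P (M.braidInv i.P V)) W) <|
    HSeries.comp (HSeries.tensRight (M.assoc i.P V i.P Φ) W) <|
    M.assocInv (tens i.P V) i.P W Φ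

variable {V W}

/-- the tensor structure `J_{VW}(f ⊗ f')`, extended `k[[ħ]]`-bilinearly -/
def J {Φ : LieAssociator k} (T : DrinfeldT M Φ) (c : Bracketing) (f : i.HomL V) (f' : i.HomL W) :
    i.HomL (tens V W) := fun n =>
  ∑ p ∈ Finset.HasAntidiagonal.antidiagonal n, ∑ q ∈ Finset.HasAntidiagonal.antidiagonal p.2,
    ((HSeries.comp (HSeries.tensRight (i.iPlusVee T) (tens V W)) (i.middle V W Φ c) p.1 :
      tens (tens i.P V) (tens i.P W) →L[k] tens i.P (tens V W)) :
        tens (tens i.P V) (tens i.P W) →ₗ[k] tens i.P (tens V W)).comp (i.preJ (f q.1) (f' q.2))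

variable (V W)

/-- the relative twist `α_{V ⊗ W} ∘ J ∘ (α_V⁻¹ ⊗ α_W⁻¹)` on `v ⊗ w`, for `v ∈ V[[ħ]]` and
`w ∈ W[[ħ]]` in the images of `α_V` and `α_W` -/
def twist {Φ : LieAssociator k} (T : DrinfeldT M Φ) (c : Bracketing) (x : ℕ → V) (y : ℕ → W) :
    ℕ → tens V W :=
  i.alpha (tens V W) (i.J T c (Function.invFunOn (i.alpha V) (i.Gam V) x)
    (Function.invFunOn (i.alpha W) (i.Gam W) y))

/-- `Alt₂` of the relative twist, `(J - J²¹) / 2` with `J²¹ = (12) ∘ J ∘ (12)` -/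
def altTwist {Φ : LieAssociator k} (T : DrinfeldT M Φ) (c : Bracketing) (x : ℕ → V) (y : ℕ → W) :
    ℕ → tens V W :=
  fun n => (2 : k)⁻¹ • (i.twist V W T c x y n - swapT W V (i.twist W V T c y x n))

/-- `r_D = ∑ i(a_j) ⊗ i(b^j)` over a basis `(a_j)` of `g_{D,-}` -/
def rD : tens V W →L[k] tens V W :=
  sumOp (fun j => i.hom (MD.a j)) (fun j => i.hom (MD.b j)) V W

/-- `r_D²¹ = ∑ i(b^j) ⊗ i(a_j)` -/
def rD21 : tens V W →L[k] tens V W :=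
  sumOp (fun j => i.hom (MD.b j)) (fun j => i.hom (MD.a j)) V W

end SplitEmbedding

end Split

end

end RelTwist

namespace RelTwist

noncomputable section

open scoped TensorProduct Topology
open Filter

/-! ### Linear topologies -/

section LinTop

/-! Evaluating the first factor at vectors z of N_+ turns an element t of N_+^* ⊗ V into a linear
map N_+ → V, and these slices determine t (`sliceEv_ext`). The action of g becomes the usual one on
linear maps. A morphism f from L_- is determined by f(1_-), which is a p_+-invariant tensor, that
is, a p_+-equivariant map N_+ → V. As g = p_+ ⊕ m_- and m_- kills 1_+, the module N_+ is spanned by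
words in p_+ applied to 1_+. An equivariant map is therefore fixed by its value at 1_+, which is
α_V(f), so α_V is injective (`eq_of_invariant`, `injOn_alpha`).

For surjectivity, N_+ maps p_+-equivariantly to U(p_+) with 1_+ ↦ 1 (`exists_ind_to_uea`), so every
v in V is the value at 1_+ of an equivariant map F. If g_D is finite-dimensional, then modulo an
open subspace of V the restriction of F to each filtration step has finite rank, with coordinates
that are continuous functionals. So F is approximated by finite sums of pure tensors
(`exists_approx`), and completeness produces the tensor (`exists_sliceEv_eq`).

Identities in topological tensor products are tested by pairs of functionals l, m with open kernels
(`eq_of_functionals`). A matrix coefficient z ↦ l(z x) is continuous on g and hence equals (z, p)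
for some p in g. If p and q represent the coefficients of x and y, then Ω has the coefficient (p, q)
on x ⊗ y, and r has (p_+, q_-). All convergent sums thus become finite computations in g, and
equivariance of Ω is invariance of the form. The constraints are built from Ω, flips and
rebracketings, and T is invariant by assumption, so J takes values in Γ(V ⊗ W).

For the 1-jet, the pentagon forces Φ to be 1 modulo ħ², and T is 1 modulo ħ² by normalization; only
-Ω/2 from the inverse braiding survives. Evaluation at 1_+ after i_+^∨ splits into two evaluations
at 1_+, because i_+(1_+) = 1_+ ⊗ 1_+. With x = α(f), y = α(f') and p representing l on x, slicing
the term of order ħ by l gives half the value of f'(1_-), viewed as a map N_+ → W, at p · 1_+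
(`slice_contract_Omega`). Write p = p_+ + i(z) + m with z in g_{D,-} and m in m_-. The last part
kills 1_+, and equivariance moves p_+ + i(z) onto y. The component p_+ accounts for r and i(z) for
r_D^{21} (`contract_Omega`). The alternation follows because the flip exchanges r with r^{21} and
r_D with r_D^{21}.

The analytic groundwork is that N_+^* is a complete equicontinuous module with a continuous product.
Its main point is that g preserves continuity of functionals, which is proved by moving letters
through words (`IsCont.insert_gm`). -/

/-- The open subspaces form a basis of neighbourhoods of zero. -/
def IsLinTop (k : Type*) (Z : Type*) [Field k] [AddCommGroup Z] [Module k Z]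
    [TopologicalSpace Z] : Prop :=
  ∀ s ∈ 𝓝 (0 : Z), ∃ U : Submodule k Z, IsOpen (U : Set Z) ∧ (U : Set Z) ⊆ s

variable {k : Type*} {E : Type*} {ι : Type*} [Field k] [AddCommGroup E] [Module k E]

theorem linearUniformity_nhds_zero (P : ι → Submodule k E) :
    @nhds E (linearUniformity P).toTopologicalSpace 0 = ⨅ j, 𝓟 (P j : Set E) := by
  rw [linearUniformity, UniformSpace.toTopologicalSpace_iInf, nhds_iInf]
  refine iInf_congr fun j => ?_
  let _ : UniformSpace (E ⧸ P j) := ⊥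
  have : DiscreteUniformity (E ⧸ P j) := ⟨rfl⟩
  have : 𝓝 ((P j).mkQ 0) = pure 0 := by rw [map_zero, nhds_discrete]
  rw [UniformSpace.toTopologicalSpace_comap, nhds_induced, this, ← principal_singleton,
    comap_principal]
  congr 1
  ext x
  simp

theorem linearUniformity_mem_nhds_zero [Nonempty ι] (P : ι → Submodule k E)
    (hP : Directed (· ≥ ·) P) (s : Set E) :
    s ∈ @nhds E (linearUniformity P).toTopologicalSpace 0 ↔ ∃ j, (P j : Set E) ⊆ s := by
  rw [linearUniformity_nhds_zero, mem_iInf_of_directed]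
  · simp
  · intro a b
    obtain ⟨c, h1, h2⟩ := hP a b
    exact ⟨c, principal_mono.2 h1, principal_mono.2 h2⟩

theorem isOpen_submodule_of_mem_nhds [TopologicalSpace E] [IsTopologicalAddGroup E]
    (U : Submodule k E) (h : (U : Set E) ∈ 𝓝 (0 : E)) : IsOpen (U : Set E) :=
  U.toAddSubgroup.isOpen_of_mem_nhds h

theorem isClosed_of_isOpen_submodule [TopologicalSpace E] [IsTopologicalAddGroup E]
    (U : Submodule k E) (h : IsOpen (U : Set E)) : IsClosed (U : Set E) :=
  U.toAddSubgroup.isClosed_of_isOpen h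

theorem isOpen_submodule_mono [TopologicalSpace E] [IsTopologicalAddGroup E]
    {U V : Submodule k E} (hUV : U ≤ V) (h : IsOpen (U : Set E)) : IsOpen (V : Set E) :=
  isOpen_submodule_of_mem_nhds V (mem_of_superset (h.mem_nhds U.zero_mem) hUV)

theorem linearUniformity_isOpen (P : ι → Submodule k E) (j : ι) :
    IsOpen[(linearUniformity P).toTopologicalSpace] (P j : Set E) := by
  let _ := linearUniformity P
  have := linearUniformity_isUniformAddGroup P
  refine isOpen_submodule_of_mem_nhds (P j) ?_
  rw [linearUniformity_nhds_zero]
  exact mem_iInf_of_mem j (mem_principal_self _)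

theorem IsLinTop.eq_zero [TopologicalSpace E] [T2Space E] (hE : IsLinTop k E) {x : E}
    (h : ∀ U : Submodule k E, IsOpen (U : Set E) → x ∈ U) : x = 0 := by
  by_contra hx
  obtain ⟨U, hU, hs⟩ := hE {x}ᶜ (isOpen_compl_singleton.mem_nhds (Ne.symm hx))
  exact hs (h U hU) rfl

/-- Makes available the criterion that a family tending to zero along the cofinite filter is
summable in a complete space. -/
theorem IsLinTop.nonarchimedean [TopologicalSpace E] [IsTopologicalAddGroup E]
    (hE : IsLinTop k E) : NonarchimedeanAddGroup E where
  is_nonarchimedean s hs := by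
    obtain ⟨U, hU, hUs⟩ := hE s hs
    exact ⟨⟨U.toAddSubgroup, hU⟩, hUs⟩

/-- A functional with open kernel, vanishing on a given open subspace but not at a given vector
outside of it. -/
theorem exists_functional_ne_zero (U : Submodule k E) {x : E} (hx : x ∉ U) :
    ∃ l : Module.Dual k E, (∀ u ∈ U, l u = 0) ∧ l x ≠ 0 := by
  obtain ⟨l, h1, h2⟩ := Submodule.exists_dual_map_eq_bot_of_notMem hx inferInstance
  refine ⟨l, fun u hu => ?_, h1⟩
  have : l u ∈ U.map l := ⟨u, hu, rfl⟩
  rw [h2] at this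
  exact this

theorem IsLinTop.eq_zero_of_functional [TopologicalSpace E] [IsTopologicalAddGroup E] [T2Space E]
    (hE : IsLinTop k E) {x : E}
    (h : ∀ l : Module.Dual k E, IsOpen (LinearMap.ker l : Set E) → l x = 0) : x = 0 := by
  refine hE.eq_zero fun U hU => ?_
  by_contra hx
  obtain ⟨l, h1, h2⟩ := exists_functional_ne_zero U hx
  exact h2 (h l (isOpen_submodule_mono (fun u hu => h1 u hu) hU))

theorem IsLinTop.continuous_of_open {F : Type*} [AddCommGroup F] [Module k F]
    [TopologicalSpace E] [IsTopologicalAddGroup E] [TopologicalSpace F] [IsTopologicalAddGroup F]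
    (hF : IsLinTop k F) (f : E →ₗ[k] F)
    (h : ∀ U : Submodule k F, IsOpen (U : Set F) → IsOpen (U.comap f : Set E)) :
    Continuous f := by
  refine continuous_of_continuousAt_zero f.toAddMonoidHom ?_
  intro s hs
  change s ∈ 𝓝 (f 0) at hs
  rw [map_zero] at hs
  obtain ⟨U, hU, hUs⟩ := hF s hs
  exact mem_of_superset ((h U hU).mem_nhds (by simp)) fun x hx => hUs hx

/-- A functional with open kernel on a convergent sum is computed by large finite partial sums. -/
theorem functional_hasSum [TopologicalSpace E] [IsTopologicalAddGroup E] {u : ι → E} {s : E}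
    (h : HasSum u s) (l : Module.Dual k E) (hl : IsOpen (LinearMap.ker l : Set E)) :
    ∃ F₀ : Finset ι, ∀ F, F₀ ⊆ F → l s = ∑ i ∈ F, l (u i) := by
  have h1 : Tendsto (fun F : Finset ι => ∑ i ∈ F, u i - s) atTop (𝓝 (s - s)) :=
    Tendsto.sub_const h s
  rw [sub_self] at h1
  have h2 := h1 (hl.mem_nhds (LinearMap.ker l).zero_mem)
  obtain ⟨F₀, h3⟩ := mem_atTop_sets.1 h2
  refine ⟨F₀, fun F hF => ?_⟩
  have h4 : l (∑ i ∈ F, u i - s) = 0 := h3 F hF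
  rw [map_sub, map_sum, sub_eq_zero] at h4
  exact h4.symm

end LinTop

/-! ### Topological tensor products -/

section Tensor

variable {k : Type u} {g : Type v} [Field k]

/-- the open subspaces -/
abbrev OpenSub (X : TMod.{u, v, w} k g) : Type w := {U : Submodule k X // IsOpen (U : Set X)}

instance (X : TMod.{u, v, w} k g) : Nonempty (OpenSub X) := ⟨⟨⊤, isOpen_univ⟩⟩

/-- intersection of open subspaces -/
def interSub {X : TMod.{u, v, w} k g} (U V : OpenSub X) : OpenSub X :=
  ⟨U.1 ⊓ V.1, U.2.inter V.2⟩

/-- preimage of an open subspace under a continuous linear map -/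
def comapSub {X : TMod.{u, v, w} k g} {Y : TMod.{u, v, w'} k g} (f : X →L[k] Y) (U : OpenSub Y) :
    OpenSub X :=
  ⟨U.1.comap (f : X →ₗ[k] Y), U.2.preimage f.continuous⟩

section Basic

variable (X : TMod.{u, v, w} k g) (Y : TMod.{u, v, w'} k g)

theorem tmul_mem_basic_left {p : OpenSub X × OpenSub Y} {x : X} (hx : x ∈ p.1.1) (y : Y) :
    (TensorProduct.tmul k x y : TensorProduct k X Y) ∈ AlgTensor.basic X Y p := by
  change TensorProduct.map p.1.1.mkQ p.2.1.mkQ (x ⊗ₜ y) = 0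
  rw [TensorProduct.map_tmul, Submodule.mkQ_apply, (Submodule.Quotient.mk_eq_zero _).2 hx,
    TensorProduct.zero_tmul]

theorem tmul_mem_basic_right {p : OpenSub X × OpenSub Y} (x : X) {y : Y} (hy : y ∈ p.2.1) :
    (TensorProduct.tmul k x y : TensorProduct k X Y) ∈ AlgTensor.basic X Y p := by
  change TensorProduct.map p.1.1.mkQ p.2.1.mkQ (x ⊗ₜ y) = 0
  rw [TensorProduct.map_tmul, Submodule.mkQ_apply p.2.1, (Submodule.Quotient.mk_eq_zero _).2 hy,
    TensorProduct.tmul_zero]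

/-- `ker (X ⊗ Y → X/U ⊗ Y/U')` is spanned by `U ⊗ Y` and `X ⊗ U'`. -/
theorem basic_le {p : OpenSub X × OpenSub Y} {Q : Submodule k (TensorProduct k X Y)}
    (h1 : ∀ x ∈ p.1.1, ∀ y, x ⊗ₜ y ∈ Q) (h2 : ∀ x, ∀ y ∈ p.2.1, x ⊗ₜ y ∈ Q) :
    (AlgTensor.basic X Y p : Submodule k (TensorProduct k X Y)) ≤ Q := by
  have h : LinearMap.ker (TensorProduct.map p.1.1.mkQ p.2.1.mkQ) = _ :=
    TensorProduct.map_ker (f := p.1.1.subtype) (g := p.1.1.mkQ)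
    (f' := p.2.1.subtype) (g' := p.2.1.mkQ)
    (LinearMap.exact_subtype_mkQ _) (Submodule.mkQ_surjective _)
    (LinearMap.exact_subtype_mkQ _) (Submodule.mkQ_surjective _)
  change LinearMap.ker (TensorProduct.map p.1.1.mkQ p.2.1.mkQ) ≤ Q
  rw [h]
  refine sup_le ?_ ?_
  · rintro _ ⟨t, rfl⟩
    induction t with
    | zero => simp
    | add a b ha hb => rw [map_add]; exact Q.add_mem ha hb
    | tmul a b => exact h2 a _ b.2
  · rintro _ ⟨t, rfl⟩
    induction t with
    | zero => simp
    | add a b ha hb => rw [map_add]; exact Q.add_mem ha hb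
    | tmul a b => exact h1 _ a.2 b

theorem basic_mono {p q : OpenSub X × OpenSub Y} (h1 : p.1.1 ≤ q.1.1) (h2 : p.2.1 ≤ q.2.1) :
    AlgTensor.basic X Y p ≤ AlgTensor.basic X Y q :=
  basic_le X Y (fun _ hx y => tmul_mem_basic_left X Y (h1 hx) y)
    (fun x _ hy => tmul_mem_basic_right X Y x (h2 hy))

theorem basic_directed : Directed (· ≥ ·) (AlgTensor.basic X Y) := fun p q =>
  ⟨(interSub p.1 q.1, interSub p.2 q.2), basic_mono X Y inf_le_left inf_le_left,
    basic_mono X Y inf_le_right inf_le_right⟩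

theorem algTensor_mem_nhds_zero (s : Set (AlgTensor X Y)) :
    s ∈ 𝓝 (0 : AlgTensor X Y) ↔ ∃ p, (AlgTensor.basic X Y p : Set (AlgTensor X Y)) ⊆ s :=
  linearUniformity_mem_nhds_zero _ (basic_directed X Y) s

/-- the closure of `ker (X ⊗ Y → X/U ⊗ Y/U')` in the topological tensor product -/
def cbasic (p : OpenSub X × OpenSub Y) : Submodule k (CTensor X Y) :=
  (Submodule.map (ofAlg X Y)
    (AlgTensor.basic X Y p : Submodule k (TensorProduct k X Y))).topologicalClosure

variable {X Y}

/-- The closure of the image of a neighbourhood under a dense inducing map is a neighbourhood. -/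
theorem isOpen_cbasic (p : OpenSub X × OpenSub Y) : IsOpen (cbasic X Y p : Set (CTensor X Y)) := by
  refine isOpen_submodule_of_mem_nhds _ ?_
  have h := (UniformSpace.Completion.isDenseInducing_coe
    (α := AlgTensor X Y)).closure_image_mem_nhds
    ((algTensor_mem_nhds_zero X Y (AlgTensor.basic X Y p)).2 ⟨p, subset_rfl⟩)
  exact h

/-- The completion is regular, so a neighbourhood of zero contains a closed one. Its preimage
contains a basic subspace of the algebraic tensor product, and closedness lets one pass to the
closure. -/
theorem cbasic_isLinTop (s : Set (CTensor X Y)) (hs : s ∈ 𝓝 (0 : CTensor X Y)) :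
    ∃ p, (cbasic X Y p : Set (CTensor X Y)) ⊆ s := by
  obtain ⟨t, ht, htc, hts⟩ := exists_mem_nhds_isClosed_subset hs
  have h1 : (fun a : AlgTensor X Y => (a : CTensor X Y)) ⁻¹' t ∈ 𝓝 (0 : AlgTensor X Y) :=
    (UniformSpace.Completion.continuous_coe (AlgTensor X Y)).continuousAt.preimage_mem_nhds
      (by rwa [UniformSpace.Completion.coe_zero])
  obtain ⟨p, hp⟩ := (algTensor_mem_nhds_zero X Y _).1 h1
  refine ⟨p, (closure_minimal ?_ htc).trans hts⟩
  rintro _ ⟨a, ha, rfl⟩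
  exact hp ha

theorem isLinTop_tens : IsLinTop k (CTensor X Y) := fun s hs => by
  obtain ⟨p, hp⟩ := cbasic_isLinTop s hs
  exact ⟨_, isOpen_cbasic p, hp⟩

theorem ptens_mem_cbasic_left {p : OpenSub X × OpenSub Y} {x : X} (hx : x ∈ p.1.1) (y : Y) :
    ptens x y ∈ cbasic X Y p :=
  Submodule.le_topologicalClosure _ ⟨_, tmul_mem_basic_left X Y hx y, rfl⟩

theorem ptens_mem_cbasic_right {p : OpenSub X × OpenSub Y} (x : X) {y : Y} (hy : y ∈ p.2.1) :
    ptens x y ∈ cbasic X Y p :=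
  Submodule.le_topologicalClosure _ ⟨_, tmul_mem_basic_right X Y x hy, rfl⟩

theorem ofAlg_mem_cbasic {p : OpenSub X × OpenSub Y} {t : TensorProduct k X Y}
    (ht : t ∈ AlgTensor.basic X Y p) : ofAlg X Y t ∈ cbasic X Y p :=
  Submodule.le_topologicalClosure _ ⟨_, ht, rfl⟩

/-- Reduces inclusions between subspaces of the completion to pure tensors. The target has to be
closed because `cbasic` is a closure; open subspaces are closed, so this is no restriction in the
applications. -/
theorem cbasic_le {p : OpenSub X × OpenSub Y} {Q : Submodule k (CTensor X Y)}
    (hQ : IsClosed (Q : Set (CTensor X Y)))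
    (h1 : ∀ x ∈ p.1.1, ∀ y, ptens x y ∈ Q) (h2 : ∀ x, ∀ y ∈ p.2.1, ptens x y ∈ Q) :
    cbasic X Y p ≤ Q := by
  refine Submodule.topologicalClosure_minimal _ ?_ hQ
  exact Submodule.map_le_iff_le_comap.2 (basic_le X Y h1 h2)

theorem exists_sub_mem_cbasic (t : CTensor X Y) (p : OpenSub X × OpenSub Y) :
    ∃ s : TensorProduct k X Y, t - ofAlg X Y s ∈ cbasic X Y p := by
  have h1 : {z | t - z ∈ cbasic X Y p} ∈ 𝓝 t := by
    have : Continuous fun z => t - z := continuous_const.sub continuous_id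
    refine this.continuousAt.preimage_mem_nhds ?_
    rw [sub_self]
    exact (isOpen_cbasic p).mem_nhds (Submodule.zero_mem _)
  obtain ⟨z, hz, s, rfl⟩ := mem_closure_iff_nhds.1
    (UniformSpace.Completion.denseRange_coe (α := AlgTensor X Y) t) _ h1
  exact ⟨s, hz⟩

theorem ofAlg_tmul (x : X) (y : Y) : ofAlg X Y (x ⊗ₜ y) = ptens x y := rfl

/-- induction principle for the topological tensor product -/
theorem ctensor_induction {P : CTensor X Y → Prop} (t : CTensor X Y)
    (hc : IsClosed {t | P t}) (h0 : P 0) (ha : ∀ s t, P s → P t → P (s + t))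
    (hp : ∀ x y, P (ptens x y)) : P t := by
  refine UniformSpace.Completion.induction_on t hc fun a => ?_
  change P (ofAlg X Y a)
  induction (show TensorProduct k X Y from a) with
  | zero => rw [map_zero]; exact h0
  | add a b h1 h2 => rw [map_add]; exact ha _ _ h1 h2
  | tmul a b => exact hp a b

theorem ctensor_ext {Z : Type w''} [AddCommGroup Z] [Module k Z] [TopologicalSpace Z] [T2Space Z]
    {F G : CTensor X Y →L[k] Z} (h : ∀ x y, F (ptens x y) = G (ptens x y)) : F = G := by
  ext t
  refine ctensor_induction t (isClosed_eq F.continuous G.continuous) ?_ ?_ h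
  · rw [map_zero, map_zero]
  · intro s t h1 h2; rw [map_add, map_add, h1, h2]

theorem ptens_add_left (x x' : X) (y : Y) : ptens (x + x') y = ptens x y + ptens x' y := by
  unfold ptens; rw [TensorProduct.add_tmul, map_add]
theorem ptens_add_right (x : X) (y y' : Y) : ptens x (y + y') = ptens x y + ptens x y' := by
  unfold ptens; rw [TensorProduct.tmul_add, map_add]
theorem ptens_smul_left (c : k) (x : X) (y : Y) : ptens (c • x) y = c • ptens x y := by
  unfold ptens; rw [← TensorProduct.smul_tmul', map_smul]
theorem ptens_smul_right (c : k) (x : X) (y : Y) : ptens x (c • y) = c • ptens x y := by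
  unfold ptens; rw [TensorProduct.tmul_smul, map_smul]

variable (X Y) in
/-- `ptens` as a bilinear map -/
def ptensB : X →ₗ[k] Y →ₗ[k] CTensor X Y :=
  LinearMap.mk₂ k ptens ptens_add_left ptens_smul_left ptens_add_right ptens_smul_right

theorem ptensB_apply (x : X) (y : Y) : ptensB X Y x y = ptens x y := rfl

theorem ptens_zero_left (y : Y) : ptens (0 : X) y = 0 := (ptensB X Y).map_zero₂ y
theorem ptens_zero_right (x : X) : ptens x (0 : Y) = 0 := (ptensB X Y x).map_zero

/-- `y ↦ x ⊗ y` -/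
def ptensL (x : X) : Y →L[k] CTensor X Y where
  toLinearMap := ptensB X Y x
  cont := by
    refine isLinTop_tens.continuous_of_open _ fun U hU => ?_
    obtain ⟨p, hp⟩ := cbasic_isLinTop _ (hU.mem_nhds U.zero_mem)
    exact isOpen_submodule_mono (fun y hy => hp (ptens_mem_cbasic_right x hy)) p.2.2

/-- `x ↦ x ⊗ y` -/
def ptensR (y : Y) : X →L[k] CTensor X Y where
  toLinearMap := (ptensB X Y).flip y
  cont := by
    refine isLinTop_tens.continuous_of_open _ fun U hU => ?_
    obtain ⟨p, hp⟩ := cbasic_isLinTop _ (hU.mem_nhds U.zero_mem)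
    exact isOpen_submodule_mono (fun x hx => hp (ptens_mem_cbasic_left hx y)) p.1.2

theorem ptensL_apply (x : X) (y : Y) : ptensL x y = ptens x y := rfl
theorem ptensR_apply (x : X) (y : Y) : ptensR y x = ptens x y := rfl

/-- The universal property of the topological tensor product. -/
theorem desc_ptens {Z : Type w''} [AddCommGroup Z] [Module k Z] [UniformSpace Z]
    [IsUniformAddGroup Z] [UniformContinuousConstSMul k Z] [CompleteSpace Z] [T2Space Z]
    (hZ : IsLinTop k Z) (φ : X →ₗ[k] Y →ₗ[k] Z)
    (hφ : ∀ O : Submodule k Z, IsOpen (O : Set Z) → ∃ p : OpenSub X × OpenSub Y,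
      (∀ x ∈ p.1.1, ∀ y, φ x y ∈ O) ∧ (∀ x, ∀ y ∈ p.2.1, φ x y ∈ O)) (x : X) (y : Y) :
    desc (fun x y => φ x y) (ptens x y) = φ x y := by
  -- `desc` takes its default value unless an extension exists. The algebraic lift sends the kernel
  -- of X ⊗ Y → X/U ⊗ Y/U' into O, so it is continuous, and it extends to the completion since Z is
  -- complete and separated.
  have h : ∃ F : CTensor X Y →L[k] Z, ∀ x y, F (ptens x y) = φ x y := by
    let f : AlgTensor X Y →ₗ[k] Z := TensorProduct.lift φ
    have hf : Continuous f := by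
      refine hZ.continuous_of_open f fun O hO => ?_
      obtain ⟨p, h1, h2⟩ := hφ O hO
      refine isOpen_submodule_mono (U := AlgTensor.basic X Y p) ?_
        (linearUniformity_isOpen _ p)
      exact basic_le X Y h1 h2
    let f' : AlgTensor X Y →L[k] Z := ⟨f, hf⟩
    exact ⟨f'.fromCompletion, fun x y => f'.fromCompletion_apply_coe _⟩
  unfold desc
  rw [dif_pos h]
  exact h.choose_spec x y

end Basic

section Maps

variable {X : TMod.{u, v, w} k g} {Y : TMod.{u, v, w'} k g}

theorem mapT_ptens {X : TMod.{u, v, w} k g} {X' : TMod.{u, v, w'} k g} {Y : TMod.{u, v, w''} k g}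
    {Y' : TMod.{u, v, v'} k g} (f : X →L[k] X') (f' : Y →L[k] Y') (x : X) (y : Y) :
    mapT f f' (ptens x y) = ptens (f x) (f' y) := by
  refine desc_ptens isLinTop_tens
    ((ptensB X' Y').compl₁₂ (f : X →ₗ[k] X') (f' : Y →ₗ[k] Y')) (fun O hO => ?_) x y
  obtain ⟨p, hp⟩ := cbasic_isLinTop _ (hO.mem_nhds O.zero_mem)
  refine ⟨(comapSub f p.1, comapSub f' p.2), fun x hx y => hp ?_, fun x y hy => hp ?_⟩
  · exact ptens_mem_cbasic_left (X := X') (Y := Y') hx _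
  · exact ptens_mem_cbasic_right (X := X') (Y := Y') _ hy

theorem swapT_ptens (x : X) (y : Y) : swapT X Y (ptens x y) = ptens y x := by
  refine desc_ptens (Z := CTensor Y X) isLinTop_tens
    (ptensB Y X).flip (fun O hO => ?_) x y
  obtain ⟨p, hp⟩ := cbasic_isLinTop _ (hO.mem_nhds O.zero_mem)
  exact ⟨(p.2, p.1), fun x hx y => hp (ptens_mem_cbasic_right _ hx),
    fun x y hy => hp (ptens_mem_cbasic_left hy _)⟩

/-- the slice map `X ⊗ Y → Y` of a functional on `X` -/
def slice (Y : TMod.{u, v, w'} k g) (l : Module.Dual k X) : CTensor X Y →L[k] Y :=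
  desc (X := X) (Y := Y) fun x y => l x • y

theorem slice_ptens [CompleteSpace Y] [T2Space Y] (hY : IsLinTop k Y) (l : Module.Dual k X)
    (hl : IsOpen (LinearMap.ker l : Set X)) (x : X) (y : Y) :
    slice Y l (ptens x y) = l x • y := by
  refine desc_ptens hY ((LinearMap.lsmul k Y).comp l) (fun O hO => ?_) x y
  refine ⟨(⟨_, hl⟩, ⟨O, hO⟩), fun x hx y => ?_, fun x y hy => ?_⟩
  · have : l x = 0 := hx
    simp [this]
  · exact O.smul_mem _ hy

/-- A family of functionals with open kernels that separates sufficiently many discrete quotients -/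
def IsSeparating (X : TMod.{u, v, w} k g) (D : Set (Module.Dual k X)) : Prop :=
  (∀ l ∈ D, IsOpen (LinearMap.ker l : Set X)) ∧
  ∀ U : OpenSub X, ∃ U₁ : OpenSub X, U₁.1 ≤ U.1 ∧
    ∀ x, (∀ l ∈ D, (∀ u ∈ U₁.1, l u = 0) → l x = 0) → x ∈ U₁.1

theorem isSeparating_open (X : TMod.{u, v, w} k g) :
    IsSeparating X {l | IsOpen (LinearMap.ker l : Set X)} := by
  refine ⟨fun l hl => hl, fun U => ⟨U, le_rfl, fun x hx => ?_⟩⟩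
  by_contra hxU
  obtain ⟨l, h1, h2⟩ := exists_functional_ne_zero U.1 hxU
  exact h2 (hx l (isOpen_submodule_mono (fun u hu => h1 u hu) U.2) h1)

/-- Expand the image of t in X/U ⊗ Y/U' along a basis of Y/U'. The coefficients lie in X/U, and
applying l to one of them gives a coordinate of (l ⊗ 1)(t), which is zero modulo U'. The functionals
of D that kill U detect membership in U, so all coefficients vanish. -/
theorem mem_basic_of_functionals (U : OpenSub X) (U' : OpenSub Y) (D : Set (Module.Dual k X))
    (hD : ∀ x, (∀ l ∈ D, (∀ u ∈ U.1, l u = 0) → l x = 0) → x ∈ U.1) (t : TensorProduct k X Y)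
    (h : ∀ l ∈ D, (∀ u ∈ U.1, l u = 0) →
      TensorProduct.lift ((LinearMap.lsmul k Y).comp l) t ∈ U'.1) :
    t ∈ AlgTensor.basic X Y (U, U') := by
  classical
  let e := Module.Basis.ofVectorSpace k (Y ⧸ U'.1)
  let E := TensorProduct.equivFinsuppOfBasisRight (M := X ⧸ U.1) e
  change TensorProduct.map U.1.mkQ U'.1.mkQ t = 0
  apply E.injective
  rw [map_zero]
  ext j
  obtain ⟨x, hx⟩ := Submodule.mkQ_surjective _ (E (TensorProduct.map U.1.mkQ U'.1.mkQ t) j)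
  rw [← hx, Finsupp.zero_apply]
  refine (Submodule.Quotient.mk_eq_zero _).2 (hD x fun l hl hlU => ?_)
  have h1 : (U.1.liftQ l hlU) (E (TensorProduct.map U.1.mkQ U'.1.mkQ t) j) =
      e.repr (U'.1.mkQ (TensorProduct.lift ((LinearMap.lsmul k Y).comp l) t)) j := by
    clear h hx
    induction t with
    | zero => simp
    | add a b ha hb =>
      simp only [map_add, Finsupp.add_apply, ha, hb]
    | tmul a b =>
      rw [TensorProduct.map_tmul]
      rw [TensorProduct.equivFinsuppOfBasisRight_apply_tmul_apply]
      have : U.1.liftQ l hlU (Submodule.Quotient.mk a) = l a := rfl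
      simp [mul_comm, this]
  rw [← hx] at h1
  have h2 : U'.1.mkQ (TensorProduct.lift ((LinearMap.lsmul k Y).comp l) t) = 0 :=
    (Submodule.Quotient.mk_eq_zero _).2 (h l hl hlU)
  rw [h2, map_zero, Finsupp.zero_apply] at h1
  exact h1

theorem slice_ofAlg [CompleteSpace Y] [T2Space Y] (hY : IsLinTop k Y) (l : Module.Dual k X)
    (hl : IsOpen (LinearMap.ker l : Set X)) (t : TensorProduct k X Y) :
    slice Y l (ofAlg X Y t) =
      TensorProduct.lift ((LinearMap.lsmul k Y).comp l) t := by
  induction t with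
  | zero => simp
  | add a b ha hb => rw [map_add, map_add, ha, hb, map_add]
  | tmul a b => rw [ofAlg_tmul, slice_ptens hY l hl]; rfl

theorem slice_mem_of_mem_cbasic [CompleteSpace Y] [T2Space Y] (hY : IsLinTop k Y)
    (l : Module.Dual k X) (hl : IsOpen (LinearMap.ker l : Set X)) (p : OpenSub X × OpenSub Y)
    (hlU : ∀ u ∈ p.1.1, l u = 0) {t : CTensor X Y} (ht : t ∈ cbasic X Y p) :
    slice Y l t ∈ p.2.1 := by
  have : cbasic X Y p ≤ p.2.1.comap (slice Y l : CTensor X Y →ₗ[k] Y) := by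
    refine cbasic_le ?_ ?_ ?_
    · exact (isClosed_of_isOpen_submodule _ p.2.2).preimage (slice Y l).continuous
    · intro x hx y
      change slice Y l (ptens x y) ∈ p.2.1
      rw [slice_ptens hY l hl, hlU x hx, zero_smul]
      exact Submodule.zero_mem _
    · intro x y hy
      change slice Y l (ptens x y) ∈ p.2.1
      rw [slice_ptens hY l hl]
      exact Submodule.smul_mem _ _ hy
  exact this ht

/-- Modulo `cbasic` one may replace t by an algebraic tensor. The slices of the error lie in U', so
the algebraic criterion `mem_basic_of_functionals` applies. -/
theorem mem_cbasic_of_slice [CompleteSpace Y] [T2Space Y] (hY : IsLinTop k Y)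
    {D : Set (Module.Dual k X)} (hDo : ∀ l ∈ D, IsOpen (LinearMap.ker l : Set X))
    (U : OpenSub X) (U' : OpenSub Y)
    (hD : ∀ x, (∀ l ∈ D, (∀ u ∈ U.1, l u = 0) → l x = 0) → x ∈ U.1) (t : CTensor X Y)
    (h : ∀ l ∈ D, (∀ u ∈ U.1, l u = 0) → slice Y l t ∈ U'.1) : t ∈ cbasic X Y (U, U') := by
  obtain ⟨s, hs⟩ := exists_sub_mem_cbasic t (U, U')
  rw [← sub_add_cancel t (ofAlg X Y s)]
  refine Submodule.add_mem _ hs (ofAlg_mem_cbasic ?_)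
  refine mem_basic_of_functionals U U' D hD s fun l hl hlU => ?_
  rw [← slice_ofAlg hY l (hDo l hl)]
  have h1 := slice_mem_of_mem_cbasic hY l (hDo l hl) (U, U') hlU hs
  have h2 := Submodule.sub_mem _ (h l hl hlU) h1
  simpa using h2

/-- Slices separate the points of the topological tensor product. -/
theorem eq_of_slice [CompleteSpace Y] [T2Space Y] (hY : IsLinTop k Y)
    {D : Set (Module.Dual k X)} (hD : IsSeparating X D) {s t : CTensor X Y}
    (h : ∀ l ∈ D, slice Y l s = slice Y l t) : s = t := by
  rw [← sub_eq_zero]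
  refine isLinTop_tens.eq_zero (k := k) fun U hU => ?_
  obtain ⟨p, hp⟩ := cbasic_isLinTop _ (hU.mem_nhds U.zero_mem)
  refine hp ?_
  obtain ⟨U₁, hU₁, h1⟩ := hD.2 p.1
  have h2 : cbasic X Y (U₁, p.2) ≤ cbasic X Y p :=
    cbasic_le (isClosed_of_isOpen_submodule _ (isOpen_cbasic p))
      (fun x hx y => ptens_mem_cbasic_left (hU₁ hx) y)
      (fun x y hy => ptens_mem_cbasic_right x hy)
  refine h2 (mem_cbasic_of_slice hY hD.1 U₁ p.2 h1 _ fun l hl _ => ?_)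
  rw [map_sub, h l hl, sub_self]
  exact Submodule.zero_mem _

/-- Products of functionals separate the points of the topological tensor product. -/
theorem eq_of_functionals [CompleteSpace Y] [T2Space Y] (hY : IsLinTop k Y) {s t : CTensor X Y}
    (h : ∀ (l : Module.Dual k X) (m : Module.Dual k Y), IsOpen (LinearMap.ker l : Set X) →
      IsOpen (LinearMap.ker m : Set Y) → m (slice Y l s) = m (slice Y l t)) : s = t := by
  refine eq_of_slice hY (isSeparating_open X) fun l hl => ?_
  rw [← sub_eq_zero]
  refine hY.eq_zero_of_functional fun m hm => ?_
  rw [map_sub, h l m hl hm, sub_self]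

theorem isOpen_ker_comp {E F : Type*} [AddCommGroup E] [Module k E] [TopologicalSpace E]
    [AddCommGroup F] [Module k F] [TopologicalSpace F] (m : Module.Dual k F)
    (hm : IsOpen (LinearMap.ker m : Set F)) (f : E →L[k] F) :
    IsOpen (LinearMap.ker (m.comp (f : E →ₗ[k] F)) : Set E) :=
  hm.preimage f.continuous

theorem slice_mapT {X : TMod.{u, v, w} k g} {X' : TMod.{u, v, w'} k g} {Y : TMod.{u, v, w''} k g}
    {Y' : TMod.{u, v, v'} k g} [CompleteSpace Y] [T2Space Y] (hY : IsLinTop k Y)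
    [CompleteSpace Y'] [T2Space Y'] (hY' : IsLinTop k Y') (f : X →L[k] X') (f' : Y →L[k] Y')
    (l : Module.Dual k X') (hl : IsOpen (LinearMap.ker l : Set X')) (t : CTensor X Y) :
    slice Y' l (mapT f f' t) = f' (slice Y (l.comp (f : X →ₗ[k] X')) t) := by
  have : (slice Y' l).comp (mapT f f') = f'.comp (slice Y (l.comp (f : X →ₗ[k] X'))) := by
    refine ctensor_ext fun x y => ?_
    simp only [ContinuousLinearMap.comp_apply]
    rw [mapT_ptens, slice_ptens hY' l hl, slice_ptens hY _ (isOpen_ker_comp l hl f), map_smul]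
    rfl
  exact DFunLike.congr_fun this t

/-- The definition of `assocT` nests two uses of `desc`; this evaluates the inner one, with the
third vector fixed. -/
theorem assocT_aux (X : TMod.{u, v, w} k g) (Y : TMod.{u, v, w'} k g) (Z : TMod.{u, v, w''} k g)
    (z : Z) (x : X) (y : Y) :
    desc (X := X) (Y := Y) (Z := tens X (tens Y Z))
      (fun x y => ptens (Y := tens Y Z) x (ptens y z)) (ptens x y) =
      ptens (Y := tens Y Z) x (ptens y z) := by
  refine desc_ptens (Z := CTensor X (tens Y Z)) isLinTop_tens
    ((ptensB X (tens Y Z)).compl₂ ((ptensB Y Z).flip z)) (fun O hO => ?_) x y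
  obtain ⟨p, hp⟩ := cbasic_isLinTop _ (hO.mem_nhds O.zero_mem)
  exact ⟨(p.1, comapSub (Y := tens Y Z) (ptensR z) p.2),
    fun x hx y => hp (ptens_mem_cbasic_left (Y := tens Y Z) hx _),
    fun x y hy => hp (ptens_mem_cbasic_right (Y := tens Y Z) _ hy)⟩

theorem assocInvT_aux (X : TMod.{u, v, w} k g) (Y : TMod.{u, v, w'} k g) (Z : TMod.{u, v, w''} k g)
    (x : X) (y : Y) (z : Z) :
    desc (X := Y) (Y := Z) (Z := tens (tens X Y) Z)
      (fun y z => ptens (X := tens X Y) (ptens x y) z) (ptens y z) =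
      ptens (X := tens X Y) (ptens x y) z := by
  refine desc_ptens (Z := CTensor (tens X Y) Z) isLinTop_tens
    ((ptensB (tens X Y) Z).comp (ptensB X Y x)) (fun O hO => ?_) y z
  obtain ⟨p, hp⟩ := cbasic_isLinTop _ (hO.mem_nhds O.zero_mem)
  exact ⟨(comapSub (Y := tens X Y) (ptensL x) p.1, p.2),
    fun x hx y => hp (ptens_mem_cbasic_left (X := tens X Y) hx _),
    fun x y hy => hp (ptens_mem_cbasic_right (X := tens X Y) _ hy)⟩

theorem assocT_ptens (X : TMod.{u, v, w} k g) (Y : TMod.{u, v, w'} k g) (Z : TMod.{u, v, w''} k g)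
    (x : X) (y : Y) (z : Z) :
    assocT X Y Z (ptens (X := tens X Y) (ptens x y) z) = ptens (Y := tens Y Z) x (ptens y z) := by
  let D : Z → tens X Y →L[k] tens X (tens Y Z) := fun z =>
    desc (X := X) (Y := Y) (Z := tens X (tens Y Z))
      (fun x y => ptens (Y := tens Y Z) x (ptens y z))
  have hD : ∀ x y z, D z (ptens x y) = ptens (Y := tens Y Z) x (ptens y z) :=
    fun x y z => assocT_aux X Y Z z x y
  have hadd : ∀ z z', D (z + z') = D z + D z' := fun z z' => ctensor_ext fun x y => by
    rw [hD, add_apply, hD, hD, ptens_add_right, ptens_add_right]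
  have hsmul : ∀ (c : k) z, D (c • z) = c • D z := fun c z => ctensor_ext fun x y => by
    rw [hD, smul_apply, hD, ptens_smul_right, ptens_smul_right]
  let φ : tens X Y →ₗ[k] Z →ₗ[k] CTensor X (tens Y Z) :=
    LinearMap.mk₂ k (fun t z => D z t) (fun a b c => map_add _ _ _) (fun a b c => map_smul _ _ _)
      (fun a b c => by rw [hadd]; rfl) (fun a b c => by rw [hsmul]; rfl)
  refine (desc_ptens (X := tens X Y) (Y := Z) (Z := CTensor X (tens Y Z)) isLinTop_tens
    φ (fun O hO => ?_) (ptens x y) z).trans (hD x y z)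
  obtain ⟨p, hp⟩ := cbasic_isLinTop _ (hO.mem_nhds O.zero_mem)
  -- The open subspaces are chosen from the outside inwards: p for the target X ⊗ (Y ⊗ Z), then q
  -- inside the open subspace of Y ⊗ Z provided by p.
  obtain ⟨q, hq⟩ := cbasic_isLinTop (X := Y) (Y := Z) _ (p.2.2.mem_nhds p.2.1.zero_mem)
  refine ⟨(⟨cbasic X Y (p.1, q.1), isOpen_cbasic _⟩, q.2), fun t ht z => ?_, fun t z hz => ?_⟩
  · have : cbasic X Y (p.1, q.1) ≤ O.comap (D z : tens X Y →ₗ[k] tens X (tens Y Z)) := by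
      refine cbasic_le ((isClosed_of_isOpen_submodule _ hO).preimage (D z).continuous) ?_ ?_
      · intro x hx y
        change D z (ptens x y) ∈ O
        rw [hD]
        exact hp (ptens_mem_cbasic_left (Y := tens Y Z) hx _)
      · intro x y hy
        change D z (ptens x y) ∈ O
        rw [hD]
        exact hp (ptens_mem_cbasic_right _ (hq (ptens_mem_cbasic_left hy _)))
    exact this ht
  · change D z t ∈ O
    refine ctensor_induction (P := fun t => D z t ∈ O) t
      ((isClosed_of_isOpen_submodule _ hO).preimage (D z).continuous) ?_ ?_ ?_
    · rw [map_zero]; exact O.zero_mem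
    · intro a b ha hb; rw [map_add]; exact O.add_mem ha hb
    · intro x y
      rw [hD]
      exact hp (ptens_mem_cbasic_right _ (hq (ptens_mem_cbasic_right _ hz)))

theorem assocInvT_ptens (X : TMod.{u, v, w} k g) (Y : TMod.{u, v, w'} k g)
    (Z : TMod.{u, v, w''} k g) (x : X) (y : Y) (z : Z) :
    assocInvT X Y Z (ptens (Y := tens Y Z) x (ptens y z)) =
      ptens (X := tens X Y) (ptens x y) z := by
  let D : X → tens Y Z →L[k] tens (tens X Y) Z := fun x =>
    desc (X := Y) (Y := Z) (Z := tens (tens X Y) Z)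
      (fun y z => ptens (X := tens X Y) (ptens x y) z)
  have hD : ∀ x y z, D x (ptens y z) = ptens (X := tens X Y) (ptens x y) z :=
    fun x y z => assocInvT_aux X Y Z x y z
  have hadd : ∀ z z', D (z + z') = D z + D z' := fun z z' => ctensor_ext fun x y => by
    rw [hD, add_apply, hD, hD, ptens_add_left, ptens_add_left]
  have hsmul : ∀ (c : k) z, D (c • z) = c • D z := fun c z => ctensor_ext fun x y => by
    rw [hD, smul_apply, hD, ptens_smul_left, ptens_smul_left]
  let φ : X →ₗ[k] tens Y Z →ₗ[k] CTensor (tens X Y) Z :=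
    LinearMap.mk₂ k (fun x t => D x t) (fun a b c => by rw [hadd]; rfl)
      (fun a b c => by rw [hsmul]; rfl) (fun a b c => map_add _ _ _) (fun a b c => map_smul _ _ _)
  refine (desc_ptens (X := X) (Y := tens Y Z) (Z := CTensor (tens X Y) Z) isLinTop_tens
    φ (fun O hO => ?_) x (ptens y z)).trans (hD x y z)
  obtain ⟨p, hp⟩ := cbasic_isLinTop _ (hO.mem_nhds O.zero_mem)
  obtain ⟨q, hq⟩ := cbasic_isLinTop (X := X) (Y := Y) _ (p.1.2.mem_nhds p.1.1.zero_mem)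
  refine ⟨(q.1, ⟨cbasic Y Z (q.2, p.2), isOpen_cbasic _⟩), fun x hx t => ?_, fun x t ht => ?_⟩
  · change D x t ∈ O
    refine ctensor_induction (P := fun t => D x t ∈ O) t
      ((isClosed_of_isOpen_submodule _ hO).preimage (D x).continuous) ?_ ?_ ?_
    · rw [map_zero]; exact O.zero_mem
    · intro a b ha hb; rw [map_add]; exact O.add_mem ha hb
    · intro y z
      rw [hD]
      exact hp (ptens_mem_cbasic_left (hq (ptens_mem_cbasic_left (X := X) (Y := Y) hx _)) _)
  · have : cbasic Y Z (q.2, p.2) ≤ O.comap (D x : tens Y Z →ₗ[k] tens (tens X Y) Z) := by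
      refine cbasic_le ((isClosed_of_isOpen_submodule _ hO).preimage (D x).continuous) ?_ ?_
      · intro y hy z
        change D x (ptens y z) ∈ O
        rw [hD]
        exact hp (ptens_mem_cbasic_left (hq (ptens_mem_cbasic_right _ hy)) _)
      · intro y z hz
        change D x (ptens y z) ∈ O
        rw [hD]
        exact hp (ptens_mem_cbasic_right _ hz)
    exact this ht

theorem tens_act_ptens (z : g) (x : X) (y : Y) :
    (tens X Y).act z (ptens x y) = ptens (X.act z x) y + ptens x (Y.act z y) := by
  change (mapT (X.act z) (ContinuousLinearMap.id k Y) +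
    mapT (ContinuousLinearMap.id k X) (Y.act z)) (ptens x y) = _
  rw [add_apply, mapT_ptens, mapT_ptens]
  rfl

end Maps

end Tensor

end

end RelTwist

/-! ### Topology and dual bases of a Manin triple -/

namespace RelTwist

noncomputable section

open scoped TensorProduct Topology
open Filter

namespace ManinTriple

variable {k : Type u} {g : Type v} [Field k] [LieRing g] [LieAlgebra k g] (M : ManinTriple k g)

/-- the chosen basis of `g_-` -/
def basis : Module.Basis M.Index k M.gm := Module.Basis.ofVectorSpace k M.gm

theorem a_eq (i : M.Index) : M.a i = (M.basis i : g) := rfl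

theorem a_mem (i : M.Index) : M.a i ∈ M.gm := (Module.Basis.ofVectorSpace k M.gm i).2

theorem b_mem (i : M.Index) : M.b i ∈ M.gp :=
  ((Equiv.ofBijective _ M.dual).symm ((Module.Basis.ofVectorSpace k M.gm).coord i)).2

theorem form_b (i : M.Index) (x : M.gm) :
    M.form (M.b i) x = M.basis.repr x i := by
  have h := (Equiv.ofBijective _ M.dual).apply_symm_apply
    ((Module.Basis.ofVectorSpace k M.gm).coord i)
  exact DFunLike.congr_fun h x

theorem form_b_a [DecidableEq M.Index] (i j : M.Index) :
    M.form (M.b i) (M.a j) = if i = j then 1 else 0 := by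
  rw [M.a_eq, M.form_b, Module.Basis.repr_self, Finsupp.single_apply]
  simp only [eq_comm]

/-- Coordinates have finite support. The expansion is asserted for every larger finite set so that
it can share an index set with the partial sums of a convergent series. -/
theorem gm_expand {x : g} (hx : x ∈ M.gm) :
    ∃ F₀ : Finset M.Index, ∀ F, F₀ ⊆ F → x = ∑ i ∈ F, M.form (M.b i) x • M.a i := by
  let e := M.basis
  refine ⟨(e.repr ⟨x, hx⟩).support, fun F hF => ?_⟩
  have h := e.linearCombination_repr ⟨x, hx⟩
  rw [Finsupp.linearCombination_apply, Finsupp.sum_of_support_subset _ hF _ (by simp)] at h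
  have h2 := congrArg (M.gm.toSubmodule.subtype) h
  rw [map_sum (M.gm.toSubmodule.subtype)] at h2
  refine h2.symm.trans (Finset.sum_congr rfl fun i _ => ?_)
  rw [map_smul]
  have : M.form (M.b i) x = e.repr ⟨x, hx⟩ i := M.form_b i ⟨x, hx⟩
  rw [this]
  rfl

/-- the elements of `g_+` orthogonal to finitely many basis vectors of `g_-` -/
def ann (I : Finset M.Index) : Submodule k g where
  carrier := {x | x ∈ M.gp ∧ ∀ i ∈ I, M.form x (M.a i) = 0}
  zero_mem' := ⟨M.gp.zero_mem, by simp⟩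
  add_mem' := fun {x y} hx hy => ⟨add_mem hx.1 hy.1, fun i hi => by
    rw [map_add, LinearMap.add_apply, hx.2 i hi, hy.2 i hi, add_zero]⟩
  smul_mem' := fun c x hx => ⟨M.gp.smul_mem c hx.1, fun i hi => by
    rw [map_smul, LinearMap.smul_apply, hx.2 i hi, smul_zero]⟩

theorem ann_anti {I J : Finset M.Index} (h : I ⊆ J) : M.ann J ≤ M.ann I :=
  fun _ hx => ⟨hx.1, fun i hi => hx.2 i (h hi)⟩

theorem b_mem_ann {I : Finset M.Index} {i : M.Index} (hi : i ∉ I) : M.b i ∈ M.ann I := by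
  classical
  refine ⟨M.b_mem i, fun j hj => ?_⟩
  rw [M.form_b_a, if_neg]
  rintro rfl
  exact hi hj

/-- Hence g_+ is spanned, modulo `ann I`, by the finitely many dual vectors with index in I. -/
theorem sub_sum_mem_ann {x : g} (hx : x ∈ M.gp) (I : Finset M.Index) :
    x - ∑ i ∈ I, M.form x (M.a i) • M.b i ∈ M.ann I := by
  classical
  refine ⟨sub_mem hx (sum_mem fun i _ => M.gp.smul_mem _ (M.b_mem i)), fun j hj => ?_⟩
  rw [map_sub, LinearMap.sub_apply, map_sum, LinearMap.sum_apply]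
  simp only [map_smul, LinearMap.smul_apply, M.form_b_a, smul_eq_mul, mul_ite, mul_one, mul_zero]
  rw [Finset.sum_ite_eq' I j, if_pos hj, sub_self]

theorem exists_ann_le (S : Set g) (hS : S.Finite) (h : ∀ s ∈ S, s ∈ M.gm) :
    ∃ I, ∀ x ∈ M.ann I, ∀ s ∈ S, M.form x s = 0 := by
  classical
  choose! F hF using fun s (hs : s ∈ S) => M.gm_expand (h s hs)
  refine ⟨hS.toFinset.biUnion F, fun x hx s hs => ?_⟩
  rw [hF s hs (F s) subset_rfl, map_sum]
  refine Finset.sum_eq_zero fun i hi => ?_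
  rw [map_smul, hx.2 i (Finset.mem_biUnion.2 ⟨s, hS.mem_toFinset.2 hs, hi⟩), smul_zero]

/-- the projection to `g_-` along `g_+` -/
def pm : g →ₗ[k] g :=
  M.gm.toSubmodule.subtype.comp (Submodule.projectionOnto _ _ M.isCompl)

/-- the projection to `g_+` along `g_-` -/
def pp : g →ₗ[k] g := LinearMap.id - M.pm

theorem pm_mem (x : g) : M.pm x ∈ M.gm := (Submodule.projectionOnto _ _ M.isCompl x).2

theorem pm_of_mem {x : g} (hx : x ∈ M.gm) : M.pm x = x := by
  unfold pm
  rw [LinearMap.comp_apply,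
    show x = ((⟨x, hx⟩ : M.gm.toSubmodule) : g) from rfl, Submodule.projectionOnto_apply_left]
  rfl

theorem pm_eq_zero {x : g} (hx : x ∈ M.gp) : M.pm x = 0 := by
  unfold pm
  rw [LinearMap.comp_apply, (Submodule.projectionOnto_apply_eq_zero_iff M.isCompl).2 hx,
    map_zero]

theorem pm_add_pp (x : g) : M.pm x + M.pp x = x := by
  change M.pm x + (x - M.pm x) = x
  abel

theorem pp_mem (x : g) : M.pp x ∈ M.gp := by
  obtain ⟨y, hy, z, hz, h⟩ := Submodule.mem_sup.1
    (show x ∈ M.gm.toSubmodule ⊔ M.gp.toSubmodule by rw [M.isCompl.sup_eq_top]; trivial)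
  have : M.pp x = z := by
    change x - M.pm x = z
    rw [← h, map_add, M.pm_of_mem hy, M.pm_eq_zero hz]
    abel
  rw [this]
  exact hz

theorem form_pm_pp (x y : g) : M.form x y = M.form (M.pm x) (M.pp y) + M.form (M.pp x) (M.pm y) := by
  conv_lhs => rw [← M.pm_add_pp x, ← M.pm_add_pp y]
  simp only [map_add, LinearMap.add_apply]
  rw [M.isotropic_gm _ (M.pm_mem x) _ (M.pm_mem y), M.isotropic_gp _ (M.pp_mem x) _ (M.pp_mem y)]
  ring

theorem mem_gp_of_form {x : g} (h : ∀ y ∈ M.gp, M.form x y = 0) : x ∈ M.gp := by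
  have : M.pm x = 0 := by
    refine M.nondegenerate _ fun y => ?_
    rw [← M.pm_add_pp y, map_add, M.isotropic_gm _ (M.pm_mem x) _ (M.pm_mem y), zero_add]
    have h1 := h _ (M.pp_mem y)
    rw [← M.pm_add_pp x, map_add, LinearMap.add_apply,
      M.isotropic_gp _ (M.pp_mem x) _ (M.pp_mem y), add_zero] at h1
    exact h1
  rw [← M.pm_add_pp x, this, zero_add]
  exact M.pp_mem x

theorem mem_gm_of_form {x : g} (h : ∀ y ∈ M.gm, M.form x y = 0) : x ∈ M.gm := by
  have : M.pp x = 0 := by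
    refine M.nondegenerate _ fun y => ?_
    rw [← M.pm_add_pp y, map_add, M.isotropic_gp _ (M.pp_mem x) _ (M.pp_mem y), add_zero]
    have h1 := h _ (M.pm_mem y)
    rw [← M.pm_add_pp x, map_add, LinearMap.add_apply,
      M.isotropic_gm _ (M.pm_mem x) _ (M.pm_mem y), zero_add] at h1
    exact h1
  rw [← M.pm_add_pp x, this, add_zero]
  exact M.pm_mem x

/-- Near zero the discrete pairing with g_+ forces the g_--component to vanish, while the weak
topology imposes finitely many conditions from g_-. By `exists_ann_le` these may be taken on basis
vectors. -/
theorem mem_nhds_zero (s : Set g) :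
    s ∈ @nhds g M.top 0 ↔ ∃ I, (M.ann I : Set g) ⊆ s := by
  have h0 : @nhds g M.top 0 =
      comap (fun x => fun y : M.gp => M.form x y) (pure 0) ⊓
      comap (fun x => fun y : M.gm => M.form x y) (Filter.pi fun _ => pure 0) := by
    unfold top maninTopology
    rw [nhds_inf, @nhds_induced _ _ ⊥, @nhds_induced _ _ (@Pi.topologicalSpace M.gm (fun _ => k)
      (fun _ => ⊥))]
    congr 2
    · rw [@nhds_discrete _ ⊥ (@DiscreteTopology.mk _ ⊥ rfl)]
      congr 1
      ext y
      simp
    · rw [@nhds_pi _ _ (fun _ => ⊥)]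
      congr 1
      ext1 y
      rw [@nhds_discrete _ ⊥ (@DiscreteTopology.mk _ ⊥ rfl)]
      congr 1
      simp
  rw [h0]
  constructor
  · intro hs
    obtain ⟨s1, ⟨t1, ht1, hst1⟩, s2, ⟨t2, ht2, hst2⟩, rfl⟩ := hs
    obtain ⟨J, hJ, t, ht, hJt⟩ := Filter.mem_pi.1 ht2
    obtain ⟨I, hI⟩ := M.exists_ann_le ((fun y : M.gm => (y : g)) '' J) (hJ.image _) (by
      rintro _ ⟨y, _, rfl⟩; exact y.2)
    refine ⟨I, fun x hx => ⟨hst1 ?_, hst2 (hJt fun y hy => ?_)⟩⟩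
    · have : (fun y : M.gp => M.form x y) = 0 := by
        ext y
        exact M.isotropic_gp _ hx.1 _ y.2
      change (fun y : M.gp => M.form x y) ∈ t1
      rw [this]
      exact ht1
    · have : M.form x y = 0 := hI x hx y ⟨y, hy, rfl⟩
      change M.form x y ∈ t y
      rw [this]
      exact ht y
  · rintro ⟨I, hI⟩
    refine mem_of_superset (inter_mem_inf (preimage_mem_comap (t := {0}) (by simp))
      (preimage_mem_comap (t := (((fun i => (⟨M.a i, M.a_mem i⟩ : M.gm)) '' (I : Set M.Index)).pi
        fun _ => ({0} : Set k))) ?_)) ?_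
    · exact Filter.mem_pi.2 ⟨_, I.finite_toSet.image _, fun _ => {0}, by simp, subset_rfl⟩
    · rintro x ⟨h1, h2⟩
      refine hI ⟨M.mem_gp_of_form fun y hy => ?_, fun i hi => ?_⟩
      · exact congrFun h1 ⟨y, hy⟩
      · exact h2 _ ⟨i, hi, rfl⟩

theorem isTopologicalAddGroup : @IsTopologicalAddGroup g M.top _ := by
  unfold top maninTopology
  refine topologicalAddGroup_inf ?_ ?_
  · let _ : TopologicalSpace (M.gp → k) := ⊥
    have : DiscreteTopology (M.gp → k) := ⟨rfl⟩
    have : IsTopologicalAddGroup (M.gp → k) :=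
      { continuous_add := continuous_of_discreteTopology
        continuous_neg := continuous_of_discreteTopology }
    let f : g →+ (M.gp → k) :=
      { toFun := fun x => fun y : M.gp => M.form x y
        map_zero' := by ext; simp
        map_add' := fun x y => by ext; simp }
    exact topologicalAddGroup_induced f
  · let _ : TopologicalSpace k := ⊥
    have : DiscreteTopology k := ⟨rfl⟩
    have : IsTopologicalAddGroup k :=
      { continuous_add := continuous_of_discreteTopology
        continuous_neg := continuous_of_discreteTopology }
    let f : g →+ (M.gm → k) :=
      { toFun := fun x => fun y : M.gm => M.form x y
        map_zero' := by ext; simp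
        map_add' := fun x y => by ext; simp }
    exact topologicalAddGroup_induced f

theorem continuous_iff {E : Type*} [AddCommGroup E] [Module k E] [TopologicalSpace E]
    [IsTopologicalAddGroup E] (hE : IsLinTop k E) (f : g →ₗ[k] E) :
    @Continuous g E M.top _ f ↔
      ∀ U : Submodule k E, IsOpen (U : Set E) → ∃ I, ∀ x ∈ M.ann I, f x ∈ U := by
  let _ := M.top
  have := M.isTopologicalAddGroup
  constructor
  · intro h U hU
    have h1 : f ⁻¹' (U : Set E) ∈ 𝓝 (0 : g) :=
      h.continuousAt.preimage_mem_nhds (by rw [map_zero]; exact hU.mem_nhds U.zero_mem)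
    exact (M.mem_nhds_zero _).1 h1
  · intro h
    refine hE.continuous_of_open f fun U hU => ?_
    exact isOpen_submodule_of_mem_nhds _ ((M.mem_nhds_zero _).2 (h U hU))

/-- continuity of the bracket in one variable -/
theorem ad_mem_ann (z : g) (I : Finset M.Index) : ∃ J, ∀ x ∈ M.ann J, ⁅z, x⁆ ∈ M.ann I := by
  have h : @Continuous g g M.top M.top (fun x => ⁅z, x⁆) := by
    let _ := M.top
    have h1 : Continuous (fun p : g × g => ⁅p.1, p.2⁆) := M.continuous_bracket
    exact h1.comp (Continuous.prodMk continuous_const continuous_id)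
  have h1 : (fun x => ⁅z, x⁆) ⁻¹' (M.ann I : Set g) ∈ @nhds g M.top 0 := by
    let _ := M.top
    refine h.continuousAt.preimage_mem_nhds ?_
    rw [lie_zero]
    exact (M.mem_nhds_zero _).2 ⟨I, subset_rfl⟩
  exact (M.mem_nhds_zero _).1 h1

/-- Modulo U, a continuous linear map on g_+ depends on finitely many coordinates only; this is
`sub_sum_mem_ann` pushed through f. -/
theorem lin_expand {E : Type*} [AddCommGroup E] [Module k E] (f : g →ₗ[k] E) (U : Submodule k E)
    (I : Finset M.Index) (h : ∀ x ∈ M.ann I, f x ∈ U) {x : g} (hx : x ∈ M.gp) :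
    f x - ∑ i ∈ I, M.form x (M.a i) • f (M.b i) ∈ U := by
  have := h _ (M.sub_sum_mem_ann hx I)
  simpa using this

/-- A continuous functional on `g` is represented by an element of `g`. -/
theorem exists_form_eq (f : Module.Dual k g) (I : Finset M.Index) (h : ∀ x ∈ M.ann I, f x = 0) :
    ∃ p, ∀ z, f z = M.form z p := by
  obtain ⟨y, hy⟩ := M.dual.2 (f.comp M.gm.toSubmodule.subtype)
  have hy' : ∀ z ∈ M.gm, M.form y z = f z := fun z hz => DFunLike.congr_fun hy ⟨z, hz⟩
  -- The element y of g_+ represents f on g_- by duality. The sum lies in g_- and represents f on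
  -- g_+; it is finite because f vanishes on `ann I`.
  refine ⟨y + ∑ i ∈ I, f (M.b i) • M.a i, fun z => ?_⟩
  have h1 : f (M.pp z) = ∑ i ∈ I, M.form (M.pp z) (M.a i) • f (M.b i) := by
    have := M.lin_expand f ⊥ I (by simpa using h) (M.pp_mem z)
    rwa [Submodule.mem_bot, sub_eq_zero] at this
  have hm : ∀ z' ∈ M.gm, M.form z' (∑ i ∈ I, f (M.b i) • M.a i) = 0 := fun z' hz' =>
    M.isotropic_gm _ hz' _ (sum_mem fun i _ => M.gm.smul_mem _ (M.a_mem i))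
  conv_lhs => rw [← M.pm_add_pp z, map_add, h1, ← hy' _ (M.pm_mem z), M.symm]
  conv_rhs => rw [← M.pm_add_pp z]
  simp only [map_add, LinearMap.add_apply]
  rw [hm _ (M.pm_mem z), M.isotropic_gp _ (M.pp_mem z) _ y.2]
  rw [map_sum]
  simp only [map_smul, smul_eq_mul, add_zero, zero_add]
  congr 1
  exact Finset.sum_congr rfl fun i _ => mul_comm _ _

/-- Together with `exists_ann_le`, this translates between finite subsets of g_-, as in `IsCont`,
and the subspaces `ann I`. -/
theorem exists_finset_isCont (I : Finset M.Index) :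
    ∃ S : Finset g, (∀ s ∈ S, s ∈ M.gm) ∧ ∀ x ∈ M.gp, (∀ s ∈ S, M.form x s = 0) → x ∈ M.ann I := by
  classical
  refine ⟨I.image M.a, fun s hs => ?_, fun x hx h => ⟨hx, fun i hi => h _ ?_⟩⟩
  · obtain ⟨i, _, rfl⟩ := Finset.mem_image.1 hs
    exact M.a_mem i
  · exact Finset.mem_image_of_mem _ hi

theorem form_lie_left (x y z : g) : M.form ⁅x, y⁆ z = - M.form y ⁅x, z⁆ := by
  rw [← lie_skew, map_neg, LinearMap.neg_apply, M.invariant]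

theorem form_lie_right (x y z : g) : M.form x ⁅y, z⁆ = M.form ⁅x, y⁆ z := (M.invariant x y z).symm

end ManinTriple

end

end RelTwist

/-! ### Equicontinuous modules, the Casimir operator and equivariance of the constraints -/

namespace RelTwist

noncomputable section

open scoped TensorProduct Topology
open Filter

set_option linter.unusedSectionVars false

section Equicontinuous

variable {k : Type u} {g : Type v} [Field k] [LieRing g] [LieAlgebra k g] {M : ManinTriple k g}
  {X : TMod.{u, v, w} k g} {Y : TMod.{u, v, w'} k g} {Z : TMod.{u, v, w''} k g}

namespace TMod.IsEquicontinuous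

theorem isLinTop (hX : X.IsEquicontinuous M) : IsLinTop k X := hX.linear

/-- the orbit map of a vector -/
def orbit (hX : X.IsEquicontinuous M) (t : X) : g →ₗ[k] X where
  toFun z := X.act z t
  map_add' x y := hX.act_add x y t
  map_smul' c x := hX.act_smul c x t

theorem exists_ann (hX : X.IsEquicontinuous M) (t : X) (U : Submodule k X)
    (hU : IsOpen (U : Set X)) : ∃ I, ∀ z ∈ M.ann I, X.act z t ∈ U :=
  (M.continuous_iff hX.isLinTop (hX.orbit t)).1 (hX.continuous_act t) U hU

/-- matrix coefficients are represented by elements of `g` -/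
theorem exists_form_eq (hX : X.IsEquicontinuous M) (t : X) (l : Module.Dual k X)
    (hl : IsOpen (LinearMap.ker l : Set X)) : ∃ p, ∀ z, l (X.act z t) = M.form z p := by
  obtain ⟨I, hI⟩ := hX.exists_ann t _ hl
  exact M.exists_form_eq (l.comp (hX.orbit t)) I hI

end TMod.IsEquicontinuous

/-- convergence to zero along the cofinite filter -/
def ManinTriple.TendsZero (M : ManinTriple k g) {ι : Type*} (b : ι → g) : Prop :=
  ∀ I, ∀ᶠ i in cofinite, b i ∈ M.ann I

theorem ManinTriple.tendsZero_b (M : ManinTriple k g) : M.TendsZero M.b := fun I => by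
  refine I.finite_toSet.subset fun i hi => ?_
  by_contra h
  exact hi (M.b_mem_ann h)

theorem HasSum.mem_of_isClosed {E : Type*} [AddCommGroup E] [Module k E] [TopologicalSpace E]
    {ι : Type*} {f : ι → E} {s : E} (h : HasSum f s) (U : Submodule k E)
    (hU : IsClosed (U : Set E)) (hf : ∀ i, f i ∈ U) : s ∈ U :=
  hU.mem_of_tendsto h (Eventually.of_forall fun _ => sum_mem fun i _ => hf i)

/-- In a complete nonarchimedean group it is enough that the terms tend to zero. They do, since
orbit maps are continuous and one of the two families tends to zero. -/
theorem summable_ptens {ι : Type*} (hX : X.IsEquicontinuous M) (hY : Y.IsEquicontinuous M)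
    {a b : ι → g} (hab : M.TendsZero a ∨ M.TendsZero b) (x : X) (y : Y) :
    Summable fun i => ptens (X.act (a i) x) (Y.act (b i) y) := by
  have := (isLinTop_tens (X := X) (Y := Y)).nonarchimedean
  refine NonarchimedeanAddGroup.summable_of_tendsto_cofinite_zero fun s hs => ?_
  obtain ⟨p, hp⟩ := cbasic_isLinTop s hs
  rcases hab with h | h
  · obtain ⟨I, hI⟩ := hX.exists_ann x p.1.1 p.1.2
    exact (h I).mono fun i hi => hp (ptens_mem_cbasic_left (hI _ hi) _)
  · obtain ⟨I, hI⟩ := hY.exists_ann y p.2.1 p.2.2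
    exact (h I).mono fun i hi => hp (ptens_mem_cbasic_right _ (hI _ hi))

theorem sumOp_ptens {ι : Type*} (hX : X.IsEquicontinuous M) (hY : Y.IsEquicontinuous M)
    {a b : ι → g} (hab : M.TendsZero a ∨ M.TendsZero b) (x : X) (y : Y) :
    sumOp a b X Y (ptens x y) = ∑' i, ptens (X.act (a i) x) (Y.act (b i) y) := by
  have hs := fun x y => summable_ptens hX hY hab x y
  let φ : X →ₗ[k] Y →ₗ[k] CTensor X Y := LinearMap.mk₂ k
    (fun x y => ∑' i, ptens (X.act (a i) x) (Y.act (b i) y))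
    (fun x x' y => by
      rw [← (hs x y).tsum_add (hs x' y)]
      exact tsum_congr fun i => by rw [map_add, ptens_add_left])
    (fun c x y => by
      rw [← (hs x y).tsum_const_smul]
      exact tsum_congr fun i => by rw [map_smul, ptens_smul_left])
    (fun x y y' => by
      rw [← (hs x y).tsum_add (hs x y')]
      exact tsum_congr fun i => by rw [map_add, ptens_add_right])
    (fun c x y => by
      rw [← (hs x y).tsum_const_smul]
      exact tsum_congr fun i => by rw [map_smul, ptens_smul_right])
  refine desc_ptens (Z := CTensor X Y) isLinTop_tens φ (fun O hO => ?_) x y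
  obtain ⟨p, hp⟩ := cbasic_isLinTop _ (hO.mem_nhds O.zero_mem)
  -- Equicontinuity supplies a single open subspace that works for all terms of the sum at once,
  -- which continuity of the individual operators would not.
  obtain ⟨U, hU, h1⟩ := hX.equicontinuous p.1.1 p.1.2
  obtain ⟨U', hU', h2⟩ := hY.equicontinuous p.2.1 p.2.2
  refine ⟨(⟨U, hU⟩, ⟨U', hU'⟩), fun x hx y => ?_, fun x y hy => ?_⟩
  · exact HasSum.mem_of_isClosed (hs x y).hasSum O (isClosed_of_isOpen_submodule O hO)
      fun i => hp (ptens_mem_cbasic_left (h1 _ x hx) _)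
  · exact HasSum.mem_of_isClosed (hs x y).hasSum O (isClosed_of_isOpen_submodule O hO)
      fun i => hp (ptens_mem_cbasic_right _ (h2 _ y hy))

/-- A functional with open kernel sees only a finite partial sum. Every index set beyond F₀ is
allowed, so that it can be enlarged to match an expansion from `gm_expand`. -/
theorem functional_sumOp {ι : Type*} (hX : X.IsEquicontinuous M) (hY : Y.IsEquicontinuous M)
    {a b : ι → g} (hab : M.TendsZero a ∨ M.TendsZero b) (x : X) (y : Y)
    (l : Module.Dual k X) (m : Module.Dual k Y) (hl : IsOpen (LinearMap.ker l : Set X))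
    (hm : IsOpen (LinearMap.ker m : Set Y)) :
    ∃ F₀ : Finset ι, ∀ F, F₀ ⊆ F → m (slice Y l (sumOp a b X Y (ptens x y))) =
      ∑ i ∈ F, l (X.act (a i) x) * m (Y.act (b i) y) := by
  have := hY.complete
  have := hY.separated
  have h := (summable_ptens hX hY hab x y).hasSum
  rw [← sumOp_ptens hX hY hab] at h
  obtain ⟨F₀, hF⟩ := functional_hasSum h (m.comp (slice Y l : CTensor X Y →ₗ[k] Y))
    (isOpen_ker_comp m hm (slice Y l))
  refine ⟨F₀, fun F h => (hF F h).trans (Finset.sum_congr rfl fun i _ => ?_)⟩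
  change m (slice Y l (ptens _ _)) = _
  rw [slice_ptens hY.isLinTop l hl, map_smul, smul_eq_mul]

section Casimir

variable (hX : X.IsEquicontinuous M) (hY : Y.IsEquicontinuous M) {x : X} {y : Y}
    {l : Module.Dual k X} {m : Module.Dual k Y} (hl : IsOpen (LinearMap.ker l : Set X))
    (hm : IsOpen (LinearMap.ker m : Set Y)) {p q : g} (hp : ∀ z, l (X.act z x) = M.form z p)
    (hq : ∀ z, m (Y.act z y) = M.form z q)

include hX hY hl hm hp hq

/-- The partial sums are ∑ (a_i, p)(b^i, q). Since ∑ (b^i, q) a_i is the expansion of the g_--part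
of q, they equal (q_-, p), and isotropy leaves only the g_+-part of p. -/
theorem functional_r : m (slice Y l (M.r X Y (ptens x y))) = M.form (M.pm q) (M.pp p) := by
  obtain ⟨F₀, h1⟩ := functional_sumOp hX hY (Or.inr M.tendsZero_b) x y l m hl hm (a := M.a)
  obtain ⟨F₁, h2⟩ := M.gm_expand (M.pm_mem q)
  classical
  refine (h1 (F₀ ∪ F₁) Finset.subset_union_left).trans ?_
  conv_rhs => rw [h2 (F₀ ∪ F₁) Finset.subset_union_right]
  rw [map_sum, LinearMap.sum_apply]
  refine Finset.sum_congr rfl fun i _ => ?_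
  rw [hp, hq, map_smul, LinearMap.smul_apply, smul_eq_mul, M.form_pm_pp (M.b i),
    M.form_pm_pp (M.a i), M.pm_eq_zero (M.b_mem i), M.pm_of_mem (M.a_mem i)]
  have h3 : M.pp (M.b i) = M.b i := by
    conv_rhs => rw [← M.pm_add_pp (M.b i), M.pm_eq_zero (M.b_mem i), zero_add]
  have h4 : M.pp (M.a i) = 0 := by
    have := M.pm_add_pp (M.a i)
    rwa [M.pm_of_mem (M.a_mem i), add_eq_left] at this
  rw [h3, h4]
  simp [mul_comm]

theorem functional_r21 : m (slice Y l (M.r21 X Y (ptens x y))) = M.form (M.pm p) (M.pp q) := by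
  obtain ⟨F₀, h1⟩ := functional_sumOp hX hY (Or.inl M.tendsZero_b) x y l m hl hm (b := M.a)
  obtain ⟨F₁, h2⟩ := M.gm_expand (M.pm_mem p)
  classical
  refine (h1 (F₀ ∪ F₁) Finset.subset_union_left).trans ?_
  conv_rhs => rw [h2 (F₀ ∪ F₁) Finset.subset_union_right]
  rw [map_sum, LinearMap.sum_apply]
  refine Finset.sum_congr rfl fun i _ => ?_
  rw [hp, hq, map_smul, LinearMap.smul_apply, smul_eq_mul, M.form_pm_pp (M.b i),
    M.form_pm_pp (M.a i), M.pm_eq_zero (M.b_mem i), M.pm_of_mem (M.a_mem i)]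
  have h3 : M.pp (M.b i) = M.b i := by
    conv_rhs => rw [← M.pm_add_pp (M.b i), M.pm_eq_zero (M.b_mem i), zero_add]
  have h4 : M.pp (M.a i) = 0 := by
    have := M.pm_add_pp (M.a i)
    rwa [M.pm_of_mem (M.a_mem i), add_eq_left] at this
  rw [h3, h4]
  simp

/-- The two polarized halves coming from r and r^{21} recombine into the whole form. -/
theorem functional_Omega : m (slice Y l (M.Omega X Y (ptens x y))) = M.form p q := by
  change m (slice Y l (M.r X Y (ptens x y) + M.r21 X Y (ptens x y))) = _
  rw [map_add, map_add, functional_r hX hY hl hm hp hq, functional_r21 hX hY hl hm hp hq,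
    M.form_pm_pp p q, M.symm (M.pm q)]
  ring

end Casimir

/-- homomorphisms of `g`-modules -/
def IsEquivar (f : X →L[k] Y) : Prop := ∀ z t, f (X.act z t) = Y.act z (f t)

namespace IsEquivar

theorem id : IsEquivar (ContinuousLinearMap.id k X) := fun _ _ => rfl

theorem zero : IsEquivar (0 : X →L[k] Y) := fun z t => by simp

theorem comp {f : Y →L[k] Z} {f' : X →L[k] Y} (h : IsEquivar f) (h' : IsEquivar f') :
    IsEquivar (f.comp f') := fun z t => by
  simp only [ContinuousLinearMap.comp_apply]
  rw [h', h]

theorem add {f f' : X →L[k] Y} (h : IsEquivar f) (h' : IsEquivar f') : IsEquivar (f + f') :=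
  fun z t => by
  rw [add_apply, add_apply, map_add, h, h']

theorem sum {ι : Type*} {s : Finset ι} {f : ι → X →L[k] Y} (h : ∀ i ∈ s, IsEquivar (f i)) :
    IsEquivar (∑ i ∈ s, f i) := by
  classical
  induction s using Finset.induction_on with
  | empty => exact zero
  | insert i s hi ih =>
    rw [Finset.sum_insert hi]
    exact add (h i (Finset.mem_insert_self _ _))
      (ih fun j hj => h j (Finset.mem_insert_of_mem hj))

theorem mapT {X : TMod.{u, v, w} k g} {X' : TMod.{u, v, w'} k g} {Y : TMod.{u, v, w''} k g}
    {Y' : TMod.{u, v, v'} k g} {f : X →L[k] X'} {f' : Y →L[k] Y'} (h : IsEquivar f)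
    (h' : IsEquivar f') : IsEquivar (X := tens X Y) (Y := tens X' Y') (RelTwist.mapT f f') := by
  intro z t
  have : (RelTwist.mapT f f').comp ((tens X Y).act z) =
      ((tens X' Y').act z).comp (RelTwist.mapT f f') := by
    refine ctensor_ext fun x y => ?_
    simp only [ContinuousLinearMap.comp_apply]
    rw [tens_act_ptens, map_add, mapT_ptens, mapT_ptens, mapT_ptens, tens_act_ptens, h, h']
  exact DFunLike.congr_fun this t

theorem swapT : IsEquivar (RelTwist.swapT X Y) := by
  intro z t
  have : (RelTwist.swapT X Y).comp ((tens X Y).act z) =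
      ((tens Y X).act z).comp (RelTwist.swapT X Y) := by
    refine ctensor_ext fun x y => ?_
    simp only [ContinuousLinearMap.comp_apply]
    rw [tens_act_ptens, map_add, swapT_ptens, swapT_ptens, swapT_ptens, tens_act_ptens, add_comm]
  exact DFunLike.congr_fun this t

end IsEquivar

theorem ctensor_ext₃ {E : Type*} [AddCommGroup E] [Module k E] [TopologicalSpace E] [T2Space E]
    {F G : tens (tens X Y) Z →L[k] E}
    (h : ∀ x y z, F (ptens (X := tens X Y) (ptens x y) z) = G (ptens (X := tens X Y) (ptens x y) z)) :
    F = G := by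
  refine ctensor_ext (X := tens X Y) (Y := Z) fun t z => ?_
  have : F.comp (ptensR (X := tens X Y) z) = G.comp (ptensR (X := tens X Y) z) :=
    ctensor_ext fun x y => h x y z
  exact DFunLike.congr_fun this t

theorem ctensor_ext₃' {E : Type*} [AddCommGroup E] [Module k E] [TopologicalSpace E] [T2Space E]
    {F G : tens X (tens Y Z) →L[k] E}
    (h : ∀ x y z, F (ptens (Y := tens Y Z) x (ptens y z)) =
      G (ptens (Y := tens Y Z) x (ptens y z))) : F = G := by
  refine ctensor_ext (X := X) (Y := tens Y Z) fun x t => ?_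
  have : F.comp (ptensL (Y := tens Y Z) x) = G.comp (ptensL (Y := tens Y Z) x) :=
    ctensor_ext fun y z => h x y z
  exact DFunLike.congr_fun this t

theorem IsEquivar.assocT : IsEquivar (RelTwist.assocT X Y Z) := by
  intro z t
  have : (RelTwist.assocT X Y Z).comp ((tens (tens X Y) Z).act z) =
      ((tens X (tens Y Z)).act z).comp (RelTwist.assocT X Y Z) := by
    refine ctensor_ext₃ fun a b c => ?_
    simp only [ContinuousLinearMap.comp_apply]
    rw [tens_act_ptens, tens_act_ptens, map_add, ptens_add_left, map_add, assocT_ptens,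
      assocT_ptens, assocT_ptens, assocT_ptens, tens_act_ptens, tens_act_ptens, ptens_add_right,
      add_assoc]
  exact DFunLike.congr_fun this t

theorem IsEquivar.assocInvT : IsEquivar (RelTwist.assocInvT X Y Z) := by
  intro z t
  have : (RelTwist.assocInvT X Y Z).comp ((tens X (tens Y Z)).act z) =
      ((tens (tens X Y) Z).act z).comp (RelTwist.assocInvT X Y Z) := by
    refine ctensor_ext₃' fun a b c => ?_
    simp only [ContinuousLinearMap.comp_apply]
    rw [tens_act_ptens, tens_act_ptens, map_add, ptens_add_right, map_add, assocInvT_ptens,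
      assocInvT_ptens, assocInvT_ptens, assocInvT_ptens, tens_act_ptens, tens_act_ptens,
      ptens_add_left, add_assoc]
  exact DFunLike.congr_fun this t

/-- Let p', q' represent l ∘ z on x and m ∘ z on y. Then l on z x is represented by p' + [z, p], and
m on z y by q' + [z, q]. The two sides of the claim are (p' + [z, p], q) + (p, q' + [z, q]) and (p',
q) + (p, q'); they agree because the form is invariant. -/
theorem isEquivar_Omega (hX : X.IsEquicontinuous M) (hY : Y.IsEquicontinuous M) :
    IsEquivar (M.Omega X Y) := by
  have := hY.complete
  have := hY.separated
  intro z t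
  have : (M.Omega X Y).comp ((tens X Y).act z) = ((tens X Y).act z).comp (M.Omega X Y) := by
    refine ctensor_ext fun x y => eq_of_functionals hY.isLinTop fun l m hl hm => ?_
    simp only [ContinuousLinearMap.comp_apply]
    obtain ⟨p, hp⟩ := hX.exists_form_eq x l hl
    obtain ⟨q, hq⟩ := hY.exists_form_eq y m hm
    have hl' := isOpen_ker_comp l hl (X.act z)
    have hm' := isOpen_ker_comp m hm (Y.act z)
    obtain ⟨p', hp'⟩ := hX.exists_form_eq x _ hl'
    obtain ⟨q', hq'⟩ := hY.exists_form_eq y _ hm'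
    have h1 : ∀ z', l (X.act z' (X.act z x)) = M.form z' (p' + ⁅z, p⁆) := fun z' => by
      have := hX.act_lie z' z x
      rw [map_add, ← hp', M.form_lie_right, ← hp, this, map_sub]
      change _ = l (X.act z (X.act z' x)) + _
      abel
    have h2 : ∀ z', m (Y.act z' (Y.act z y)) = M.form z' (q' + ⁅z, q⁆) := fun z' => by
      have := hY.act_lie z' z y
      rw [map_add, ← hq', M.form_lie_right, ← hq, this, map_sub]
      change _ = m (Y.act z (Y.act z' y)) + _
      abel
    rw [tens_act_ptens, map_add, map_add, map_add, functional_Omega hX hY hl hm h1 hq,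
      functional_Omega hX hY hl hm hp h2]
    change _ = m (slice Y l (RelTwist.mapT (X.act z) (ContinuousLinearMap.id k Y) _ +
      RelTwist.mapT (ContinuousLinearMap.id k X) (Y.act z) _))
    rw [map_add (slice Y l), map_add m, slice_mapT hY.isLinTop hY.isLinTop _ _ l hl,
      slice_mapT hY.isLinTop hY.isLinTop _ _ l hl]
    have e1 : m ((ContinuousLinearMap.id k Y) (slice Y (l.comp (X.act z : X →ₗ[k] X))
        (M.Omega X Y (ptens x y)))) = M.form p' q := functional_Omega hX hY hl' hm hp' hq
    have e2 : m (Y.act z (slice Y (l.comp (ContinuousLinearMap.id k X : X →ₗ[k] X))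
        (M.Omega X Y (ptens x y)))) = M.form p q' := functional_Omega hX hY hl hm' hp hq'
    rw [e1, e2]
    simp only [map_add, LinearMap.add_apply]
    rw [M.form_lie_left, M.form_lie_right]
    ring
  exact DFunLike.congr_fun this t

/-- Topological tensor products of equicontinuous modules are equicontinuous. -/
theorem isEquicontinuous_tens (hX : X.IsEquicontinuous M) (hY : Y.IsEquicontinuous M) :
    (tens X Y).IsEquicontinuous M := by
  have heq : ∀ U : Submodule k (tens X Y), IsOpen (U : Set (tens X Y)) →
      ∃ U' : Submodule k (tens X Y), IsOpen (U' : Set (tens X Y)) ∧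
        ∀ x : g, ∀ t ∈ U', (tens X Y).act x t ∈ U := by
    intro O hO
    obtain ⟨p, hp⟩ := cbasic_isLinTop (X := X) (Y := Y) _ (hO.mem_nhds O.zero_mem)
    obtain ⟨U, hU, h1⟩ := hX.equicontinuous p.1.1 p.1.2
    obtain ⟨U', hU', h2⟩ := hY.equicontinuous p.2.1 p.2.2
    refine ⟨cbasic X Y (interSub p.1 ⟨U, hU⟩, interSub p.2 ⟨U', hU'⟩), isOpen_cbasic _,
      fun z t ht => ?_⟩
    have : cbasic X Y (interSub p.1 ⟨U, hU⟩, interSub p.2 ⟨U', hU'⟩) ≤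
        O.comap ((tens X Y).act z : tens X Y →ₗ[k] tens X Y) := by
      refine cbasic_le ((isClosed_of_isOpen_submodule _ hO).preimage
        ((tens X Y).act z).continuous) (fun x hx y => ?_) (fun x y hy => ?_)
      · change (tens X Y).act z (ptens x y) ∈ O
        rw [tens_act_ptens]
        exact O.add_mem (hp (ptens_mem_cbasic_left (X := X) (Y := Y) (h1 _ _ hx.2) _))
          (hp (ptens_mem_cbasic_left (X := X) (Y := Y) hx.1 _))
      · change (tens X Y).act z (ptens x y) ∈ O
        rw [tens_act_ptens]
        exact O.add_mem (hp (ptens_mem_cbasic_right (X := X) (Y := Y) _ hy.1))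
          (hp (ptens_mem_cbasic_right (X := X) (Y := Y) _ (h2 _ _ hy.2)))
    exact this ht
  have hadd : ∀ x y (t : tens X Y), (tens X Y).act (x + y) t =
      (tens X Y).act x t + (tens X Y).act y t := fun x y t => by
    have : (tens X Y).act (x + y) = (tens X Y).act x + (tens X Y).act y := by
      refine ctensor_ext fun a b => ?_
      rw [tens_act_ptens, add_apply, tens_act_ptens, tens_act_ptens, hX.act_add,
        hY.act_add, ptens_add_left, ptens_add_right]
      abel
    rw [this]; rfl
  have hsmul : ∀ (c : k) x (t : tens X Y), (tens X Y).act (c • x) t =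
      c • (tens X Y).act x t := fun c x t => by
    have : (tens X Y).act (c • x) = c • (tens X Y).act x := by
      refine ctensor_ext fun a b => ?_
      rw [tens_act_ptens, smul_apply, tens_act_ptens, hX.act_smul,
        hY.act_smul, ptens_smul_left, ptens_smul_right, smul_add]
    rw [this]; rfl
  refine ⟨inferInstanceAs (CompleteSpace (CTensor X Y)), inferInstanceAs (T2Space (CTensor X Y)),
    isLinTop_tens, hadd, hsmul, fun x y t => ?_, fun t => ?_, heq⟩
  · have : (tens X Y).act ⁅x, y⁆ = ((tens X Y).act x).comp ((tens X Y).act y) -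
        ((tens X Y).act y).comp ((tens X Y).act x) := by
      refine ctensor_ext fun a b => ?_
      rw [sub_apply]
      simp only [ContinuousLinearMap.comp_apply]
      rw [tens_act_ptens, tens_act_ptens, tens_act_ptens, map_add, map_add, tens_act_ptens,
        tens_act_ptens, tens_act_ptens, tens_act_ptens, hX.act_lie, hY.act_lie]
      simp only [← ptensB_apply, map_sub, LinearMap.sub_apply]
      abel
    rw [this]; rfl
  · let f : g →ₗ[k] CTensor X Y :=
      { toFun := fun z => (tens X Y).act z t
        map_add' := fun x y => hadd x y t
        map_smul' := fun c x => hsmul c x t }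
    refine (M.continuous_iff isLinTop_tens f).2 fun U hU => ?_
    obtain ⟨U', hU', h1⟩ := heq U hU
    classical
    -- Q consists of the vectors whose orbit map is continuous modulo U. It is open by
    -- equicontinuity, hence closed, and it contains the pure tensors; so it is everything.
    let Q : Submodule k (CTensor X Y) :=
      { carrier := {t | ∃ I, ∀ z ∈ M.ann I, (tens X Y).act z t ∈ U}
        zero_mem' := ⟨∅, fun z _ => by rw [map_zero]; exact U.zero_mem⟩
        add_mem' := by
          rintro s t ⟨I, hI⟩ ⟨J, hJ⟩
          refine ⟨I ∪ J, fun z hz => ?_⟩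
          rw [map_add]
          exact U.add_mem (hI z (M.ann_anti Finset.subset_union_left hz))
            (hJ z (M.ann_anti Finset.subset_union_right hz))
        smul_mem' := by
          rintro c t ⟨I, hI⟩
          refine ⟨I, fun z hz => ?_⟩
          rw [map_smul]
          exact U.smul_mem c (hI z hz) }
    have hQ : IsOpen (Q : Set (CTensor X Y)) :=
      isOpen_submodule_mono (fun s hs => ⟨∅, fun z _ => h1 z s hs⟩) hU'
    refine ctensor_induction (P := fun t => t ∈ Q) t (isClosed_of_isOpen_submodule Q hQ)
      Q.zero_mem (fun a b => Q.add_mem) fun x y => ?_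
    obtain ⟨p, hp⟩ := cbasic_isLinTop (X := X) (Y := Y) _ (hU.mem_nhds U.zero_mem)
    obtain ⟨I, hI⟩ := hX.exists_ann x p.1.1 p.1.2
    obtain ⟨J, hJ⟩ := hY.exists_ann y p.2.1 p.2.2
    refine ⟨I ∪ J, fun z hz => ?_⟩
    rw [tens_act_ptens]
    exact U.add_mem
      (hp (ptens_mem_cbasic_left (hI z (M.ann_anti Finset.subset_union_left hz)) _))
      (hp (ptens_mem_cbasic_right _ (hJ z (M.ann_anti Finset.subset_union_right hz))))

/-! ### Equivariance of the constraints -/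

/-- series of homomorphisms of `g`-modules -/
def HSeries.IsEquivar (F : HSeries X Y) : Prop := ∀ n, RelTwist.IsEquivar (F n)

namespace HSeries.IsEquivar

theorem const {f : X →L[k] Y} (h : RelTwist.IsEquivar f) : (HSeries.const f).IsEquivar := by
  intro n
  unfold HSeries.const
  split_ifs
  · exact h
  · exact RelTwist.IsEquivar.zero

theorem comp {F : HSeries Y Z} {G : HSeries X Y} (hF : F.IsEquivar) (hG : G.IsEquivar) :
    (HSeries.comp F G).IsEquivar := fun _ =>
  RelTwist.IsEquivar.sum fun p _ => (hF p.1).comp (hG p.2)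

theorem tensRight {F : HSeries X Y} (hF : F.IsEquivar) (Z : TMod.{u, v, w''} k g) :
    (HSeries.tensRight F Z).IsEquivar := fun n => (hF n).mapT RelTwist.IsEquivar.id

theorem tensLeft (Z : TMod.{u, v, w''} k g) {F : HSeries X Y} (hF : F.IsEquivar) :
    (HSeries.tensLeft Z F).IsEquivar := fun n => RelTwist.IsEquivar.id.mapT (hF n)

end HSeries.IsEquivar

variable (X) in
/-- the algebra of endomorphisms of a `g`-module -/
def equivarSubalgebra : Subalgebra k (X →L[k] X) where
  carrier := {f | IsEquivar f}
  mul_mem' := fun h h' => IsEquivar.comp h h'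
  add_mem' := fun h h' => IsEquivar.add h h'
  algebraMap_mem' := fun c z t => by
    change c • (X.act z t) = X.act z (c • t)
    rw [map_smul]

/-- The coefficients are noncommutative polynomials in x and y. With the subalgebra of
g-endomorphisms this makes the associativity constraints equivariant. -/
theorem coeff_evalFree_mem {R : Type*} [Ring R] [Algebra k R] (S : Subalgebra k R)
    (F : PowerSeries (FreeAlgebra k (Fin 2))) {x y : R} (hx : x ∈ S) (hy : y ∈ S) (n : ℕ) :
    PowerSeries.coeff n (evalFree F x y) ∈ S := by
  unfold evalFree
  rw [PowerSeries.coeff_map]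
  change FreeAlgebra.lift k ![x, y] _ ∈ S
  induction PowerSeries.coeff n F using FreeAlgebra.induction with
  | grade0 r => rw [AlgHom.commutes]; exact S.algebraMap_mem r
  | grade1 i =>
    rw [FreeAlgebra.lift_ι_apply]
    fin_cases i
    · exact hx
    · exact hy
  | mul a b ha hb => rw [map_mul]; exact S.mul_mem ha hb
  | add a b ha hb => rw [map_add]; exact S.add_mem ha hb

theorem coeff_hexp_mem {R : Type*} [Ring R] [Algebra k R] (S : Subalgebra k R) {x : R}
    (hx : x ∈ S) (n : ℕ) : PowerSeries.coeff n (hexp k x) ∈ S := by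
  unfold hexp
  rw [PowerSeries.coeff_mk]
  exact S.smul_mem (S.pow_mem hx n) _

variable (hX : X.IsEquicontinuous M) (hY : Y.IsEquicontinuous M) (hZ : Z.IsEquicontinuous M)

include hX hY

theorem isEquivar_braidInv : (M.braidInv X Y).IsEquivar := by
  refine HSeries.IsEquivar.comp (fun n => ?_) (HSeries.IsEquivar.const IsEquivar.swapT)
  refine coeff_hexp_mem (equivarSubalgebra (tens X Y)) ?_ n
  exact Subalgebra.smul_mem _ (isEquivar_Omega hX hY) _

theorem isEquivar_Omega12 : IsEquivar (M.Omega12 X Y Z) :=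
  (isEquivar_Omega hX hY).mapT IsEquivar.id

omit hX in
include hZ in
theorem isEquivar_Omega23 : IsEquivar (M.Omega23 X Y Z) :=
  IsEquivar.assocInvT.comp ((IsEquivar.id.mapT (isEquivar_Omega hY hZ)).comp IsEquivar.assocT)

include hZ

theorem isEquivar_assoc (Φ : LieAssociator k) : (M.assoc X Y Z Φ).IsEquivar := by
  refine HSeries.IsEquivar.comp (HSeries.IsEquivar.const IsEquivar.assocT) fun n => ?_
  exact coeff_evalFree_mem (equivarSubalgebra (tens (tens X Y) Z)) _
    (isEquivar_Omega12 hX hY) (isEquivar_Omega23 hY hZ) n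

theorem isEquivar_assocInv (Φ : LieAssociator k) : (M.assocInv X Y Z Φ).IsEquivar := by
  refine HSeries.IsEquivar.comp (fun n => ?_) (HSeries.IsEquivar.const IsEquivar.assocInvT)
  exact coeff_evalFree_mem (equivarSubalgebra (tens (tens X Y) Z)) _
    (isEquivar_Omega12 hX hY) (isEquivar_Omega23 hY hZ) n

end Equicontinuous

end

end RelTwist

/-! ### Induced modules and the structure of a split embedding -/

namespace RelTwist

noncomputable section

open scoped TensorProduct Topology
open Filter

set_option linter.unusedSectionVars false

section Induced

attribute [local instance 100] LieRing.ofAssociativeRing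

variable {k : Type u} {g : Type v} [Field k] [LieRing g] [LieAlgebra k g]

/-- U(g) is generated by g: the lift of g → S to U(g), followed by the inclusion of S, is the
identity by the universal property. -/
theorem uea_mem_subalgebra {S : Subalgebra k (UniversalEnvelopingAlgebra k g)}
    (hS : ∀ x : g, UniversalEnvelopingAlgebra.ι k x ∈ S) (t : UniversalEnvelopingAlgebra k g) :
    t ∈ S := by
  let f : g →ₗ⁅k⁆ S :=
    { toFun := fun x => ⟨UniversalEnvelopingAlgebra.ι k x, hS x⟩
      map_add' := fun x y => Subtype.ext (map_add _ _ _)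
      map_smul' := fun c x => Subtype.ext (map_smul _ _ _)
      map_lie' := fun {x y} => Subtype.ext (LieHom.map_lie _ _ _) }
  have h : S.val.comp (UniversalEnvelopingAlgebra.lift k f : UniversalEnvelopingAlgebra k g →ₐ[k] S) =
      AlgHom.id k _ := by
    apply UniversalEnvelopingAlgebra.hom_ext (R := k) (L := g)
    ext x
    simp [f]
  have h1 := DFunLike.congr_fun h t
  rw [AlgHom.id_apply] at h1
  rw [← h1]
  exact (UniversalEnvelopingAlgebra.lift k f t).2

namespace Ind

variable (h : Submodule k g)

theorem lie_one {x : g} (hx : x ∈ h) : ⁅x, one k h⁆ = 0 := by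
  change (UniversalEnvelopingAlgebra.ι k x • one k h : Ind k h) = 0
  unfold one
  erw [← Submodule.Quotient.mk_smul]
  rw [smul_eq_mul, mul_one]
  exact (Submodule.Quotient.mk_eq_zero _).2 (Ideal.subset_span ⟨x, hx, rfl⟩)

theorem exists_smul_one (m : Ind k h) :
    ∃ t : UniversalEnvelopingAlgebra k g, m = t • one k h := by
  obtain ⟨t, rfl⟩ := Submodule.Quotient.mk_surjective _ m
  refine ⟨t, ?_⟩
  unfold one
  erw [← Submodule.Quotient.mk_smul]
  rw [smul_eq_mul, mul_one]

/-- The generator generates. -/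
theorem induction_on {Q : Submodule k (Ind k h)} (h1 : one k h ∈ Q)
    (h2 : ∀ x : g, ∀ m ∈ Q, ⁅x, m⁆ ∈ Q) (m : Ind k h) : m ∈ Q := by
  obtain ⟨t, rfl⟩ := exists_smul_one h m
  let S : Subalgebra k (UniversalEnvelopingAlgebra k g) :=
    { carrier := {t | ∀ m ∈ Q, t • m ∈ Q}
      mul_mem' := fun {s t} hs ht m hm => by rw [mul_smul]; exact hs _ (ht _ hm)
      add_mem' := fun {s t} hs ht m hm => by rw [add_smul]; exact Q.add_mem (hs _ hm) (ht _ hm)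
      algebraMap_mem' := fun c m hm => by
        rw [algebraMap_smul]; exact Q.smul_mem c hm }
  exact uea_mem_subalgebra (S := S) (fun x m hm => h2 x m hm) t _ h1

end Ind

end Induced

namespace SplitEmbedding

variable {k : Type u} {g : Type v} {gD : Type v'} [Field k] [LieRing g] [LieAlgebra k g]
  [LieRing gD] [LieAlgebra k gD] {MD : ManinTriple k gD} {M : ManinTriple k g}
  (i : SplitEmbedding MD M)

theorem mem_orth {x : g} : x ∈ M.form.orthogonal (LinearMap.range (i.hom : gD →ₗ[k] g)) ↔
    ∀ z, M.form (i.hom z) x = 0 := by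
  rw [LinearMap.BilinForm.mem_orthogonal_iff]
  constructor
  · intro h z
    exact h _ ⟨z, rfl⟩
  · rintro h _ ⟨z, rfl⟩
    exact h z

theorem mem_mMinus {x : g} : x ∈ i.mMinus ↔ x ∈ M.gm ∧ ∀ z, M.form (i.hom z) x = 0 := by
  rw [← i.mem_orth]; rfl

theorem mem_mPlus {x : g} : x ∈ i.mPlus ↔ x ∈ M.gp ∧ ∀ z, M.form (i.hom z) x = 0 := by
  rw [← i.mem_orth]; rfl

theorem exists_ann_map (J : Finset M.Index) : ∃ I, ∀ z ∈ MD.ann I, i.hom z ∈ M.ann J := by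
  have h1 : i.hom ⁻¹' (M.ann J : Set g) ∈ @nhds gD MD.top 0 := by
    let _ := M.top
    let _ := MD.top
    refine i.continuous.continuousAt.preimage_mem_nhds ?_
    rw [map_zero]
    exact (M.mem_nhds_zero _).2 ⟨J, subset_rfl⟩
  exact (MD.mem_nhds_zero _).1 h1

/-- the adjoint of the embedding -/
theorem exists_adj (x : g) : ∃ z, ∀ y, M.form (i.hom y) x = MD.form y z := by
  -- By continuity of the embedding, elements near zero of g_D have images in g_+ orthogonal to x_-,
  -- and orthogonal to x_+ by isotropy. So the functional y ↦ (i(y), x) on g_D is continuous and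
  -- representable.
  obtain ⟨J, hJ⟩ := M.exists_ann_le {M.pm x} (Set.finite_singleton _) (by
    rintro s rfl; exact M.pm_mem x)
  obtain ⟨I, hI⟩ := i.exists_ann_map J
  refine MD.exists_form_eq ((M.form.flip x).comp (i.hom : gD →ₗ[k] g)) I fun y hy => ?_
  change M.form (i.hom y) x = 0
  rw [← M.pm_add_pp x, map_add, hJ _ (hI y hy) _ rfl,
    M.isotropic_gp _ (hI y hy).1 _ (M.pp_mem x), add_zero]

/-- Continuity of the embedding; this is what makes r_D and its flip converge on g-modules. -/
theorem tendsZero_hom_b : M.TendsZero fun j => i.hom (MD.b j) := fun J => by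
  obtain ⟨I, hI⟩ := i.exists_ann_map J
  exact (MD.tendsZero_b I).mono fun j hj => hI _ hj

/-- Subtracting the image of the adjoint element makes x orthogonal to i(g_D). That element lies in
g_{D,-} because it is orthogonal to g_{D,-}. -/
theorem gm_decomp {x : g} (hx : x ∈ M.gm) : ∃ z ∈ MD.gm, x - i.hom z ∈ i.mMinus := by
  obtain ⟨z, hz⟩ := i.exists_adj x
  have h1 : z ∈ MD.gm := MD.mem_gm_of_form fun y hy => by
    rw [MD.symm, ← hz, M.isotropic_gm _ (i.map_gm y hy) _ hx]
  refine ⟨z, h1, i.mem_mMinus.2 ⟨sub_mem hx (i.map_gm z h1), fun y => ?_⟩⟩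
  rw [map_sub, i.form_map, hz, sub_self]

theorem gp_decomp {x : g} (hx : x ∈ M.gp) : ∃ z ∈ MD.gp, x - i.hom z ∈ i.mPlus := by
  obtain ⟨z, hz⟩ := i.exists_adj x
  have h1 : z ∈ MD.gp := MD.mem_gp_of_form fun y hy => by
    rw [MD.symm, ← hz, M.isotropic_gp _ (i.map_gp y hy) _ hx]
  refine ⟨z, h1, i.mem_mPlus.2 ⟨sub_mem hx (i.map_gp z h1), fun y => ?_⟩⟩
  rw [map_sub, i.form_map, hz, sub_self]

theorem hom_mem_pPlus (z : gD) : i.hom z ∈ i.pPlus := Submodule.mem_sup_right ⟨z, rfl⟩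

theorem gp_le_pPlus {x : g} (hx : x ∈ M.gp) : x ∈ i.pPlus := by
  obtain ⟨z, -, hz⟩ := i.gp_decomp hx
  rw [← sub_add_cancel x (i.hom z)]
  exact add_mem (Submodule.mem_sup_left hz) (i.hom_mem_pPlus z)

theorem pPlus_decomp {x : g} (hx : x ∈ i.pPlus) : ∃ y ∈ M.gp, ∃ z ∈ MD.gm, x = y + i.hom z := by
  obtain ⟨y, hy, _, ⟨z, rfl⟩, rfl⟩ := Submodule.mem_sup.1 hx
  refine ⟨y + i.hom (MD.pp z), add_mem (i.mem_mPlus.1 hy).1 (i.map_gp _ (MD.pp_mem z)), MD.pm z,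
    MD.pm_mem z, ?_⟩
  rw [add_assoc, ← map_add, add_comm (MD.pp z), MD.pm_add_pp]
  rfl

theorem lie_hom_orth (z : gD) {m : g} (hm : ∀ z, M.form (i.hom z) m = 0) (y : gD) :
    M.form (i.hom y) ⁅i.hom z, m⁆ = 0 := by
  rw [M.form_lie_right, ← LieHom.map_lie, hm]

/-- The bracket is orthogonal to i(g_D) by invariance. It remains to pair it with m' in m_-, and
([i(z), m], m') = (i(z), [m, m']) vanishes because m_- is a subalgebra. This is where splitness
makes i(g_D) normalize m_-. -/
theorem lie_hom_mMinus (z : gD) {m : g} (hm : m ∈ i.mMinus) : ⁅i.hom z, m⁆ ∈ i.mMinus := by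
  have h := i.mem_mMinus.1 hm
  refine i.mem_mMinus.2 ⟨M.mem_gm_of_form fun y hy => ?_, i.lie_hom_orth z h.2⟩
  obtain ⟨z', -, hz'⟩ := i.gm_decomp hy
  rw [← sub_add_cancel y (i.hom z'), map_add, M.symm _ (i.hom z'), i.lie_hom_orth z h.2,
    add_zero, M.invariant]
  exact (i.mem_mMinus.1 (i.split_gm _ hm _ hz')).2 z

theorem lie_hom_mPlus (z : gD) {m : g} (hm : m ∈ i.mPlus) : ⁅i.hom z, m⁆ ∈ i.mPlus := by
  have h := i.mem_mPlus.1 hm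
  refine i.mem_mPlus.2 ⟨M.mem_gp_of_form fun y hy => ?_, i.lie_hom_orth z h.2⟩
  obtain ⟨z', -, hz'⟩ := i.gp_decomp hy
  rw [← sub_add_cancel y (i.hom z'), map_add, M.symm _ (i.hom z'), i.lie_hom_orth z h.2,
    add_zero, M.invariant]
  exact (i.mem_mPlus.1 (i.split_gp _ hm _ hz')).2 z

theorem lie_mMinus {x y : g} (hx : x ∈ i.mMinus) (hy : y ∈ i.mMinus) : ⁅x, y⁆ ∈ i.mMinus :=
  i.split_gm x hx y hy

theorem lie_pPlus {x y : g} (hx : x ∈ i.pPlus) (hy : y ∈ i.pPlus) : ⁅x, y⁆ ∈ i.pPlus := by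
  obtain ⟨a, ha, _, ⟨z, rfl⟩, rfl⟩ := Submodule.mem_sup.1 hx
  obtain ⟨b, hb, _, ⟨z', rfl⟩, rfl⟩ := Submodule.mem_sup.1 hy
  simp only [add_lie, lie_add]
  refine add_mem (add_mem ?_ ?_) (add_mem ?_ ?_)
  · exact Submodule.mem_sup_left (i.split_gp a ha b hb)
  · exact Submodule.mem_sup_left (i.lie_hom_mPlus z hb)
  · rw [← lie_skew]
    exact neg_mem (Submodule.mem_sup_left (i.lie_hom_mPlus z' ha))
  · have : ⁅i.hom z, i.hom z'⁆ = i.hom ⁅z, z'⁆ := (LieHom.map_lie _ _ _).symm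
    exact this ▸ i.hom_mem_pPlus _

/-- If y + i(z) with y in m_+ lies in m_-, pairing with i(g_D) gives z = 0 by nondegeneracy on g_D,
and then y lies in both g_+ and g_-. The sum is everything by `gm_decomp`. -/
theorem isCompl_pPlus_mMinus : IsCompl i.pPlus i.mMinus := by
  refine IsCompl.of_eq ?_ ?_
  · rw [eq_bot_iff]
    rintro x ⟨h1, h2⟩
    obtain ⟨y, hy, _, ⟨z, rfl⟩, rfl⟩ := Submodule.mem_sup.1 h1
    have hy' := i.mem_mPlus.1 hy
    have h2' := i.mem_mMinus.1 h2
    have hz : z = 0 := MD.nondegenerate z fun z' => by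
      have := h2'.2 z'
      rw [map_add, hy'.2, zero_add] at this
      rw [MD.symm, ← i.form_map]
      exact this
    have h3 : y ∈ M.gm := by simpa [hz] using h2'.1
    have h4 : y = 0 := by
      rw [← M.pm_of_mem h3, M.pm_eq_zero hy'.1]
    simp [hz, h4]
  · rw [eq_top_iff]
    rintro x -
    obtain ⟨z, -, hz⟩ := i.gm_decomp (M.pm_mem x)
    have : x = (i.hom z + M.pp x) + (M.pm x - i.hom z) := by
      conv_lhs => rw [← M.pm_add_pp x]
      abel
    rw [this]
    exact Submodule.add_mem_sup (add_mem (i.hom_mem_pPlus z) (i.gp_le_pPlus (M.pp_mem x))) hz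

theorem exists_decomp (x : g) : ∃ p ∈ i.pPlus, ∃ m ∈ i.mMinus, x = p + m := by
  obtain ⟨p, hp, m, hm, h⟩ := Submodule.mem_sup.1
    (show x ∈ i.pPlus ⊔ i.mMinus by rw [i.isCompl_pPlus_mMinus.sup_eq_top]; trivial)
  exact ⟨p, hp, m, hm, h.symm⟩

/-! ### Words in the relative Verma module -/

theorem word_nil : i.word [] = Ind.one k i.mMinus := rfl

theorem word_cons (x : g) (l : List g) : i.word (x :: l) = ⁅x, i.word l⁆ := rfl

theorem word_append (l l' : List g) :
    i.word (l ++ l') = l.foldr (fun x m => ⁅x, m⁆) (i.word l') := by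
  unfold word
  rw [List.foldr_append]

/-- a word with one variable letter, as a linear map -/
def wordMid (l l' : List g) : g →ₗ[k] i.NPlus where
  toFun z := i.word (l ++ z :: l')
  map_add' x y := by
    induction l with
    | nil => simp only [List.nil_append, word_cons, add_lie]
    | cons a l ih => simp only [List.cons_append, word_cons, ih, lie_add]
  map_smul' c x := by
    induction l with
    | nil => simp only [List.nil_append, word_cons, smul_lie, RingHom.id_apply]
    | cons a l ih => simp only [List.cons_append, word_cons, ih, lie_smul, RingHom.id_apply]

theorem wordMid_apply (l l' : List g) (z : g) : i.wordMid l l' z = i.word (l ++ z :: l') := rfl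

theorem word_swap (l l' : List g) (x y : g) :
    i.word (l ++ x :: y :: l') = i.word (l ++ y :: x :: l') + i.word (l ++ ⁅x, y⁆ :: l') := by
  induction l with
  | nil =>
    simp only [List.nil_append, word_cons]
    rw [leibniz_lie, add_comm]
  | cons a l ih => simp only [List.cons_append, word_cons, ih, lie_add]

/-- As i(g_D) normalizes m_-, an element of m_- can be moved to the right through letters of
i(g_{D,-}) until it meets 1_+. -/
theorem lie_word_eq_zero {m : g} (hm : m ∈ i.mMinus) (l : List g)
    (hl : ∀ y ∈ l, ∃ z ∈ MD.gm, i.hom z = y) : ⁅m, i.word l⁆ = 0 := by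
  induction l generalizing m with
  | nil => exact Ind.lie_one _ hm
  | cons y l ih =>
    obtain ⟨z, -, rfl⟩ := hl y List.mem_cons_self
    have hl' := fun y hy => hl y (List.mem_cons_of_mem _ hy)
    have h1 : ⁅m, i.hom z⁆ ∈ i.mMinus := by
      rw [← lie_skew]
      exact neg_mem (i.lie_hom_mMinus z hm)
    rw [word_cons, leibniz_lie, ih hm hl', ih h1 hl', lie_zero, add_zero]

theorem filt_mono {m n : ℕ} (h : m ≤ n) : i.filt m ≤ i.filt n :=
  Submodule.span_mono fun _ ⟨l, h1, h2, h3⟩ => ⟨l, h1.trans h, h2, h3⟩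

theorem word_mem_filt (l : List g) (hl : ∀ x ∈ l, x ∈ i.pPlus) : i.word l ∈ i.filt l.length :=
  Submodule.subset_span ⟨l, le_rfl, hl, rfl⟩

theorem one_mem_filt (n : ℕ) : Ind.one k i.mMinus ∈ i.filt n :=
  Submodule.subset_span ⟨[], Nat.zero_le _, by simp, rfl⟩

theorem lie_pPlus_filt {x : g} (hx : x ∈ i.pPlus) {n : ℕ} {z : i.NPlus} (hz : z ∈ i.filt n) :
    ⁅x, z⁆ ∈ i.filt (n + 1) := by
  unfold filt at hz
  induction hz using Submodule.span_induction with
  | mem z hz =>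
    obtain ⟨l, h1, h2, rfl⟩ := hz
    refine Submodule.subset_span ⟨x :: l, by simpa using h1, fun y hy => ?_, rfl⟩
    rcases List.mem_cons.1 hy with rfl | hy
    · exact hx
    · exact h2 y hy
  | zero => rw [lie_zero]; exact zero_mem _
  | add a b _ _ ha hb => rw [lie_add]; exact add_mem ha hb
  | smul c a _ ha => rw [lie_smul]; exact Submodule.smul_mem _ c ha

/-- Moving m past a letter x produces [m, x], whose p_+-part only replaces that letter and whose
m_--part acts on a shorter word. So m_- does not raise the filtration, and an arbitrary element of g
raises it by at most one. -/
theorem lie_mMinus_word {m : g} (hm : m ∈ i.mMinus) (l : List g) (hl : ∀ x ∈ l, x ∈ i.pPlus) :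
    ⁅m, i.word l⁆ ∈ i.filt l.length := by
  induction l generalizing m with
  | nil => rw [word_nil, Ind.lie_one _ hm]; exact zero_mem _
  | cons x l ih =>
    have hl' := fun y hy => hl y (List.mem_cons_of_mem _ hy)
    have hx := hl x List.mem_cons_self
    rw [word_cons, leibniz_lie]
    refine add_mem ?_ (i.lie_pPlus_filt hx (ih hm hl'))
    obtain ⟨p, hp, m', hm', h⟩ := i.exists_decomp ⁅m, x⁆
    rw [h, add_lie]
    exact add_mem (i.lie_pPlus_filt hp (i.word_mem_filt l hl'))
      (i.filt_mono (Nat.le_succ _) (ih hm' hl'))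

theorem lie_mMinus_filt {m : g} (hm : m ∈ i.mMinus) {n : ℕ} {z : i.NPlus} (hz : z ∈ i.filt n) :
    ⁅m, z⁆ ∈ i.filt n := by
  unfold filt at hz
  induction hz using Submodule.span_induction with
  | mem z hz =>
    obtain ⟨l, h1, h2, rfl⟩ := hz
    exact i.filt_mono h1 (i.lie_mMinus_word hm l h2)
  | zero => rw [lie_zero]; exact zero_mem _
  | add a b _ _ ha hb => rw [lie_add]; exact add_mem ha hb
  | smul c a _ ha => rw [lie_smul]; exact Submodule.smul_mem _ c ha

theorem lie_filt (x : g) {n : ℕ} {z : i.NPlus} (hz : z ∈ i.filt n) : ⁅x, z⁆ ∈ i.filt (n + 1) := by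
  obtain ⟨p, hp, m, hm, rfl⟩ := i.exists_decomp x
  rw [add_lie]
  exact add_mem (i.lie_pPlus_filt hp hz) (i.filt_mono (Nat.le_succ _) (i.lie_mMinus_filt hm hz))

theorem exists_mem_filt (z : i.NPlus) : ∃ n, z ∈ i.filt n := by
  let Q : Submodule k i.NPlus :=
    { carrier := {z | ∃ n, z ∈ i.filt n}
      zero_mem' := ⟨0, zero_mem _⟩
      add_mem' := by
        rintro a b ⟨m, hm⟩ ⟨n, hn⟩
        exact ⟨max m n, add_mem (i.filt_mono (le_max_left _ _) hm)
          (i.filt_mono (le_max_right _ _) hn)⟩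
      smul_mem' := by
        rintro c a ⟨n, hn⟩
        exact ⟨n, Submodule.smul_mem _ c hn⟩ }
  exact Ind.induction_on _ (Q := Q) ⟨0, i.one_mem_filt 0⟩
    (fun x m ⟨n, hn⟩ => ⟨n + 1, i.lie_filt x hn⟩) z

/-- ordered words: letters from `g_+` followed by letters from `g_{D,-}` -/
def IsOrdered (lx ly : List g) : Prop :=
  (∀ x ∈ lx, x ∈ M.gp) ∧ ∀ y ∈ ly, ∃ z ∈ MD.gm, i.hom z = y

/-- the span of the ordered words of bounded length -/
def ordFilt (n : ℕ) : Submodule k i.NPlus :=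
  Submodule.span k {z | ∃ lx ly : List g, lx.length + ly.length ≤ n ∧ i.IsOrdered lx ly ∧
    z = i.word (lx ++ ly)}

theorem ordFilt_mono {m n : ℕ} (h : m ≤ n) : i.ordFilt m ≤ i.ordFilt n :=
  Submodule.span_mono fun _ ⟨lx, ly, h1, h2⟩ => ⟨lx, ly, h1.trans h, h2⟩

theorem lie_gp_ordFilt {x : g} (hx : x ∈ M.gp) {n : ℕ} {z : i.NPlus} (hz : z ∈ i.ordFilt n) :
    ⁅x, z⁆ ∈ i.ordFilt (n + 1) := by
  unfold ordFilt at hz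
  induction hz using Submodule.span_induction with
  | mem z hz =>
    obtain ⟨lx, ly, h1, h2, rfl⟩ := hz
    refine Submodule.subset_span ⟨x :: lx, ly, by rw [List.length_cons]; omega,
      ⟨fun y hy => ?_, h2.2⟩, rfl⟩
    rcases List.mem_cons.1 hy with rfl | hy
    · exact hx
    · exact h2.1 y hy
  | zero => rw [lie_zero]; exact zero_mem _
  | add a b _ _ ha hb => rw [lie_add]; exact add_mem ha hb
  | smul c a _ ha => rw [lie_smul]; exact Submodule.smul_mem _ c ha

/-- The letter i(y) is moved behind the letters of g_+. Each commutator lies in p_+ = g_+ +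
i(g_{D,-}), so it gives a letter of g_+ in front and another element of g_{D,-} acting on a shorter
word; hence the induction is over all y. -/
theorem lie_gm_ordered {y : gD} (hy : y ∈ MD.gm) (lx ly : List g) (h : i.IsOrdered lx ly) :
    ⁅i.hom y, i.word (lx ++ ly)⁆ ∈ i.ordFilt (lx.length + ly.length + 1) := by
  induction lx generalizing y with
  | nil =>
    refine Submodule.subset_span ⟨[], i.hom y :: ly, by simp, ⟨by simp, fun z hz => ?_⟩, rfl⟩
    rcases List.mem_cons.1 hz with rfl | hz
    · exact ⟨y, hy, rfl⟩
    · exact h.2 z hz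
  | cons x lx ih =>
    have hx := h.1 x List.mem_cons_self
    have h' : i.IsOrdered lx ly := ⟨fun z hz => h.1 z (List.mem_cons_of_mem _ hz), h.2⟩
    have hlen : (x :: lx).length + ly.length + 1 = lx.length + ly.length + 1 + 1 := by
      rw [List.length_cons]; omega
    have hmem : i.word (lx ++ ly) ∈ i.ordFilt (lx.length + ly.length) :=
      Submodule.subset_span ⟨lx, ly, le_rfl, h', rfl⟩
    rw [List.cons_append, word_cons, leibniz_lie, hlen]
    refine add_mem ?_ (i.lie_gp_ordFilt hx (ih hy h'))
    obtain ⟨y', hy', z, hz, e⟩ := i.pPlus_decomp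
      (i.lie_pPlus (i.hom_mem_pPlus y) (i.gp_le_pPlus hx))
    rw [e, add_lie]
    exact i.ordFilt_mono (Nat.le_succ _) (add_mem (i.lie_gp_ordFilt hy' hmem) (ih hz h'))

theorem lie_pPlus_ordFilt {x : g} (hx : x ∈ i.pPlus) {n : ℕ} {z : i.NPlus}
    (hz : z ∈ i.ordFilt n) : ⁅x, z⁆ ∈ i.ordFilt (n + 1) := by
  obtain ⟨x', hx', y, hy, rfl⟩ := i.pPlus_decomp hx
  rw [add_lie]
  refine add_mem (i.lie_gp_ordFilt hx' hz) ?_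
  unfold ordFilt at hz
  induction hz using Submodule.span_induction with
  | mem z hz =>
    obtain ⟨lx, ly, h1, h2, rfl⟩ := hz
    exact i.ordFilt_mono (Nat.succ_le_succ h1) (i.lie_gm_ordered hy lx ly h2)
  | zero => rw [lie_zero]; exact zero_mem _
  | add a b _ _ ha hb => rw [lie_add]; exact add_mem ha hb
  | smul c a _ ha => rw [lie_smul]; exact Submodule.smul_mem _ c ha

/-- A spanning statement in the style of Poincaré–Birkhoff–Witt. It links the topology of N_+^*,
defined through all words in p_+, with `IsCont`, which tests ordered words only. -/
theorem filt_le_ordFilt (n : ℕ) : i.filt n ≤ i.ordFilt n := by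
  refine Submodule.span_le.2 ?_
  rintro _ ⟨l, h1, h2, rfl⟩
  refine i.ordFilt_mono h1 ?_
  clear h1
  induction l with
  | nil => exact Submodule.subset_span ⟨[], [], by simp, ⟨by simp, by simp⟩, rfl⟩
  | cons x l ih =>
    exact i.lie_pPlus_ordFilt (h2 x List.mem_cons_self)
      (ih fun y hy => h2 y (List.mem_cons_of_mem _ hy))

theorem word_ordered_mem_filt {lx ly : List g} (h : i.IsOrdered lx ly) :
    i.word (lx ++ ly) ∈ i.filt (lx.length + ly.length) := by
  rw [← List.length_append]
  refine i.word_mem_filt _ fun x hx => ?_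
  rcases List.mem_append.1 hx with hx | hx
  · exact i.gp_le_pPlus (h.1 x hx)
  · obtain ⟨z, -, rfl⟩ := h.2 x hx
    exact i.hom_mem_pPlus z

/-! ### Continuous functionals -/

theorem isCont_iff (f : Module.Dual k i.NPlus) : i.IsCont f ↔ ∀ p q, ∃ I : Finset M.Index,
    ∀ lx ly : List g, lx.length = p → ly.length = q → i.IsOrdered lx ly →
      (∃ x ∈ lx, x ∈ M.ann I) → f (i.word (lx ++ ly)) = 0 := by
  refine forall_congr' fun p => forall_congr' fun q => ⟨?_, ?_⟩
  · rintro ⟨S, hS, h⟩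
    obtain ⟨I, hI⟩ := M.exists_ann_le S S.finite_toSet hS
    exact ⟨I, fun lx ly h1 h2 h3 ⟨x, hx, hxI⟩ => h lx ly h1 h2 h3.1 h3.2 ⟨x, hx, hI x hxI⟩⟩
  · rintro ⟨I, h⟩
    obtain ⟨S, hS, hS'⟩ := M.exists_finset_isCont I
    exact ⟨S, hS, fun lx ly h1 h2 h3 h4 ⟨x, hx, hxS⟩ =>
      h lx ly h1 h2 ⟨h3, h4⟩ ⟨x, hx, hS' x (h3 x hx) hxS⟩⟩

/-- The extra letter z of g_- is moved to the right through the b letters of g_+. Passing a letter x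
leaves a correction with [z, x] in place of x. The g_+-part of [z, x] gives an ordered word and is
small when x is, by continuity of the bracket. The g_--part depends on finitely many coordinates of
x, so it amounts to inserting finitely many fixed elements of g_-, with fewer letters left to cross.
-/
theorem IsCont.insert_gm {f : Module.Dual k i.NPlus} (hf : i.IsCont f) (b : ℕ) {z : g}
    (hz : z ∈ M.gm) (a q : ℕ) : ∃ I : Finset M.Index, ∀ l₁ l₂ ly : List g, l₁.length = a →
      l₂.length = b → ly.length = q → i.IsOrdered (l₁ ++ l₂) ly →
      (∃ x ∈ l₁ ++ l₂, x ∈ M.ann I) → f (i.word (l₁ ++ z :: (l₂ ++ ly))) = 0 := by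
  classical
  have hf' := (i.isCont_iff f).1 hf
  induction b generalizing z a with
  | zero =>
    -- Nothing from g_+ is left to cross: the m_--part of z kills the remaining word, and the part
    -- in i(g_{D,-}) becomes one more letter of the second kind, whence the q + 1 below.
    obtain ⟨z', hz', hm⟩ := i.gm_decomp hz
    obtain ⟨I, hI⟩ := hf' a (q + 1)
    refine ⟨I, fun l₁ l₂ ly h1 h2 h3 h4 h5 => ?_⟩
    obtain rfl := List.length_eq_zero_iff.1 h2
    rw [List.append_nil] at h4 h5
    have : i.word (l₁ ++ z :: ([] ++ ly)) = i.word (l₁ ++ i.hom z' :: ly) := by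
      rw [List.nil_append, word_append, word_append i l₁, word_cons, word_cons]
      congr 1
      rw [← sub_eq_zero, ← sub_lie]
      exact i.lie_word_eq_zero hm ly h4.2
    rw [this]
    refine hI l₁ (i.hom z' :: ly) h1 (by simp [h3]) ⟨h4.1, fun y hy => ?_⟩ h5
    rcases List.mem_cons.1 hy with rfl | hy
    · exact ⟨z', hz', rfl⟩
    · exact h4.2 y hy
  | succ b ih =>
    obtain ⟨I₁, hI₁⟩ := ih hz (a + 1)
    obtain ⟨I₂, hI₂⟩ := hf' (a + 1 + b) q
    -- J serves twice: letters in `ann J` have bracket with z in `ann I₂`, and that bracket has no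
    -- g_--part. So only the finitely many elements [z, b^j] with j in J matter below.
    obtain ⟨J, hJ⟩ := M.ad_mem_ann z I₂
    choose I₃ hI₃ using fun j => ih (M.pm_mem ⁅z, M.b j⁆) a
    refine ⟨I₁ ∪ (I₂ ∪ (J ∪ J.biUnion I₃)), fun l₁ l₂ ly h1 h2 h3 h4 h5 => ?_⟩
    obtain ⟨x, l₂, rfl⟩ := List.exists_cons_of_length_eq_add_one h2
    have hlen : l₂.length = b := by simpa using h2
    have hx : x ∈ M.gp := h4.1 x (by simp)
    obtain ⟨x', hx'mem, hx'⟩ := h5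
    have hx₁ := M.ann_anti Finset.subset_union_left hx'
    have hx' := M.ann_anti Finset.subset_union_right hx'
    have hx₂ := M.ann_anti Finset.subset_union_left hx'
    have hx' := M.ann_anti Finset.subset_union_right hx'
    have hxJ := M.ann_anti Finset.subset_union_left hx'
    have hx₃ := M.ann_anti Finset.subset_union_right hx'
    rw [List.cons_append, word_swap, map_add]
    have e1 : f (i.word (l₁ ++ x :: z :: (l₂ ++ ly))) = 0 := by
      have := hI₁ (l₁ ++ [x]) l₂ ly (by simp [h1]) hlen h3 (by simpa using h4)
        ⟨x', by simpa using hx'mem, hx₁⟩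
      simpa using this
    have e2 : f (i.wordMid l₁ (l₂ ++ ly) (M.pp ⁅z, x⁆)) = 0 := by
      have := hI₂ (l₁ ++ M.pp ⁅z, x⁆ :: l₂) ly (by simp [h1, hlen]; omega) h3
        ⟨fun y hy => ?_, h4.2⟩ ?_
      · simpa [wordMid_apply] using this
      · rcases List.mem_append.1 hy with hy | hy
        · exact h4.1 y (by simp [hy])
        · rcases List.mem_cons.1 hy with rfl | hy
          · exact M.pp_mem _
          · exact h4.1 y (by simp [hy])
      · rcases List.mem_append.1 hx'mem with hm | hm
        · exact ⟨x', by simp [hm], hx₂⟩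
        · rcases List.mem_cons.1 hm with rfl | hm
          · refine ⟨M.pp ⁅z, x'⁆, by simp, ?_⟩
            have h6 := hJ x' hxJ
            have h7 := M.pm_add_pp ⁅z, x'⁆
            rw [M.pm_eq_zero h6.1, zero_add] at h7
            rw [h7]
            exact h6
          · exact ⟨x', by simp [hm], hx₂⟩
    have e3 : f (i.wordMid l₁ (l₂ ++ ly) (M.pm ⁅z, x⁆)) = 0 := by
      let L : g →ₗ[k] g := M.pm.comp (LieModule.toEnd k g g z)
      have h6 : L x = ∑ j ∈ J, M.form x (M.a j) • L (M.b j) := by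
        have := M.lin_expand L ⊥ J (fun y hy => M.pm_eq_zero (hJ y hy).1) hx
        rwa [Submodule.mem_bot, sub_eq_zero] at this
      change f (i.wordMid l₁ (l₂ ++ ly) (L x)) = 0
      rw [h6, map_sum, map_sum]
      refine Finset.sum_eq_zero fun j hj => ?_
      rw [map_smul, map_smul]
      -- If the small letter is the one absorbed into the bracket, its coordinates indexed by J
      -- vanish. Otherwise it survives among the other letters and the induction hypothesis applies.
      by_cases hm : x' = x
      · subst hm
        rw [hxJ.2 j hj, zero_smul]
      · have : f (i.word (l₁ ++ L (M.b j) :: (l₂ ++ ly))) = 0 := by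
          refine hI₃ j l₁ l₂ ly h1 hlen h3 ⟨fun y hy => h4.1 y ?_, h4.2⟩ ⟨x', ?_, ?_⟩
          · rcases List.mem_append.1 hy with hy | hy <;> simp [hy]
          · simpa [hm] using hx'mem
          · exact M.ann_anti (Finset.subset_biUnion_of_mem I₃ hj) hx₃
        rw [wordMid_apply, this, smul_zero]
    rw [e1, zero_add, ← wordMid_apply, ← M.pm_add_pp ⁅z, x⁆, map_add, map_add, e2, e3, add_zero]

/-- The g_--part of x is inserted at the front by `insert_gm`; the g_+-part lengthens the ordered
word by one letter. -/
theorem IsCont.lie {f : Module.Dual k i.NPlus} (hf : i.IsCont f) (x : g) :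
    i.IsCont (f.comp (LieModule.toEnd k g i.NPlus x)) := by
  classical
  refine (i.isCont_iff _).2 fun p q => ?_
  obtain ⟨I₁, h₁⟩ := hf.insert_gm i p (M.pm_mem x) 0 q
  obtain ⟨I₂, h₂⟩ := (i.isCont_iff f).1 hf (p + 1) q
  refine ⟨I₁ ∪ I₂, fun lx ly h1 h2 h3 ⟨y, hy, hyI⟩ => ?_⟩
  change f ⁅x, i.word (lx ++ ly)⁆ = 0
  have e1 : f ⁅M.pm x, i.word (lx ++ ly)⁆ = 0 :=
    h₁ [] lx ly rfl h1 h2 h3 ⟨y, hy, M.ann_anti Finset.subset_union_left hyI⟩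
  have e2 : f ⁅M.pp x, i.word (lx ++ ly)⁆ = 0 := by
    refine h₂ (M.pp x :: lx) ly (by simp [h1]) h2 ⟨fun z hz => ?_, h3.2⟩
      ⟨y, List.mem_cons_of_mem _ hy, M.ann_anti Finset.subset_union_right hyI⟩
    rcases List.mem_cons.1 hz with rfl | hz
    · exact M.pp_mem x
    · exact h3.1 z hz
  rw [← M.pm_add_pp x, add_lie, map_add, e1, e2, add_zero]

end SplitEmbedding

end

end RelTwist

/-! ### The topological module N_+^* and its product -/

namespace RelTwist

noncomputable section

open scoped TensorProduct Topology
open Filter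

set_option linter.unusedSectionVars false

namespace SplitEmbedding

variable {k : Type u} {g : Type v} {gD : Type v'} [Field k] [LieRing g] [LieAlgebra k g]
  [LieRing gD] [LieAlgebra k gD] {MD : ManinTriple k gD} {M : ManinTriple k g}
  (i : SplitEmbedding MD M)

theorem NStarFilt_anti {m n : ℕ} (h : m ≤ n) : i.NStarFilt n ≤ i.NStarFilt m :=
  fun _ hf z hz => hf z (i.filt_mono h hz)

theorem NStar_mem_nhds_zero (s : Set i.NStar) :
    s ∈ 𝓝 (0 : i.NStar) ↔ ∃ n, (i.NStarFilt n : Set i.NStar) ⊆ s :=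
  linearUniformity_mem_nhds_zero _ (fun m n => ⟨max m n, i.NStarFilt_anti (le_max_left _ _),
    i.NStarFilt_anti (le_max_right _ _)⟩) s

theorem isOpen_NStarFilt (n : ℕ) : IsOpen (i.NStarFilt n : Set i.NStar) :=
  isOpen_submodule_of_mem_nhds (E := i.NStar) (i.NStarFilt n) ((i.NStar_mem_nhds_zero _).2 ⟨n, subset_rfl⟩)

theorem isLinTop_NStar : IsLinTop k i.NStar := fun s hs => by
  obtain ⟨n, hn⟩ := (i.NStar_mem_nhds_zero s).1 hs
  exact ⟨_, i.isOpen_NStarFilt n, hn⟩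

theorem continuous_NStar {E : Type*} [AddCommGroup E] [Module k E] [TopologicalSpace E]
    [IsTopologicalAddGroup E] (f : E →ₗ[k] i.NStar)
    (h : ∀ n, IsOpen ((i.NStarFilt n).comap f : Set E)) : Continuous f := by
  refine i.isLinTop_NStar.continuous_of_open f fun U hU => ?_
  obtain ⟨n, hn⟩ := (i.NStar_mem_nhds_zero _).1 (hU.mem_nhds U.zero_mem)
  exact isOpen_submodule_mono (Submodule.comap_mono hn) (h n)

instance : T2Space i.NStar := by
  refine IsTopologicalAddGroup.t2Space_of_zero_sep fun f hf => ?_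
  have : f.1 ≠ 0 := fun h => hf (Subtype.ext h)
  obtain ⟨z, hz⟩ := DFunLike.ne_iff.1 this
  obtain ⟨n, hn⟩ := i.exists_mem_filt z
  exact ⟨i.NStarFilt n, (i.isOpen_NStarFilt n).mem_nhds (zero_mem _), fun h => hz (h z hn)⟩

/-- A Cauchy filter has a well-defined restriction to each filtration step, and these restrictions
glue to a functional. Continuity of the limit is tested on words of a fixed type (p, q), which lie
in the single step p + q, where the limit agrees with a continuous functional. -/
instance : CompleteSpace i.NStar := by
  refine ⟨fun {F} hF => ?_⟩
  have hne := hF.1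
  have h1 : ∀ n, ∃ A ∈ F, ∀ a ∈ A, ∀ b ∈ A, b - a ∈ i.NStarFilt n := fun n => by
    have h2 : {p : i.NStar × i.NStar | p.2 - p.1 ∈ i.NStarFilt n} ∈ uniformity i.NStar := by
      rw [uniformity_eq_comap_nhds_zero]
      exact preimage_mem_comap ((i.isOpen_NStarFilt n).mem_nhds (zero_mem _))
    obtain ⟨A, hA, hA'⟩ := (cauchy_iff.1 hF).2 _ h2
    exact ⟨A, hA, fun a ha b hb => hA' (Set.mk_mem_prod ha hb)⟩
  choose A hA hA' using h1
  choose f hf using fun n => hF.1.nonempty_of_mem (hA n)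
  have h2 : ∀ m n z, z ∈ i.filt m → z ∈ i.filt n → (f m).1 z = (f n).1 z := by
    intro m n z hm hn
    obtain ⟨c, hc⟩ := hF.1.nonempty_of_mem (inter_mem (hA m) (hA n))
    have e1 : c.1 z - (f m).1 z = 0 := hA' m _ (hf m) _ hc.1 z hm
    have e2 : c.1 z - (f n).1 z = 0 := hA' n _ (hf n) _ hc.2 z hn
    rw [← sub_eq_zero.1 e1, sub_eq_zero.1 e2]
  choose d hd using i.exists_mem_filt
  have h3 : ∀ n z, z ∈ i.filt n → (f (d z)).1 z = (f n).1 z := fun n z hz => h2 _ _ z (hd z) hz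
  let φ : Module.Dual k i.NPlus :=
    { toFun := fun z => (f (d z)).1 z
      map_add' := fun x y => by
        have hx := i.filt_mono (le_max_left (d x) (d y)) (hd x)
        have hy := i.filt_mono (le_max_right (d x) (d y)) (hd y)
        rw [h3 _ _ hx, h3 _ _ hy, h3 _ _ (add_mem hx hy), map_add]
      map_smul' := fun c x => by
        rw [h3 _ _ (Submodule.smul_mem _ c (hd x)), map_smul]; rfl }
  have hφ : i.IsCont φ := by
    refine (i.isCont_iff φ).2 fun p q => ?_
    obtain ⟨I, hI⟩ := (i.isCont_iff _).1 (f (p + q)).2 p q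
    refine ⟨I, fun lx ly e1 e2 e3 e4 => ?_⟩
    refine (h3 (p + q) _ ?_).trans (hI lx ly e1 e2 e3 e4)
    subst e1 e2
    exact i.word_ordered_mem_filt e3
  refine ⟨⟨φ, hφ⟩, ?_⟩
  rw [nhds_eq_comap_uniformity, uniformity_eq_comap_nhds_zero, comap_comap]
  rintro s ⟨t, ht, hs⟩
  obtain ⟨n, hn⟩ := (i.NStar_mem_nhds_zero t).1 ht
  refine mem_of_superset (hA n) fun a ha => hs (hn ?_)
  intro z hz
  change a.1 z - φ z = 0
  rw [show φ z = (f n).1 z from h3 n z hz]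
  exact hA' n _ (hf n) _ ha z hz

/-- evaluation at a vector of `N_+` -/
def ev (z : i.NPlus) : Module.Dual k i.P := (LinearMap.applyₗ z).comp i.NStar.subtype

theorem ev_apply (z : i.NPlus) (f : i.NStar) : i.ev z f = f.1 z := rfl

theorem isOpen_ker_ev (z : i.NPlus) : IsOpen (LinearMap.ker (i.ev z) : Set i.P) := by
  obtain ⟨n, hn⟩ := i.exists_mem_filt z
  exact isOpen_submodule_mono (E := i.NStar) (U := i.NStarFilt n) (fun f hf => hf z hn) (i.isOpen_NStarFilt n)

theorem mem_NStarFilt_of_ev (n : ℕ) (f : i.P)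
    (h : ∀ l ∈ Set.range i.ev, (∀ e ∈ i.NStarFilt n, l e = 0) → l f = 0) : f ∈ i.NStarFilt n :=
  fun z hz => h _ ⟨z, rfl⟩ fun _ he => he z hz

theorem isSeparating_ev : IsSeparating i.P (Set.range i.ev) := by
  refine ⟨?_, fun U => ?_⟩
  · rintro _ ⟨z, rfl⟩
    exact i.isOpen_ker_ev z
  · obtain ⟨n, hn⟩ := (i.NStar_mem_nhds_zero _).1 (U.2.mem_nhds U.1.zero_mem)
    exact ⟨⟨i.NStarFilt n, i.isOpen_NStarFilt n⟩, hn, i.mem_NStarFilt_of_ev n⟩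

/-- The definition falls back to zero unless the operator exists. It does: `IsCont.lie` keeps
functionals continuous, and since x raises the filtration by at most one the operator is continuous.
-/
theorem actNStar_apply (x : g) (f : i.NStar) (z : i.NPlus) :
    (i.actNStar x f).1 z = - f.1 ⁅x, z⁆ := by
  have h : ∃ F : i.NStar →L[k] i.NStar, ∀ f n, (F f).1 n = - f.1 ⁅x, n⁆ := by
    let F : i.NStar →ₗ[k] i.NStar :=
      { toFun := fun f => -⟨_, f.2.lie i x⟩
        map_add' := fun f f' => by
          ext n
          change -((f.1 + f'.1) ⁅x, n⁆) = - f.1 ⁅x, n⁆ + - f'.1 ⁅x, n⁆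
          rw [LinearMap.add_apply, neg_add]
        map_smul' := fun c f => by
          ext n
          change -((c • f.1) ⁅x, n⁆) = c • - f.1 ⁅x, n⁆
          rw [LinearMap.smul_apply, smul_neg] }
    have hF : ∀ f n, (F f).1 n = - f.1 ⁅x, n⁆ := fun _ _ => rfl
    have hc : Continuous F := by
      refine i.continuous_NStar (E := i.NStar) F fun n => ?_
      refine isOpen_submodule_mono (E := i.NStar) (U := i.NStarFilt (n + 1)) (fun f hf => ?_)
        (i.isOpen_NStarFilt (n + 1))
      intro z hz
      change (F f).1 z = 0
      rw [hF, hf _ (i.lie_filt x hz), neg_zero]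
    exact ⟨⟨F, hc⟩, hF⟩
  unfold actNStar
  rw [dif_pos h]
  exact h.choose_spec f z

/-- Equicontinuity holds because the shift of the filtration by one is uniform in x. For continuity
in x, an x in g_+ is prepended to an ordered word as one more letter of g_+, and only finitely many
types of words occur in a given filtration step. -/
theorem isEquicontinuous_P : i.P.IsEquicontinuous M := by
  have hadd : ∀ (x y : g) (f : i.NStar), i.actNStar (x + y) f = i.actNStar x f + i.actNStar y f :=
    fun x y f => by
    ext z
    change (i.actNStar (x + y) f).1 z = (i.actNStar x f).1 z + (i.actNStar y f).1 z
    rw [actNStar_apply, actNStar_apply, actNStar_apply, add_lie, map_add, neg_add]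
  have hsmul : ∀ (c : k) (x : g) (f : i.NStar), i.actNStar (c • x) f = c • i.actNStar x f :=
    fun c x f => by
    ext z
    change (i.actNStar (c • x) f).1 z = c • (i.actNStar x f).1 z
    rw [actNStar_apply, actNStar_apply, smul_lie, map_smul, smul_neg]
  refine ⟨inferInstanceAs (CompleteSpace i.NStar), inferInstanceAs (T2Space i.NStar),
    i.isLinTop_NStar, hadd, hsmul, fun x y f => ?_, fun f => ?_, fun U hU => ?_⟩
  · ext z
    change (i.actNStar ⁅x, y⁆ f).1 z =
      (i.actNStar x (i.actNStar y f)).1 z - (i.actNStar y (i.actNStar x f)).1 z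
    simp only [actNStar_apply]
    rw [lie_lie, map_sub]
    abel
  · let F : g →ₗ[k] i.NStar :=
      { toFun := fun x => i.actNStar x f
        map_add' := fun x y => hadd x y f
        map_smul' := fun c x => hsmul c x f }
    refine (M.continuous_iff i.isLinTop_NStar F).2 fun U hU => ?_
    obtain ⟨n, hn⟩ := (i.NStar_mem_nhds_zero _).1 (hU.mem_nhds U.zero_mem)
    choose I hI using fun p q => (i.isCont_iff _).1 f.2 (p + 1) q
    classical
    refine ⟨(Finset.range (n + 1)).biUnion fun p => (Finset.range (n + 1)).biUnion (I p),
      fun x hx => hn fun z hz => ?_⟩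
    change (i.actNStar x f).1 z = 0
    rw [actNStar_apply, neg_eq_zero]
    have hz' := i.filt_le_ordFilt n hz
    clear hz
    unfold ordFilt at hz'
    induction hz' using Submodule.span_induction with
    | mem z hz =>
      obtain ⟨lx, ly, h1, h2, rfl⟩ := hz
      refine hI lx.length ly.length (x :: lx) ly rfl rfl ⟨fun y hy => ?_, h2.2⟩
        ⟨x, List.mem_cons_self, M.ann_anti ?_ hx⟩
      · rcases List.mem_cons.1 hy with rfl | hy
        · exact hx.1
        · exact h2.1 y hy
      · intro j hj
        refine Finset.mem_biUnion.2 ⟨lx.length, Finset.mem_range.2 (by omega),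
          Finset.mem_biUnion.2 ⟨ly.length, Finset.mem_range.2 (by omega), hj⟩⟩
    | zero => rw [lie_zero, map_zero]
    | add a b _ _ ha hb => rw [lie_add, map_add, ha, hb, add_zero]
    | smul c a _ ha => rw [lie_smul, map_smul, ha, smul_zero]
  · obtain ⟨n, hn⟩ := (i.NStar_mem_nhds_zero _).1 (hU.mem_nhds (zero_mem U))
    refine ⟨i.NStarFilt (n + 1), i.isOpen_NStarFilt (n + 1), fun x f hf => hn fun z hz => ?_⟩
    change (i.actNStar x f).1 z = 0
    rw [actNStar_apply, hf _ (i.lie_filt x hz), neg_zero]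

/-! ### The coalgebra structure of `N_+` -/

/-- the functional `f ⊗ f'` -/
def pair : Module.Dual k i.NPlus →ₗ[k] Module.Dual k i.NPlus →ₗ[k]
    Module.Dual k (i.NPlus ⊗[k] i.NPlus) :=
  (LinearMap.mk₂ k fun f f' => (TensorProduct.lid k k).toLinearMap.comp (TensorProduct.map f f'))
    (fun f f' h => by rw [TensorProduct.map_add_left, LinearMap.comp_add])
    (fun c f h => by rw [TensorProduct.map_smul_left, LinearMap.comp_smul])
    (fun f f' h => by rw [TensorProduct.map_add_right, LinearMap.comp_add])
    (fun c f h => by rw [TensorProduct.map_smul_right, LinearMap.comp_smul])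

theorem pair_tmul (f f' : Module.Dual k i.NPlus) (a b : i.NPlus) :
    i.pair f f' (a ⊗ₜ b) = f a * f' b := by
  change TensorProduct.lid k k (TensorProduct.map f f' (a ⊗ₜ b)) = _
  simp

/-- Each letter is distributed over the two factors. This gives the continuity of the product on
N_+^*. -/
theorem comul_filt {n : ℕ} {z : i.NPlus} (hz : z ∈ i.filt n) :
    Ind.comul k i.mMinus z ∈ Submodule.span k
      {t | ∃ a ∈ i.filt n, ∃ b ∈ i.filt n, t = a ⊗ₜ[k] b} := by
  have key : ∀ l : List g, (∀ x ∈ l, x ∈ i.pPlus) → Ind.comul k i.mMinus (i.word l) ∈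
      Submodule.span k {t | ∃ a ∈ i.filt l.length, ∃ b ∈ i.filt l.length, t = a ⊗ₜ[k] b} := by
    intro l hl
    induction l with
    | nil =>
      rw [word_nil, Ind.comul_one]
      exact Submodule.subset_span ⟨_, i.one_mem_filt _, _, i.one_mem_filt _, rfl⟩
    | cons x l ih =>
      have h1 := ih fun y hy => hl y (List.mem_cons_of_mem _ hy)
      have hx := hl x List.mem_cons_self
      rw [word_cons, Ind.comul_lie]
      generalize Ind.comul k i.mMinus (i.word l) = t at h1
      induction h1 using Submodule.span_induction with
      | mem t ht =>
        obtain ⟨a, ha, b, hb, rfl⟩ := ht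
        rw [TensorProduct.LieModule.lie_tmul_right]
        refine add_mem (Submodule.subset_span ⟨_, i.lie_pPlus_filt hx ha, _,
          i.filt_mono (Nat.le_succ _) hb, rfl⟩) (Submodule.subset_span ⟨_,
          i.filt_mono (Nat.le_succ _) ha, _, i.lie_pPlus_filt hx hb, rfl⟩)
      | zero => rw [lie_zero]; exact zero_mem _
      | add a b _ _ ha hb => rw [lie_add]; exact add_mem ha hb
      | smul c a _ ha => rw [lie_smul]; exact Submodule.smul_mem _ c ha
  unfold filt at hz
  induction hz using Submodule.span_induction with
  | mem z hz =>
    obtain ⟨l, h1, h2, rfl⟩ := hz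
    refine Submodule.span_mono ?_ (key l h2)
    rintro _ ⟨a, ha, b, hb, rfl⟩
    exact ⟨a, i.filt_mono h1 ha, b, i.filt_mono h1 hb, rfl⟩
  | zero => rw [map_zero]; exact zero_mem _
  | add a b _ _ ha hb => rw [map_add]; exact add_mem ha hb
  | smul c a _ ha => rw [map_smul]; exact Submodule.smul_mem _ c ha

/-- pairs of ordered words of bounded types, one of which has a letter in a given subspace -/
def ordPairs (A : Submodule k g) (c : Prop) (p q : ℕ) : Set (i.NPlus ⊗[k] i.NPlus) :=
  {t | ∃ lx ly lx' ly' : List g, lx.length ≤ p ∧ ly.length ≤ q ∧ lx'.length ≤ p ∧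
    ly'.length ≤ q ∧ i.IsOrdered lx ly ∧ i.IsOrdered lx' ly' ∧
    (c → (∃ x ∈ lx, x ∈ A) ∨ (∃ x ∈ lx', x ∈ A)) ∧ t = i.word (lx ++ ly) ⊗ₜ i.word (lx' ++ ly')}

/-- Letters are distributed over the two factors in order, so ordered words stay ordered, and a
letter lying in A survives in one of them. Recording this as an implication lets one induction cover
words with and without such a letter. -/
theorem comul_ordered (A : Submodule k g) (lx ly : List g) (h : i.IsOrdered lx ly) :
    Ind.comul k i.mMinus (i.word (lx ++ ly)) ∈
      Submodule.span k (i.ordPairs A (∃ x ∈ lx, x ∈ A) lx.length ly.length) := by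
  induction lx with
  | nil =>
    rw [List.nil_append]
    induction ly with
    | nil =>
      rw [word_nil, Ind.comul_one]
      exact Submodule.subset_span ⟨[], [], [], [], by simp, by simp, by simp, by simp, h, h,
        by simp, rfl⟩
    | cons y ly ih =>
      have h1 := ih ⟨h.1, fun z hz => h.2 z (List.mem_cons_of_mem _ hz)⟩
      have hy := h.2 y List.mem_cons_self
      rw [word_cons, Ind.comul_lie]
      generalize Ind.comul k i.mMinus (i.word ly) = t at h1
      induction h1 using Submodule.span_induction with
      | mem t ht =>
        obtain ⟨lx, l, lx', l', h1, h2, h3, h4, h5, h6, h7, rfl⟩ := ht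
        obtain rfl := List.length_eq_zero_iff.1 (Nat.le_zero.1 h1)
        obtain rfl := List.length_eq_zero_iff.1 (Nat.le_zero.1 h3)
        have h8 : ∀ l, i.IsOrdered [] l → i.IsOrdered [] (y :: l) := fun l hl =>
          ⟨by simp, fun z hz => by
            rcases List.mem_cons.1 hz with rfl | hz
            · exact hy
            · exact hl.2 z hz⟩
        rw [TensorProduct.LieModule.lie_tmul_right]
        refine add_mem (Submodule.subset_span ⟨[], y :: l, [], l', by simp, ?_, by simp, ?_,
          h8 l h5, h6, by simp, rfl⟩) (Submodule.subset_span ⟨[], l, [], y :: l', by simp, ?_,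
          by simp, ?_, h5, h8 l' h6, by simp, rfl⟩) <;> simp only [List.length_cons] <;> omega
      | zero => rw [lie_zero]; exact zero_mem _
      | add a b _ _ ha hb => rw [lie_add]; exact add_mem ha hb
      | smul c a _ ha => rw [lie_smul]; exact Submodule.smul_mem _ c ha
  | cons x lx ih =>
    have h1 := ih ⟨fun z hz => h.1 z (List.mem_cons_of_mem _ hz), h.2⟩
    have hx := h.1 x List.mem_cons_self
    rw [List.cons_append, word_cons, Ind.comul_lie]
    generalize Ind.comul k i.mMinus (i.word (lx ++ ly)) = t at h1
    induction h1 using Submodule.span_induction with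
    | mem t ht =>
      obtain ⟨a, b, a', b', h1, h2, h3, h4, h5, h6, h7, rfl⟩ := ht
      have h8 : ∀ l l', i.IsOrdered l l' → i.IsOrdered (x :: l) l' := fun l l' hl =>
        ⟨fun z hz => by
          rcases List.mem_cons.1 hz with rfl | hz
          · exact hx
          · exact hl.1 z hz, hl.2⟩
      have h9 : (∃ z ∈ x :: lx, z ∈ A) → x ∈ A ∨ (∃ z ∈ a, z ∈ A) ∨ (∃ z ∈ a', z ∈ A) := by
        rintro ⟨z, hz, hzA⟩
        rcases List.mem_cons.1 hz with rfl | hz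
        · exact Or.inl hzA
        · exact Or.inr (h7 ⟨z, hz, hzA⟩)
      rw [TensorProduct.LieModule.lie_tmul_right]
      refine add_mem (Submodule.subset_span ⟨x :: a, b, a', b', ?_, h2, ?_, h4, h8 a b h5, h6,
        fun hc => ?_, rfl⟩) (Submodule.subset_span ⟨a, b, x :: a', b', ?_, h2, ?_, h4, h5,
        h8 a' b' h6, fun hc => ?_, rfl⟩)
      · simpa using h1
      · exact h3.trans (by simp)
      · rcases h9 hc with hx | ⟨z, hz, hzA⟩ | h
        · exact Or.inl ⟨x, by simp, hx⟩
        · exact Or.inl ⟨z, by simp [hz], hzA⟩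
        · exact Or.inr h
      · exact h1.trans (by simp)
      · simpa using h3
      · rcases h9 hc with hx | h | ⟨z, hz, hzA⟩
        · exact Or.inr ⟨x, by simp, hx⟩
        · exact Or.inl h
        · exact Or.inr ⟨z, by simp [hz], hzA⟩
    | zero => rw [lie_zero]; exact zero_mem _
    | add a b _ _ ha hb => rw [lie_add]; exact add_mem ha hb
    | smul c a _ ha => rw [lie_smul]; exact Submodule.smul_mem _ c ha

/-- Only finitely many types of words appear in the coproduct, so one finite set of indices controls
both factors. -/
theorem IsCont.mul {f f' : Module.Dual k i.NPlus} (hf : i.IsCont f) (hf' : i.IsCont f') :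
    i.IsCont ((i.pair f f').comp (Ind.comul k i.mMinus)) := by
  classical
  refine (i.isCont_iff _).2 fun p q => ?_
  choose I hI using (i.isCont_iff f).1 hf
  choose I' hI' using (i.isCont_iff f').1 hf'
  let J := (Finset.range (p + 1)).biUnion fun a => (Finset.range (q + 1)).biUnion fun b =>
    I a b ∪ I' a b
  have hJ : ∀ a b, a ≤ p → b ≤ q → I a b ∪ I' a b ⊆ J := fun a b ha hb j hj =>
    Finset.mem_biUnion.2 ⟨a, Finset.mem_range.2 (by omega), Finset.mem_biUnion.2
      ⟨b, Finset.mem_range.2 (by omega), hj⟩⟩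
  refine ⟨J, fun lx ly h1 h2 h3 h4 => ?_⟩
  have h5 := i.comul_ordered (M.ann J) lx ly h3
  change i.pair f f' (Ind.comul k i.mMinus (i.word (lx ++ ly))) = 0
  generalize Ind.comul k i.mMinus (i.word (lx ++ ly)) = t at h5
  induction h5 using Submodule.span_induction with
  | mem t ht =>
    obtain ⟨a, b, a', b', e1, e2, e3, e4, e5, e6, e7, rfl⟩ := ht
    rw [pair_tmul]
    rcases e7 h4 with ⟨z, hz, hzA⟩ | ⟨z, hz, hzA⟩
    · rw [hI a.length b.length a b rfl rfl e5 ⟨z, hz, M.ann_anti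
        (Finset.subset_union_left.trans (hJ _ _ (e1.trans h1.le) (e2.trans h2.le))) hzA⟩, zero_mul]
    · rw [hI' a'.length b'.length a' b' rfl rfl e6 ⟨z, hz, M.ann_anti
        (Finset.subset_union_right.trans (hJ _ _ (e3.trans h1.le) (e4.trans h2.le))) hzA⟩,
        mul_zero]
  | zero => rw [map_zero]
  | add a b _ _ ha hb => rw [map_add, ha, hb, add_zero]
  | smul c a _ ha => rw [map_smul, ha, smul_zero]

/-- Shows that the operator in the definition exists: products of continuous functionals are
continuous by `IsCont.mul`, and `comul_filt` gives joint continuity. -/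
theorem iPlusStar_ptens (f f' : i.NStar) (z : i.NPlus) :
    (i.iPlusStar (ptens (X := i.P) (Y := i.P) f f')).1 z =
      i.pair f.1 f'.1 (Ind.comul k i.mMinus z) := by
  have h : ∃ F : CTensor i.P i.P →L[k] i.NStar, ∀ (f f' : i.NStar) n, (F (ptens f f')).1 n =
      TensorProduct.lid k k (TensorProduct.map f.1 f'.1 (Ind.comul k i.mMinus n)) := by
    let φ : i.P →ₗ[k] i.P →ₗ[k] i.NStar := LinearMap.mk₂ k
      (fun f f' => (⟨_, IsCont.mul i f.2 f'.2⟩ : i.NStar))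
      (fun f f' h => Subtype.ext (by
        change (i.pair (f.1 + f'.1) h.1).comp _ = _
        rw [map_add]; rfl))
      (fun c f h => Subtype.ext (by
        change (i.pair (c • f.1) h.1).comp _ = _
        rw [map_smul]; rfl))
      (fun f h h' => Subtype.ext (by
        change (i.pair f.1 (h.1 + h'.1)).comp _ = _
        rw [map_add]; rfl))
      (fun c f h => Subtype.ext (by
        change (i.pair f.1 (c • h.1)).comp _ = _
        rw [map_smul]; rfl))
    refine ⟨desc fun f f' => φ f f', fun f f' z => ?_⟩
    rw [desc_ptens i.isLinTop_NStar φ]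
    · rfl
    · intro O hO
      obtain ⟨n, hn⟩ := (i.NStar_mem_nhds_zero _).1 (hO.mem_nhds O.zero_mem)
      refine ⟨(⟨i.NStarFilt n, i.isOpen_NStarFilt n⟩, ⟨i.NStarFilt n, i.isOpen_NStarFilt n⟩),
        fun f hf f' => hn fun z hz => ?_, fun f f' hf' => hn fun z hz => ?_⟩
      · have h1 := i.comul_filt hz
        change i.pair f.1 f'.1 (Ind.comul k i.mMinus z) = 0
        generalize Ind.comul k i.mMinus z = t at h1
        induction h1 using Submodule.span_induction with
        | mem t ht =>
          obtain ⟨a, ha, b, hb, rfl⟩ := ht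
          rw [pair_tmul, show f.1 a = 0 from hf a ha, zero_mul]
        | zero => rw [map_zero]
        | add a b _ _ ha hb => rw [map_add, ha, hb, add_zero]
        | smul c a _ ha => rw [map_smul, ha, smul_zero]
      · have h1 := i.comul_filt hz
        change i.pair f.1 f'.1 (Ind.comul k i.mMinus z) = 0
        generalize Ind.comul k i.mMinus z = t at h1
        induction h1 using Submodule.span_induction with
        | mem t ht =>
          obtain ⟨a, ha, b, hb, rfl⟩ := ht
          rw [pair_tmul, show f'.1 b = 0 from hf' b hb, mul_zero]
        | zero => rw [map_zero]
        | add a b _ _ ha hb => rw [map_add, ha, hb, add_zero]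
        | smul c a _ ha => rw [map_smul, ha, smul_zero]
  unfold iPlusStar
  rw [dif_pos h]
  exact h.choose_spec f f' z

theorem pair_lie (f f' : i.NStar) (x : g) (t : i.NPlus ⊗[k] i.NPlus) :
    i.pair (i.actNStar x f).1 f'.1 t + i.pair f.1 (i.actNStar x f').1 t =
      - i.pair f.1 f'.1 ⁅x, t⁆ := by
  induction t with
  | zero => simp
  | add a b ha hb =>
    rw [lie_add, map_add, map_add, map_add, neg_add, ← ha, ← hb]
    abel
  | tmul a b =>
    rw [TensorProduct.LieModule.lie_tmul_right, map_add]
    simp only [pair_tmul, actNStar_apply]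
    ring

theorem isEquivar_iPlusStar : IsEquivar (X := tens i.P i.P) (Y := i.P) i.iPlusStar := by
  intro x t
  have : i.iPlusStar.comp ((tens i.P i.P).act x) = (i.P.act x).comp i.iPlusStar := by
    refine ctensor_ext (Z := i.NStar) fun f f' => ?_
    refine Subtype.ext ?_
    refine LinearMap.ext fun z => ?_
    simp only [ContinuousLinearMap.comp_apply]
    rw [tens_act_ptens, map_add]
    change (i.iPlusStar (ptens (X := i.P) (Y := i.P) (i.actNStar x f) f')).1 z +
      (i.iPlusStar (ptens (X := i.P) (Y := i.P) f (i.actNStar x f'))).1 z =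
      (i.actNStar x (i.iPlusStar (ptens (X := i.P) (Y := i.P) f f'))).1 z
    rw [actNStar_apply, iPlusStar_ptens, iPlusStar_ptens, iPlusStar_ptens, Ind.comul_lie]
    exact i.pair_lie f f' x _
  exact DFunLike.congr_fun this t

theorem isEquivar_iPlusVee {Φ : LieAssociator k} (T : DrinfeldT M Φ) :
    (i.iPlusVee T).IsEquivar :=
  HSeries.IsEquivar.comp (HSeries.IsEquivar.const i.isEquivar_iPlusStar)
    (HSeries.IsEquivar.comp
      (fun n x t => T.invariant i.P i.P i.isEquicontinuous_P i.isEquicontinuous_P n x t)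
      (HSeries.IsEquivar.const IsEquivar.swapT))

end SplitEmbedding

end

end RelTwist

/-! ### From an induced module to the enveloping algebra of a complement -/

namespace RelTwist

noncomputable section

open scoped TensorProduct Topology
open Filter

set_option linter.unusedSectionVars false

section Enveloping

attribute [local instance 100] LieRing.ofAssociativeRing

variable {k : Type u} {g : Type v} [Field k] [LieRing g] [LieAlgebra k g]

theorem uea_induction {Q : Submodule k (UniversalEnvelopingAlgebra k g)} (h1 : 1 ∈ Q)
    (h2 : ∀ x : g, ∀ t ∈ Q, UniversalEnvelopingAlgebra.ι k x * t ∈ Q)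
    (t : UniversalEnvelopingAlgebra k g) : t ∈ Q := by
  let S : Subalgebra k (UniversalEnvelopingAlgebra k g) :=
    { carrier := {t | ∀ m ∈ Q, t * m ∈ Q}
      mul_mem' := fun {s t} hs ht m hm => by rw [mul_assoc]; exact hs _ (ht _ hm)
      add_mem' := fun {s t} hs ht m hm => by rw [add_mul]; exact Q.add_mem (hs _ hm) (ht _ hm)
      algebraMap_mem' := fun c m hm => by
        rw [← Algebra.smul_def]; exact Q.smul_mem c hm }
  have := uea_mem_subalgebra (S := S) (fun x m hm => h2 x m hm) t 1 h1
  rwa [mul_one] at this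

/-- The universal property of induced modules. -/
theorem Ind.exists_lift (h : Submodule k g) {E : Type*} [AddCommGroup E] [Module k E]
    (ρ : g →ₗ⁅k⁆ Module.End k E) (t : E) (ht : ∀ x ∈ h, ρ x t = 0) :
    ∃ F : Ind k h →ₗ[k] E, F (Ind.one k h) = t ∧ ∀ x m, F ⁅x, m⁆ = ρ x (F m) := by
  let θ := UniversalEnvelopingAlgebra.lift k ρ
  have hθ : ∀ x, θ (UniversalEnvelopingAlgebra.ι k x) = ρ x := fun x =>
    UniversalEnvelopingAlgebra.lift_ι_apply k ρ x
  have hker : (Ideal.span (UniversalEnvelopingAlgebra.ι k '' (h : Set g))).restrictScalars k ≤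
      LinearMap.ker ((LinearMap.applyₗ t).comp θ.toLinearMap) := by
    intro u hu
    rw [Submodule.restrictScalars_mem] at hu
    rw [LinearMap.mem_ker]
    change θ u t = 0
    induction hu using Submodule.span_induction with
    | mem u hu =>
      obtain ⟨x, hx, rfl⟩ := hu
      rw [hθ, ht x hx]
    | zero => simp
    | add u u' _ _ h1 h2 => rw [map_add, LinearMap.add_apply, h1, h2, add_zero]
    | smul a u _ h1 => rw [smul_eq_mul, map_mul, Module.End.mul_apply, h1, map_zero]
  refine ⟨(Submodule.liftQ _ _ hker).comp (Submodule.Quotient.restrictScalarsEquiv k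
      (Ideal.span (UniversalEnvelopingAlgebra.ι k '' (h : Set g)))).symm.toLinearMap, ?_, ?_⟩
  · change θ 1 t = t
    rw [map_one, Module.End.one_apply]
  · intro x m
    obtain ⟨u, rfl⟩ := Submodule.Quotient.mk_surjective _ m
    change θ (UniversalEnvelopingAlgebra.ι k x * u) t = ρ x (θ u t)
    rw [map_mul, Module.End.mul_apply, hθ]

variable (p : LieSubalgebra k g)

/-- the representation of `p` on `Hom(g, U(p))` -/
def homRep : p →ₗ⁅k⁆ Module.End k (g →ₗ[k] UniversalEnvelopingAlgebra k p) where
  toFun q :=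
    { toFun := fun φ => (LinearMap.mulLeft k (UniversalEnvelopingAlgebra.ι k q)).comp φ -
        φ.comp (LieModule.toEnd k g g (q : g))
      map_add' := fun φ ψ => by rw [LinearMap.comp_add, LinearMap.add_comp]; abel
      map_smul' := fun c φ => by
        rw [LinearMap.comp_smul, LinearMap.smul_comp, ← smul_sub]; rfl }
  map_add' q q' := by
    ext φ x
    simp [add_mul]
    abel
  map_smul' c q := by
    ext φ x
    simp [smul_sub]
  map_lie' {q q'} := by
    ext φ x
    simp only [LieRing.of_associative_ring_bracket, LinearMap.coe_mk, AddHom.coe_mk,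
      LinearMap.sub_apply, LinearMap.comp_apply, LinearMap.mulLeft_apply, Module.End.mul_apply,
      LieHom.map_lie, LieModule.toEnd_apply_apply, LieSubalgebra.coe_bracket, map_sub]
    noncomm_ring

theorem homRep_apply (q : p) (φ : g →ₗ[k] UniversalEnvelopingAlgebra k p) (x : g) :
    homRep p q φ x = UniversalEnvelopingAlgebra.ι k q * φ x - φ ⁅(q : g), x⁆ := rfl

/-- For `g = p ⊕ m`, the module `Ind_m^g k` surjects onto `U(p)`. -/
theorem exists_ind_to_uea (m : Submodule k g) (hm : ∀ x ∈ m, ∀ y ∈ m, ⁅x, y⁆ ∈ m)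
    (hc : IsCompl p.toSubmodule m) :
    ∃ F : Ind k m →ₗ[k] UniversalEnvelopingAlgebra k p, F (Ind.one k m) = 1 ∧
      ∀ (q : p) z, F ⁅(q : g), z⁆ = UniversalEnvelopingAlgebra.ι k q * F z := by
  let π : g →ₗ[k] p := Submodule.projectionOnto p.toSubmodule m hc
  have hπp : ∀ q : p, π q = q := fun q => Submodule.projectionOnto_apply_left hc q
  have hπm : ∀ x ∈ m, π x = 0 := fun x hx =>
    (Submodule.projectionOnto_apply_eq_zero_iff hc).2 hx
  have hπ : ∀ x, x - π x ∈ m := fun x => by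
    rw [← Submodule.projectionOnto_apply_eq_zero_iff hc]
    change π (x - π x) = 0
    rw [map_sub, hπp, sub_self]
  let ι : p →ₗ⁅k⁆ UniversalEnvelopingAlgebra k p := UniversalEnvelopingAlgebra.ι k
  let φ₀ : g →ₗ[k] UniversalEnvelopingAlgebra k p := (ι : p →ₗ[k] _).comp π
  let θ := UniversalEnvelopingAlgebra.lift k (homRep p)
  -- `act t x` is the intended action of x on t in U(p). It is obtained by applying t to the
  -- projection φ₀ in the p-module Hom(g, U(p)). This makes `act` well defined without a basis
  -- theorem and encodes the recursion x · (q t) = q (x · t) + [x, q] · t with x · 1 = π(x).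
  let act : UniversalEnvelopingAlgebra k p →ₗ[k] g →ₗ[k] UniversalEnvelopingAlgebra k p :=
    (LinearMap.applyₗ φ₀).comp θ.toLinearMap
  have act_one : ∀ x, act 1 x = ι (π x) := fun x => by
    change θ 1 φ₀ x = _
    rw [map_one]; rfl
  have act_mul : ∀ (q : p) t x, act (ι q * t) x = ι q * act t x + act t ⁅x, (q : g)⁆ := by
    intro q t x
    change θ (ι q * t) φ₀ x = _
    have : θ (ι q) = homRep p q := UniversalEnvelopingAlgebra.lift_ι_apply k _ q
    rw [map_mul, Module.End.mul_apply, this, homRep_apply, ← lie_skew x, map_neg, ← sub_eq_add_neg]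
    rfl
  have act_p : ∀ (q : p) t, act t q = ι q * t := by
    intro q t
    let Q : Submodule k (UniversalEnvelopingAlgebra k p) :=
      { carrier := {t | ∀ q : p, act t q = ι q * t}
        zero_mem' := fun q => by simp
        add_mem' := fun {a b} ha hb q => by rw [map_add, LinearMap.add_apply, ha, hb, mul_add]
        smul_mem' := fun c a ha q => by
          rw [map_smul, LinearMap.smul_apply, ha, mul_smul_comm] }
    refine uea_induction (Q := Q) (fun q => ?_) (fun q' t ht q => ?_) t q
    · rw [act_one, hπp, mul_one]
    · have h1 : act t ⁅(q : g), (q' : g)⁆ = ι ⁅q, q'⁆ * t := ht ⁅q, q'⁆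
      change act (ι q' * t) q = ι q * (ι q' * t)
      rw [act_mul, ht, h1, LieHom.map_lie, LieRing.of_associative_ring_bracket]
      noncomm_ring
  -- The representation identity, by induction on t. For t = 1 it says that π[x - π(x), y - π(y)] =
  -- 0, that is, that m is a subalgebra. The inductive step is the Jacobi identity.
  have act_lie : ∀ t x y, act t ⁅x, y⁆ = act (act t y) x - act (act t x) y := by
    intro t
    let Q : Submodule k (UniversalEnvelopingAlgebra k p) :=
      { carrier := {t | ∀ x y, act t ⁅x, y⁆ = act (act t y) x - act (act t x) y}
        zero_mem' := fun x y => by simp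
        add_mem' := fun {a b} ha hb x y => by
          simp only [map_add, LinearMap.add_apply, ha x y, hb x y]
          abel
        smul_mem' := fun c a ha x y => by
          simp only [map_smul, LinearMap.smul_apply, ha x y, smul_sub] }
    refine uea_induction (Q := Q) (fun x y => ?_) (fun q t ht x y => ?_) t
    · have key : ∀ x y, act (ι (π y)) x = ι (π y) * ι (π x) + ι (π ⁅x, (π y : g)⁆) := fun x y => by
        have := act_mul (π y) 1 x
        rwa [mul_one, act_one, act_one] at this
      rw [act_one, act_one, act_one, key, key]
      have h1 : π ⁅x, y⁆ = π ⁅x, (π y : g)⁆ + ⁅π y, π x⁆ - π ⁅y, (π x : g)⁆ := by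
        have e : ⁅x - (π x : g), y - (π y : g)⁆ =
            ⁅x, y⁆ - ⁅x, (π y : g)⁆ + ⁅y, (π x : g)⁆ + ⁅(π x : g), (π y : g)⁆ := by
          rw [sub_lie, lie_sub, lie_sub, ← lie_skew y]
          abel
        have h2 := hπm _ (hm _ (hπ x) _ (hπ y))
        have h3 : π ⁅(π x : g), (π y : g)⁆ = ⁅π x, π y⁆ := hπp ⁅π x, π y⁆
        rw [e, map_add, map_add, map_sub, h3, ← lie_skew (π x) (π y)] at h2
        rw [← sub_eq_zero, ← h2]
        abel
      rw [h1, map_sub, map_add, LieHom.map_lie, LieRing.of_associative_ring_bracket]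
      abel
    · have h1 := ht x y
      have h2 := ht ⁅x, (q : g)⁆ y
      have h3 := ht x ⁅y, (q : g)⁆
      have h4 : act t ⁅⁅x, y⁆, (q : g)⁆ = act t ⁅⁅x, (q : g)⁆, y⁆ + act t ⁅x, ⁅y, (q : g)⁆⁆ := by
        rw [← map_add]
        congr 1
        rw [lie_lie, ← lie_skew y ⁅x, (q : g)⁆]
        abel
      rw [h2, h3] at h4
      change act (ι q * t) ⁅x, y⁆ = act (act (ι q * t) y) x - act (act (ι q * t) x) y
      simp only [act_mul, map_add, LinearMap.add_apply, h4, h1, mul_sub]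
      abel
  let ρ : g →ₗ⁅k⁆ Module.End k (UniversalEnvelopingAlgebra k p) :=
    { toLinearMap := act.flip
      map_lie' := fun {x y} => by
        ext t
        rw [LieRing.of_associative_ring_bracket]
        exact act_lie t x y }
  -- Since π vanishes on m, the vector 1 is killed by m under the new action of g, so the universal
  -- property of the induced module applies.
  obtain ⟨F, h1, h2⟩ := Ind.exists_lift m ρ 1 fun x hx => by
    change act 1 x = 0
    rw [act_one, hπm x hx, map_zero]
  refine ⟨F, h1, fun q z => ?_⟩
  rw [h2]
  exact act_p q _

end Enveloping

end

end RelTwist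

/-! ### Injectivity and surjectivity of α_V -/

namespace RelTwist

noncomputable section

open scoped TensorProduct Topology
open Filter

set_option linter.unusedSectionVars false

attribute [local instance 100] LieRing.ofAssociativeRing

/-- the representation on an equicontinuous module -/
def TMod.IsEquicontinuous.rep {k : Type u} {g : Type v} [Field k] [LieRing g] [LieAlgebra k g]
    {M : ManinTriple k g} {X : TMod.{u, v, w} k g} (hX : X.IsEquicontinuous M) :
    g →ₗ⁅k⁆ Module.End k X where
  toFun x := (X.act x : X →ₗ[k] X)
  map_add' x y := LinearMap.ext fun t => hX.act_add x y t
  map_smul' c x := LinearMap.ext fun t => hX.act_smul c x t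
  map_lie' {x y} := LinearMap.ext fun t => hX.act_lie x y t

namespace SplitEmbedding

variable {k : Type u} {g : Type v} {gD : Type v'} [Field k] [LieRing g] [LieAlgebra k g]
  [LieRing gD] [LieAlgebra k gD] {MD : ManinTriple k gD} {M : ManinTriple k g}
  (i : SplitEmbedding MD M) {V : TMod.{u, v, w} k g}

/-! ### Slices of `N_+^* ⊗ V` -/

section Slices

variable (hV : V.IsEquicontinuous M)

include hV

theorem slice_ev_ptens (z : i.NPlus) (f : i.NStar) (t : V) :
    slice V (i.ev z) (ptens (X := i.P) f t) = f.1 z • t := by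
  have := hV.complete
  have := hV.separated
  exact slice_ptens hV.isLinTop _ (i.isOpen_ker_ev z) f t

/-- an element of `N_+^* ⊗ V` as a linear map `N_+ → V` -/
def sliceEv (t : tens i.P V) : i.NPlus →ₗ[k] V where
  toFun z := slice V (i.ev z) t
  map_add' a b := by
    have := hV.separated
    have : slice V (i.ev (a + b)) = slice V (i.ev a) + slice V (i.ev b) :=
      ctensor_ext fun f t => by
        rw [add_apply, i.slice_ev_ptens hV, i.slice_ev_ptens hV, i.slice_ev_ptens hV, map_add,
          add_smul]
    rw [this]; rfl
  map_smul' c a := by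
    have := hV.separated
    have : slice V (i.ev (c • a)) = c • slice V (i.ev a) :=
      ctensor_ext fun f t => by
        rw [smul_apply, i.slice_ev_ptens hV, i.slice_ev_ptens hV, map_smul, smul_eq_mul, mul_smul]
    rw [this]; rfl

theorem sliceEv_apply (t : tens i.P V) (z : i.NPlus) :
    i.sliceEv hV t z = slice V (i.ev z) t := rfl

theorem sliceEv_one (t : tens i.P V) : i.sliceEv hV t (Ind.one k i.mMinus) = i.evOne V t := rfl

theorem sliceEv_act (x : g) (t : tens i.P V) (z : i.NPlus) :
    i.sliceEv hV ((tens i.P V).act x t) z =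
      V.act x (i.sliceEv hV t z) - i.sliceEv hV t ⁅x, z⁆ := by
  have := hV.separated
  have : (slice V (i.ev z)).comp ((tens i.P V).act x) =
      (V.act x).comp (slice V (i.ev z)) - slice V (i.ev ⁅x, z⁆) := by
    refine ctensor_ext fun f t => ?_
    rw [sub_apply]
    simp only [ContinuousLinearMap.comp_apply]
    rw [tens_act_ptens, map_add, i.slice_ev_ptens hV, i.slice_ev_ptens hV, i.slice_ev_ptens hV]
    erw [i.slice_ev_ptens hV]
    rw [actNStar_apply, map_smul, neg_smul]
    abel
  exact DFunLike.congr_fun this t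

/-- Evaluations at vectors of N_+ suffice as test functionals, because the basic neighbourhoods of
zero in N_+^* are cut out by them. -/
theorem sliceEv_ext {s t : tens i.P V} (h : ∀ z, i.sliceEv hV s z = i.sliceEv hV t z) : s = t := by
  have := hV.complete
  have := hV.separated
  refine eq_of_slice hV.isLinTop i.isSeparating_ev ?_
  rintro _ ⟨z, rfl⟩
  exact h z

/-- `p_+`-invariant elements of `N_+^* ⊗ V` are `p_+`-equivariant maps `N_+ → V` -/
theorem sliceEv_lie {t : tens i.P V} (ht : ∀ x ∈ i.pPlus, (tens i.P V).act x t = 0) {x : g}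
    (hx : x ∈ i.pPlus) (z : i.NPlus) :
    i.sliceEv hV t ⁅x, z⁆ = V.act x (i.sliceEv hV t z) := by
  have := i.sliceEv_act hV x t z
  rw [ht x hx, sliceEv_apply, map_zero] at this
  exact (sub_eq_zero.1 this.symm).symm

/-- Invariance turns both tensors into p_+-equivariant maps on N_+, which is spanned by words in p_+
applied to 1_+. So the value at 1_+ decides. -/
theorem eq_of_invariant {s t : tens i.P V} (hs : ∀ x ∈ i.pPlus, (tens i.P V).act x s = 0)
    (ht : ∀ x ∈ i.pPlus, (tens i.P V).act x t = 0) (h : i.evOne V s = i.evOne V t) : s = t := by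
  refine i.sliceEv_ext hV fun z => ?_
  obtain ⟨n, hn⟩ := i.exists_mem_filt z
  unfold filt at hn
  induction hn using Submodule.span_induction with
  | mem z hz =>
    obtain ⟨l, -, h2, rfl⟩ := hz
    induction l with
    | nil => exact h
    | cons x l ih =>
      have hx := h2 x List.mem_cons_self
      rw [word_cons, i.sliceEv_lie hV hs hx, i.sliceEv_lie hV ht hx,
        ih fun y hy => h2 y (List.mem_cons_of_mem _ hy)]
  | zero => rw [map_zero, map_zero]
  | add a b _ _ ha hb => rw [map_add, map_add, ha, hb]
  | smul c a _ ha => rw [map_smul, map_smul, ha]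

end Slices

theorem gam_invariant {f : i.HomL V} (hf : f ∈ i.Gam V) (n : ℕ) {x : g} (hx : x ∈ i.pPlus) :
    (tens i.P V).act x (f n (Ind.one k i.pPlus)) = 0 := by
  rw [← hf n x, Ind.lie_one _ hx, map_zero]

/-- The image of 1_- is p_+-invariant and hence fixed by its evaluation at 1_+; the rest follows
because 1_- generates L_-. -/
theorem injOn_alpha (hV : V.IsEquicontinuous M) : Set.InjOn (i.alpha V) (i.Gam V) := by
  intro f hf f' hf' h
  funext n
  have h1 : f n (Ind.one k i.pPlus) = f' n (Ind.one k i.pPlus) :=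
    i.eq_of_invariant hV (fun x => i.gam_invariant hf n) (fun x => i.gam_invariant hf' n)
      (congrFun h n)
  refine LinearMap.ext fun z => ?_
  refine Ind.induction_on _ (Q := LinearMap.eqLocus (f n) (f' n)) h1 (fun x m hm => ?_) z
  have hm' : f n m = f' n m := hm
  change f n ⁅x, m⁆ = f' n ⁅x, m⁆
  rw [hf, hf', hm']

/-! ### Surjectivity for finite-dimensional `g_D` -/

section Surjective

variable (hV : V.IsEquicontinuous M)

include hV

/-- The map N_+ → U(p_+) is followed by u ↦ u t. -/
theorem exists_equivariant_map (t : V) : ∃ F : i.NPlus →ₗ[k] V, F (Ind.one k i.mMinus) = t ∧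
    ∀ x ∈ i.pPlus, ∀ z, F ⁅x, z⁆ = V.act x (F z) := by
  let p : LieSubalgebra k g := { i.pPlus with lie_mem' := fun hx hy => i.lie_pPlus hx hy }
  obtain ⟨F, h1, h2⟩ := exists_ind_to_uea p i.mMinus (fun x hx y hy => i.lie_mMinus hx hy)
    i.isCompl_pPlus_mMinus
  let ρ : p →ₗ⁅k⁆ Module.End k V := hV.rep.comp p.incl
  let θ := UniversalEnvelopingAlgebra.lift k ρ
  refine ⟨((LinearMap.applyₗ t).comp θ.toLinearMap).comp F, ?_, fun x hx z => ?_⟩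
  · change θ (F _) t = t
    rw [h1, map_one]; rfl
  · change θ (F _) t = V.act x (θ (F z) t)
    have h3 : F ⁅x, z⁆ = _ := h2 ⟨x, hx⟩ z
    have h4 : θ (UniversalEnvelopingAlgebra.ι k (⟨x, hx⟩ : p)) = ρ ⟨x, hx⟩ :=
      UniversalEnvelopingAlgebra.lift_ι_apply k ρ _
    rw [h3, map_mul, Module.End.mul_apply, h4]
    rfl

variable {F : i.NPlus →ₗ[k] V} (hF : ∀ x ∈ i.pPlus, ∀ z, F ⁅x, z⁆ = V.act x (F z))

include hF

/-- This is where finite dimension of g_D enters: acting by g_D keeps a finitely generated subspace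
finitely generated. -/
theorem fg_words_gD [Module.Finite k gD] (q : ℕ) : ∃ G : Submodule k V, G.FG ∧
    ∀ ly : List g, ly.length = q → (∀ y ∈ ly, ∃ z ∈ MD.gm, i.hom z = y) → F (i.word ly) ∈ G := by
  induction q with
  | zero =>
    refine ⟨_, Submodule.fg_span (Set.finite_singleton (F (i.word []))), fun ly h _ => ?_⟩
    rw [List.length_eq_zero_iff.1 h]
    exact Submodule.subset_span rfl
  | succ q ih =>
    obtain ⟨G, hG, h⟩ := ih
    let B : gD →ₗ[k] V →ₗ[k] V := (hV.rep : g →ₗ[k] Module.End k V).comp (i.hom : gD →ₗ[k] g)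
    refine ⟨Submodule.map₂ B ⊤ G, Submodule.FG.map₂ B Module.Finite.fg_top hG,
      fun ly h1 h2 => ?_⟩
    obtain ⟨y, ly, rfl⟩ := List.exists_cons_of_length_eq_add_one h1
    obtain ⟨z, -, rfl⟩ := h2 y List.mem_cons_self
    rw [word_cons, hF _ (i.hom_mem_pPlus z)]
    exact Submodule.apply_mem_map₂ B (m := z) trivial
      (h ly (by simpa using h1) fun y hy => h2 y (List.mem_cons_of_mem _ hy))

/-- Modulo an open subspace, the words of a given type act through a finite-dimensional space, and
continuously. -/
theorem fg_words [Module.Finite k gD] (p q : ℕ) (U : Submodule k V) (hU : IsOpen (U : Set V)) :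
    ∃ (G : Submodule k V) (I : Finset M.Index), G.FG ∧ ∀ lx ly : List g, lx.length = p →
      ly.length = q → i.IsOrdered lx ly → F (i.word (lx ++ ly)) ∈ U ⊔ G ∧
      ((∃ x ∈ lx, x ∈ M.ann I) → F (i.word (lx ++ ly)) ∈ U) := by
  classical
  induction p generalizing U with
  | zero =>
    obtain ⟨G, hG, h⟩ := i.fg_words_gD hV hF q
    refine ⟨G, ∅, hG, fun lx ly h1 h2 h3 => ?_⟩
    obtain rfl := List.length_eq_zero_iff.1 h1
    exact ⟨Submodule.mem_sup_right (h ly h2 h3.2), by simp⟩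
  | succ p ih =>
    -- The induction hypothesis is used for a smaller U₁ that every operator of g maps into U. The
    -- shorter word is then in U₁ up to the finitely generated G₁, and only the action on G₁ remains
    -- to be controlled.
    obtain ⟨U₁, hU₁, hact⟩ := hV.equicontinuous U hU
    obtain ⟨G₁, I₁, hG₁, h₁⟩ := ih U₁ hU₁
    -- Since G₁ has finitely many generators, one set J works for all of it. Modulo U, the leading
    -- letter then acts on G₁ through the span of the b^j with j in J.
    obtain ⟨J, hJ⟩ : ∃ J, ∀ x ∈ M.ann J, ∀ e ∈ G₁, V.act x e ∈ U := by
      obtain ⟨s, rfl⟩ := hG₁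
      choose I hI using fun e => hV.exists_ann e U hU
      refine ⟨s.biUnion I, fun x hx e he => ?_⟩
      have : Submodule.span k (s : Set V) ≤ U.comap (V.act x : V →ₗ[k] V) :=
        Submodule.span_le.2 fun e he =>
          hI e x (M.ann_anti (Finset.subset_biUnion_of_mem I he) hx)
      exact this he
    let B : g →ₗ[k] V →ₗ[k] V := hV.rep
    refine ⟨Submodule.map₂ B (Submodule.span k (J.image M.b : Set g)) G₁, I₁ ∪ J,
      Submodule.FG.map₂ B (Submodule.fg_span (Finset.finite_toSet _)) hG₁,
      fun lx ly h1 h2 h3 => ?_⟩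
    obtain ⟨x, lx, rfl⟩ := List.exists_cons_of_length_eq_add_one h1
    have hx := h3.1 x List.mem_cons_self
    obtain ⟨h4, h5⟩ := h₁ lx ly (by simpa using h1) h2
      ⟨fun y hy => h3.1 y (List.mem_cons_of_mem _ hy), h3.2⟩
    have e1 : F (i.word (x :: lx ++ ly)) = V.act x (F (i.word (lx ++ ly))) :=
      hF _ (i.gp_le_pPlus hx) _
    obtain ⟨a, ha, b, hb, hab⟩ := Submodule.mem_sup.1 h4
    rw [e1]
    constructor
    · rw [← hab, map_add]
      refine add_mem (Submodule.mem_sup_left (hact x a ha)) ?_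
      have h6 := hJ _ (M.sub_sum_mem_ann hx J) b hb
      have h7 : V.act x b = V.act (x - ∑ j ∈ J, M.form x (M.a j) • M.b j) b +
          B (∑ j ∈ J, M.form x (M.a j) • M.b j) b := by
        change B x b = B (x - ∑ j ∈ J, M.form x (M.a j) • M.b j) b + _
        rw [map_sub, LinearMap.sub_apply, sub_add_cancel]
      rw [h7]
      refine Submodule.add_mem_sup h6 (Submodule.apply_mem_map₂ B ?_ hb)
      refine Submodule.sum_mem _ fun j hj => Submodule.smul_mem _ _ (Submodule.subset_span ?_)
      simp only [Finset.coe_image]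
      exact ⟨j, hj, rfl⟩
    · rintro ⟨y, hy, hyI⟩
      rcases List.mem_cons.1 hy with rfl | hy
      · rw [← hab, map_add]
        exact add_mem (hact _ a ha) (hJ _ (M.ann_anti Finset.subset_union_right hyI) b hb)
      · exact hact _ _ (h5 ⟨y, hy, M.ann_anti Finset.subset_union_left hyI⟩)

theorem isCont_comp [Module.Finite k gD] (l : Module.Dual k V)
    (hl : IsOpen (LinearMap.ker l : Set V)) : i.IsCont (l.comp F) := by
  refine (i.isCont_iff _).2 fun p q => ?_
  obtain ⟨G, I, -, h⟩ := i.fg_words hV hF p q _ hl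
  exact ⟨I, fun lx ly h1 h2 h3 h4 => (h lx ly h1 h2 h3).2 h4⟩

theorem fg_filt [Module.Finite k gD] (n : ℕ) (U : Submodule k V) (hU : IsOpen (U : Set V)) :
    ∃ G : Submodule k V, G.FG ∧ ∀ z ∈ i.filt n, F z ∈ U ⊔ G := by
  choose G I hG h using fun p q => i.fg_words hV hF p q U hU
  let G' : Fin (n + 1) × Fin (n + 1) → Submodule k V := fun j => G j.1 j.2
  refine ⟨⨆ j, G' j, Submodule.fg_iSup G' fun j => hG j.1 j.2, fun z hz => ?_⟩
  have hz' := i.filt_le_ordFilt n hz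
  suffices h0 : i.ordFilt n ≤ Submodule.comap F (U ⊔ ⨆ j, G' j) from h0 hz'
  refine Submodule.span_le.2 ?_
  rintro _ ⟨lx, ly, h1, h2, rfl⟩
  have h3 := (h lx.length ly.length lx ly rfl rfl h2).1
  have h4 : G lx.length ly.length ≤ ⨆ j, G' j :=
    le_iSup G' (⟨lx.length, by omega⟩, ⟨ly.length, by omega⟩)
  exact sup_le_sup_left h4 U h3

/-- Modulo U, the image of the filtration step under F lies in a finite-dimensional G'. With
coordinates l_j on G', extended to V with open kernels, and lifts e_j of the basis vectors, the
approximating tensor is ∑ (l_j ∘ F) ⊗ e_j. -/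
theorem exists_approx [Module.Finite k gD] (n : ℕ) (U : Submodule k V) (hU : IsOpen (U : Set V)) :
    ∃ s : tens i.P V, ∀ z ∈ i.filt n, i.sliceEv hV s z - F z ∈ U := by
  obtain ⟨G, hG, h⟩ := i.fg_filt hV hF n U hU
  let G' := G.map U.mkQ
  have : Module.Finite k G' := Module.Finite.iff_fg.2 (hG.map _)
  -- A projection of V/U onto G', used to extend the coordinates of G' to functionals on V that
  -- vanish on U.
  obtain ⟨π, hπ⟩ := G'.subtype.exists_leftInverse_of_injective (Submodule.ker_subtype G')
  let c := Module.finBasis k G'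
  choose e he using fun j => Submodule.mkQ_surjective U (c j : V ⧸ U)
  let l : Fin (Module.finrank k G') → Module.Dual k V := fun j =>
    ((c.coord j).comp π).comp U.mkQ
  have hl : ∀ j, IsOpen (LinearMap.ker (l j) : Set V) := fun j => by
    refine isOpen_submodule_mono (fun x hx => ?_) hU
    change c.coord j (π (U.mkQ x)) = 0
    rw [show U.mkQ x = 0 from (Submodule.Quotient.mk_eq_zero U).2 hx, map_zero, map_zero]
  refine ⟨∑ j, ptens (X := i.P) (Y := V) (⟨_, i.isCont_comp hV hF (l j) (hl j)⟩ : i.NStar) (e j),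
    fun z hz => ?_⟩
  have h1 : i.sliceEv hV (∑ j, ptens (X := i.P) (Y := V)
      (⟨_, i.isCont_comp hV hF (l j) (hl j)⟩ : i.NStar) (e j)) z = ∑ j, l j (F z) • e j := by
    rw [sliceEv_apply, map_sum]
    exact Finset.sum_congr rfl fun j _ => i.slice_ev_ptens hV z _ _
  rw [h1]
  refine (Submodule.Quotient.mk_eq_zero U).1 ?_
  change U.mkQ (∑ j, l j (F z) • e j - F z) = 0
  rw [map_sub, map_sum, sub_eq_zero]
  have h2 : U.mkQ (F z) ∈ G' := by
    obtain ⟨a, ha, b, hb, hab⟩ := Submodule.mem_sup.1 (h z hz)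
    refine ⟨b, hb, ?_⟩
    rw [← hab, map_add, show U.mkQ a = 0 from (Submodule.Quotient.mk_eq_zero U).2 ha, zero_add]
  have h3 : π (U.mkQ (F z)) = ⟨_, h2⟩ := DFunLike.congr_fun hπ ⟨_, h2⟩
  have h4 : ∀ j, l j (F z) = c.repr ⟨_, h2⟩ j := fun j => by
    change c.coord j (π (U.mkQ (F z))) = _
    rw [h3]; rfl
  have h5 := congrArg G'.subtype (c.sum_repr ⟨_, h2⟩)
  rw [map_sum] at h5
  refine Eq.trans (Finset.sum_congr rfl fun j _ => ?_) h5
  rw [map_smul, map_smul, he, h4]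
  rfl

end Surjective

/-- Intersections make the open subspaces, ordered by reverse inclusion, a directed index set for
the Cauchy net below. -/
instance (X : TMod.{u, v, w} k g) : SemilatticeInf (OpenSub X) :=
  Subtype.semilatticeInf fun _ _ hU hV => hU.inter hV

/-- The approximations form a net indexed by a filtration degree and an open subspace U. Two of them
beyond (n, U) agree modulo U on the n-th step, so by `mem_cbasic_of_slice` they differ by an element
of a basic open subspace. The net is therefore Cauchy, and slices are continuous along its limit. -/
theorem exists_sliceEv_eq (hV : V.IsEquicontinuous M) (F : i.NPlus →ₗ[k] V)
    (h : ∀ n, ∀ U : OpenSub V, ∃ s : tens i.P V, ∀ z ∈ i.filt n, i.sliceEv hV s z - F z ∈ U.1) :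
    ∃ t, ∀ z, i.sliceEv hV t z = F z := by
  have := hV.complete
  have := hV.separated
  choose s hs using h
  let σ : ℕ × (OpenSub V)ᵒᵈ → CTensor i.P V := fun j => s j.1 (OrderDual.ofDual j.2)
  have key : ∀ (n : ℕ) (U : OpenSub V) (a b : ℕ × (OpenSub V)ᵒᵈ),
      (n, OrderDual.toDual U) ≤ a → (n, OrderDual.toDual U) ≤ b →
      σ b - σ a ∈ cbasic i.P V (⟨i.NStarFilt n, i.isOpen_NStarFilt n⟩, U) := by
    intro n U a b ha hb
    refine mem_cbasic_of_slice hV.isLinTop (D := i.ev '' (i.filt n)) ?_ _ _ ?_ _ ?_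
    · rintro _ ⟨z, -, rfl⟩
      exact i.isOpen_ker_ev z
    · intro f hf z hz
      exact hf _ ⟨z, hz, rfl⟩ fun e he => he z hz
    · rintro _ ⟨z, hz, rfl⟩ -
      have e1 := ha.2 (hs a.1 (OrderDual.ofDual a.2) z (i.filt_mono ha.1 hz))
      have e2 := hb.2 (hs b.1 (OrderDual.ofDual b.2) z (i.filt_mono hb.1 hz))
      have e3 := U.1.sub_mem e2 e1
      rw [sub_sub_sub_cancel_right] at e3
      rw [map_sub]
      exact e3
  have hc : CauchySeq σ := by
    refine ((uniformity (CTensor i.P V)).basis_sets.cauchySeq_iff (u := σ)).2 fun N hN => ?_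
    rw [id]
    rw [uniformity_eq_comap_nhds_zero (CTensor i.P V)] at hN
    obtain ⟨O, hO, hON⟩ := hN
    obtain ⟨p, hp⟩ := cbasic_isLinTop (X := i.P) (Y := V) O hO
    obtain ⟨n, hn⟩ := (i.NStar_mem_nhds_zero _).1 (p.1.2.mem_nhds p.1.1.zero_mem)
    have hle : cbasic i.P V (⟨i.NStarFilt n, i.isOpen_NStarFilt n⟩, p.2) ≤ cbasic i.P V p := by
      refine cbasic_le (isClosed_of_isOpen_submodule _ (isOpen_cbasic p)) ?_ ?_
      · intro x hx y
        exact ptens_mem_cbasic_left (X := i.P) (hn hx) y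
      · intro x y hy
        exact ptens_mem_cbasic_right (X := i.P) x hy
    refine ⟨(n, OrderDual.toDual p.2), fun a ha b hb => ?_⟩
    have hab : σ b - σ a ∈ O := hp (hle (key n p.2 a b ha hb))
    exact hON hab
  obtain ⟨t, ht⟩ := cauchySeq_tendsto_of_complete hc
  refine ⟨t, fun z => ?_⟩
  have h1 : Tendsto (fun j => slice V (i.ev z) (σ j)) atTop (𝓝 (slice V (i.ev z) t)) :=
    ((slice V (i.ev z)).continuous.tendsto t).comp ht
  refine tendsto_nhds_unique h1 ?_
  have h2 : Tendsto (fun j => slice V (i.ev z) (σ j) - F z) atTop (𝓝 0) := by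
    intro N hN
    obtain ⟨U, hU, hUN⟩ := hV.linear N hN
    obtain ⟨n, hn⟩ := i.exists_mem_filt z
    refine mem_map.2 <| mem_of_superset (mem_atTop (n, OrderDual.toDual (⟨U, hU⟩ : OpenSub V)))
      fun j hj => hUN ?_
    have hj' : (n, OrderDual.toDual (⟨U, hU⟩ : OpenSub V)) ≤ j := hj
    exact hj'.2 (hs j.1 (OrderDual.ofDual j.2) z (i.filt_mono hj'.1 hn))
  have h3 := h2.add_const (F z)
  simpa using h3

/-- An equivariant map with the prescribed value at 1_+ is realized by a tensor. Equivariance makes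
the tensor p_+-invariant, so L_- maps to it by the universal property. This is done for each
coefficient of the series separately. -/
theorem surjOn_alpha [Module.Finite k gD] (hV : V.IsEquicontinuous M) :
    Set.SurjOn (i.alpha V) (i.Gam V) Set.univ := by
  intro x _
  have h : ∀ t : V, ∃ f : i.LMinus →ₗ[k] tens i.P V,
      (∀ x l, f ⁅x, l⁆ = (tens i.P V).act x (f l)) ∧ i.evOne V (f (Ind.one k i.pPlus)) = t := by
    intro t
    obtain ⟨F, h1, h2⟩ := i.exists_equivariant_map hV t
    obtain ⟨s, hs⟩ := i.exists_sliceEv_eq hV F fun n U => i.exists_approx hV h2 n U.1 U.2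
    obtain ⟨f, h3, h4⟩ := Ind.exists_lift i.pPlus
      (isEquicontinuous_tens i.isEquicontinuous_P hV).rep s fun x hx => by
        refine i.sliceEv_ext hV fun z => ?_
        refine (i.sliceEv_act hV x s z).trans ?_
        rw [hs, hs, h2 x hx, sub_self, sliceEv_apply, map_zero]
    refine ⟨f, h4, ?_⟩
    rw [h3, ← i.sliceEv_one hV, hs, h1]
  choose f h1 h2 using h
  exact ⟨fun n => f (x n), fun n => h1 (x n), funext fun n => h2 (x n)⟩

theorem bijOn_alpha [Module.Finite k gD] (hV : V.IsEquicontinuous M) :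
    Set.BijOn (i.alpha V) (i.Gam V) Set.univ :=
  ⟨fun _ _ => trivial, i.injOn_alpha hV, i.surjOn_alpha hV⟩

end SplitEmbedding

end

end RelTwist

namespace RelTwist

noncomputable section

open scoped TensorProduct Topology
open Filter

set_option linter.unusedSectionVars false

/-! ### The 1-jet of a Lie associator -/

section AssociatorJet

open PowerSeries

variable {k : Type u} [Field k]

theorem coeff_zero_mul' {R : Type*} [Ring R] (F G : PowerSeries R) :
    coeff 0 (F * G) = coeff 0 F * coeff 0 G := by
  simp

theorem coeff_one_mul' {R : Type*} [Ring R] (F G : PowerSeries R) :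
    coeff 1 (F * G) = coeff 0 F * coeff 1 G + coeff 1 F * coeff 0 G := by
  rw [coeff_mul, Finset.Nat.antidiagonal_succ]
  simp

theorem isInfBraid_of_commRing {n : ℕ} {R : Type*} [CommRing R] (t : Fin n → Fin n → R)
    (h : ∀ i j, t i j = t j i) : IsInfBraid t :=
  ⟨fun i j _ => h i j, fun _ _ _ _ _ _ _ _ _ _ => Commute.all _ _, fun _ _ _ _ _ _ =>
    Commute.all _ _⟩

variable (Φ : LieAssociator k)

namespace LieAssociator

/-- By homogeneity the coefficient is a scalar c. The pentagon for t = 0 reads c² = c³, and c is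
nonzero because the series is invertible. -/
theorem coeff_zero_series : coeff 0 Φ.series.1 = 1 := by
  have h := Φ.homogeneous 0
  rw [pow_zero] at h
  obtain ⟨c, hc⟩ := Submodule.mem_one.1 h
  have h1 : ∀ x y : k, coeff 0 (evalFree Φ.series.1 x y) = c := fun x y => by
    unfold evalFree
    rw [coeff_map, ← hc]
    exact AlgHom.commutes _ c
  have h2 := congrArg (coeff 0) (Φ.pentagon k (fun _ _ => 0)
    (isInfBraid_of_commRing _ fun _ _ => rfl))
  simp only [coeff_zero_eq_constantCoeff, map_mul] at h2 h1
  simp only [h1] at h2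
  have h3 : c ≠ 0 := by
    rintro rfl
    have h4 := congrArg (coeff 0) Φ.series.mul_inv
    rw [coeff_zero_mul', ← hc, map_zero, zero_mul, coeff_zero_one] at h4
    exact zero_ne_one h4
  have h5 : c = 1 := by
    have : c * c * (c - 1) = 0 := by rw [mul_sub, mul_one, ← h2, sub_self]
    rcases mul_eq_zero.1 this with h | h
    · exact absurd (mul_self_eq_zero.1 h) h3
    · exact sub_eq_zero.1 h
  rw [← hc, h5, map_one]

/-- By homogeneity the coefficient is c₀A + c₁B. In the commutative algebra k every symmetric array
satisfies the infinitesimal braid relations, and at order ħ the pentagon reduces to c₀ t₀₁ + c₁ t₂₃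
= 0. -/
theorem coeff_one_series : coeff 1 Φ.series.1 = 0 := by
  have h := Φ.homogeneous 1
  rw [pow_one] at h
  obtain ⟨c, hc⟩ := (Submodule.mem_span_range_iff_exists_fun k).1 h
  rw [Fin.sum_univ_two] at hc
  have h0 : ∀ x y : k, coeff 0 (evalFree Φ.series.1 x y) = 1 := fun x y => by
    unfold evalFree
    rw [coeff_map, Φ.coeff_zero_series, map_one]
  have h1 : ∀ x y : k, coeff 1 (evalFree Φ.series.1 x y) = c 0 * x + c 1 * y := fun x y => by
    unfold evalFree
    rw [coeff_map, ← hc]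
    change FreeAlgebra.lift k ![x, y] _ = _
    simp
  have h2 : ∀ t : Fin 4 → Fin 4 → k, (∀ i j, t i j = t j i) →
      c 0 * t 0 1 + c 1 * t 2 3 = 0 := fun t ht => by
    have h3 := congrArg (coeff 1) (Φ.pentagon k t (isInfBraid_of_commRing t ht))
    rw [coeff_one_mul', coeff_one_mul', coeff_one_mul', coeff_zero_mul', h0, h0, h0, h0, h0, h1, h1,
      h1, h1, h1] at h3
    linear_combination -h3
  have h3 : c 0 = 0 := by
    -- Among pairs of indices below four, the sum 1 singles out {0, 1}; likewise the sum 5 below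
    -- singles out {2, 3}.
    have := h2 (fun i j => if i.1 + j.1 = 1 then 1 else 0) fun i j => by rw [add_comm]
    simpa using this
  have h4 : c 1 = 0 := by
    have := h2 (fun i j => if i.1 + j.1 = 5 then 1 else 0) fun i j => by rw [add_comm]
    simpa using this
  rw [← hc, h3, h4, zero_smul, zero_smul, add_zero]

theorem coeff_zero_inv : coeff 0 Φ.series⁻¹.1 = 1 := by
  have h := congrArg (coeff 0) Φ.series.mul_inv
  rw [coeff_zero_mul', coeff_zero_series, one_mul] at h
  rw [h]; simp

theorem coeff_one_inv : coeff 1 Φ.series⁻¹.1 = 0 := by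
  have h := congrArg (coeff 1) Φ.series.mul_inv
  rw [coeff_one_mul', coeff_zero_series, coeff_one_series, one_mul, zero_mul, add_zero] at h
  rw [h]; simp [coeff_one]

end LieAssociator

theorem coeff_zero_evalFree {R : Type*} [Ring R] [Algebra k R]
    {F : PowerSeries (FreeAlgebra k (Fin 2))} (h : coeff 0 F = 1) (x y : R) :
    coeff 0 (evalFree F x y) = 1 := by
  unfold evalFree
  rw [coeff_map, h, map_one]

theorem coeff_one_evalFree {R : Type*} [Ring R] [Algebra k R]
    {F : PowerSeries (FreeAlgebra k (Fin 2))} (h : coeff 1 F = 0) (x y : R) :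
    coeff 1 (evalFree F x y) = 0 := by
  unfold evalFree
  rw [coeff_map, h, map_zero]

end AssociatorJet

/-! ### 1-jets of the structure morphisms -/

section Jets

variable {k : Type u} {g : Type v} [Field k] {X : TMod.{u, v, w} k g} {Y : TMod.{u, v, w'} k g}
  {Z : TMod.{u, v, w''} k g}

theorem antidiagonal_zero' : Finset.HasAntidiagonal.antidiagonal 0 = {(0, 0)} := rfl

theorem antidiagonal_one : Finset.HasAntidiagonal.antidiagonal 1 = {(0, 1), (1, 0)} := rfl

namespace HSeries

theorem comp_zero (F : HSeries Y Z) (G : HSeries X Y) : comp F G 0 = (F 0).comp (G 0) := by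
  unfold comp
  rw [antidiagonal_zero', Finset.sum_singleton]

theorem comp_one (F : HSeries Y Z) (G : HSeries X Y) :
    comp F G 1 = (F 0).comp (G 1) + (F 1).comp (G 0) := by
  unfold comp
  rw [antidiagonal_one, Finset.sum_pair (by simp)]

theorem const_zero (f : X →L[k] Y) : const f 0 = f := if_pos rfl

theorem const_one (f : X →L[k] Y) : const f 1 = 0 := if_neg one_ne_zero

end HSeries

theorem mapT_zero_left {X : TMod.{u, v, w} k g} {X' : TMod.{u, v, w'} k g} {Y : TMod.{u, v, w''} k g}
    {Y' : TMod.{u, v, v'} k g} (f : Y →L[k] Y') : mapT (0 : X →L[k] X') f = 0 :=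
  ctensor_ext fun x y => by
    rw [mapT_ptens]
    exact ptens_zero_left _

theorem mapT_zero_right {X : TMod.{u, v, w} k g} {X' : TMod.{u, v, w'} k g} {Y : TMod.{u, v, w''} k g}
    {Y' : TMod.{u, v, v'} k g} (f : X →L[k] X') : mapT f (0 : Y →L[k] Y') = 0 :=
  ctensor_ext fun x y => by
    rw [mapT_ptens]
    exact ptens_zero_right _

end Jets

namespace ManinTriple

variable {k : Type u} {g : Type v} [Field k] [LieRing g] [LieAlgebra k g] (M : ManinTriple k g)
  (X : TMod.{u, v, w} k g) (Y : TMod.{u, v, w'} k g) (Z : TMod.{u, v, w''} k g)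
  (Φ : LieAssociator k)

theorem assoc_zero : M.assoc X Y Z Φ 0 = assocT X Y Z := by
  unfold assoc
  rw [HSeries.comp_zero, HSeries.const_zero, coeff_zero_evalFree Φ.coeff_zero_series]
  rfl

theorem assoc_one : M.assoc X Y Z Φ 1 = 0 := by
  unfold assoc
  rw [HSeries.comp_one, HSeries.const_one, coeff_one_evalFree Φ.coeff_one_series,
    ContinuousLinearMap.comp_zero, ContinuousLinearMap.zero_comp, add_zero]

theorem assocInv_zero : M.assocInv X Y Z Φ 0 = assocInvT X Y Z := by
  unfold assocInv
  rw [HSeries.comp_zero, HSeries.const_zero, coeff_zero_evalFree Φ.coeff_zero_inv]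
  rfl

theorem assocInv_one : M.assocInv X Y Z Φ 1 = 0 := by
  unfold assocInv
  rw [HSeries.comp_one, HSeries.const_one, coeff_one_evalFree Φ.coeff_one_inv,
    ContinuousLinearMap.comp_zero, ContinuousLinearMap.zero_comp, add_zero]

theorem braidInv_zero : M.braidInv X Y 0 = swapT Y X := by
  unfold braidInv hexp
  rw [HSeries.comp_zero, HSeries.const_zero, PowerSeries.coeff_mk, pow_zero, Nat.factorial_zero,
    Nat.cast_one, inv_one, one_smul]
  rfl

theorem braidInv_one :
    M.braidInv X Y 1 = (-(2 : k)⁻¹ • M.Omega X Y).comp (swapT Y X) := by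
  unfold braidInv hexp
  rw [HSeries.comp_one, HSeries.const_zero, HSeries.const_one, PowerSeries.coeff_mk,
    PowerSeries.coeff_mk, pow_one, Nat.factorial_one, Nat.cast_one, inv_one, one_smul,
    ContinuousLinearMap.comp_zero, zero_add]

end ManinTriple

namespace SplitEmbedding

variable {k : Type u} {g : Type v} {gD : Type v'} [Field k] [LieRing g] [LieAlgebra k g]
  [LieRing gD] [LieAlgebra k gD] {MD : ManinTriple k gD} {M : ManinTriple k g}
  (i : SplitEmbedding MD M)

theorem iPlusVee_zero {Φ : LieAssociator k} (T : DrinfeldT M Φ) :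
    i.iPlusVee T 0 = i.iPlusStar.comp (swapT i.P i.P) := by
  unfold iPlusVee
  rw [HSeries.comp_zero, HSeries.comp_zero, HSeries.const_zero, HSeries.const_zero, T.coeff_zero]
  rfl

theorem iPlusVee_one {Φ : LieAssociator k} (T : DrinfeldT M Φ) : i.iPlusVee T 1 = 0 := by
  unfold iPlusVee
  rw [HSeries.comp_one, HSeries.comp_one, HSeries.const_one, HSeries.const_one, T.coeff_one,
    ContinuousLinearMap.comp_zero, ContinuousLinearMap.zero_comp, ContinuousLinearMap.zero_comp,
    add_zero, add_zero, ContinuousLinearMap.comp_zero]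

variable (V : TMod.{u, v, w} k g) (W : TMod.{u, v, w'} k g)

/-- rebracketing, with an operator `S` applied to the middle factors -/
def rebracket (S : tens V i.P →L[k] tens i.P V) : Bracketing →
    (tens (tens i.P V) (tens i.P W) →L[k] tens (tens i.P i.P) (tens V W))
  | .inner =>
    (assocInvT i.P i.P (tens V W)).comp <|
    (mapT (ContinuousLinearMap.id k i.P) (assocT i.P V W)).comp <|
    (mapT (ContinuousLinearMap.id k i.P) (mapT S (ContinuousLinearMap.id k W))).comp <|
    (mapT (ContinuousLinearMap.id k i.P) (assocInvT V i.P W)).comp <|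
    assocT i.P V (tens i.P W)
  | .outer =>
    (assocT (tens i.P i.P) V W).comp <|
    (mapT (assocInvT i.P i.P V) (ContinuousLinearMap.id k W)).comp <|
    (mapT (mapT (ContinuousLinearMap.id k i.P) S) (ContinuousLinearMap.id k W)).comp <|
    (mapT (assocT i.P V i.P) (ContinuousLinearMap.id k W)).comp <|
    assocInvT (tens i.P V) i.P W

theorem middle_zero (Φ : LieAssociator k) (c : Bracketing) :
    i.middle V W Φ c 0 = i.rebracket V W (swapT V i.P) c := by
  cases c <;> unfold middle rebracket <;> dsimp only
  · rw [HSeries.comp_zero, HSeries.comp_zero, HSeries.comp_zero, HSeries.comp_zero,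
      HSeries.tensLeft, HSeries.tensLeft, HSeries.tensLeft, HSeries.tensRight, M.assoc_zero,
      M.assocInv_zero, M.assoc_zero, M.assocInv_zero, M.braidInv_zero]
  · rw [HSeries.comp_zero, HSeries.comp_zero, HSeries.comp_zero, HSeries.comp_zero,
      HSeries.tensRight, HSeries.tensRight, HSeries.tensRight, HSeries.tensLeft, M.assoc_zero,
      M.assocInv_zero, M.assoc_zero, M.assocInv_zero, M.braidInv_zero]

/-- The rebracketings have no term of order ħ, so the inverse braiding is the only contribution, in
either bracketing. -/
theorem middle_one (Φ : LieAssociator k) (c : Bracketing) :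
    i.middle V W Φ c 1 =
      i.rebracket V W ((-(2 : k)⁻¹ • M.Omega i.P V).comp (swapT V i.P)) c := by
  cases c <;> unfold middle rebracket <;> dsimp only
  · simp only [HSeries.comp_zero, HSeries.comp_one, HSeries.tensLeft, HSeries.tensRight,
      M.assoc_zero, M.assocInv_zero, M.assoc_one, M.assocInv_one, M.braidInv_one, mapT_zero_right, ContinuousLinearMap.comp_zero, ContinuousLinearMap.zero_comp, zero_add,
      add_zero]
  · simp only [HSeries.comp_zero, HSeries.comp_one, HSeries.tensLeft, HSeries.tensRight,
      M.assoc_zero, M.assocInv_zero, M.assoc_one, M.assocInv_one, M.braidInv_one, mapT_zero_left,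
      ContinuousLinearMap.comp_zero, ContinuousLinearMap.zero_comp, zero_add,
      add_zero]

end SplitEmbedding

end

end RelTwist

namespace RelTwist

noncomputable section

open scoped TensorProduct Topology
open Filter

set_option linter.unusedSectionVars false

namespace SplitEmbedding

variable {k : Type u} {g : Type v} {gD : Type v'} [Field k] [LieRing g] [LieAlgebra k g]
  [LieRing gD] [LieAlgebra k gD] {MD : ManinTriple k gD} {M : ManinTriple k g}
  (i : SplitEmbedding MD M) {V : TMod.{u, v, w} k g} {W : TMod.{u, v, w'} k g}

/-! ### `J` takes values in `Γ(V ⊗ W)` -/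

theorem ofAlg_map_lie {f : i.LMinus →ₗ[k] tens i.P V} {f' : i.LMinus →ₗ[k] tens i.P W}
    (hf : ∀ x l, f ⁅x, l⁆ = (tens i.P V).act x (f l))
    (hf' : ∀ x l, f' ⁅x, l⁆ = (tens i.P W).act x (f' l)) (x : g)
    (t : i.LMinus ⊗[k] i.LMinus) :
    ofAlg (tens i.P V) (tens i.P W) (TensorProduct.map f f' ⁅x, t⁆) =
      (tens (tens i.P V) (tens i.P W)).act x
        (ofAlg (tens i.P V) (tens i.P W) (TensorProduct.map f f' t)) := by
  induction t with
  | zero => rw [lie_zero, map_zero, map_zero, map_zero]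
  | add s t hs ht => rw [lie_add, map_add, map_add, hs, ht, map_add, map_add, map_add]
  | tmul a b =>
    rw [TensorProduct.LieModule.lie_tmul_right, map_add, map_add, TensorProduct.map_tmul,
      TensorProduct.map_tmul, TensorProduct.map_tmul, hf, hf', ofAlg_tmul, ofAlg_tmul, ofAlg_tmul,
      tens_act_ptens]

theorem preJ_lie {f : i.LMinus →ₗ[k] tens i.P V} {f' : i.LMinus →ₗ[k] tens i.P W}
    (hf : ∀ x l, f ⁅x, l⁆ = (tens i.P V).act x (f l))
    (hf' : ∀ x l, f' ⁅x, l⁆ = (tens i.P W).act x (f' l)) (x : g) (l : i.LMinus) :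
    i.preJ f f' ⁅x, l⁆ = (tens (tens i.P V) (tens i.P W)).act x (i.preJ f f' l) := by
  unfold preJ
  rw [LinearMap.comp_apply, Ind.comul_lie]
  exact i.ofAlg_map_lie hf hf' x _

theorem preJ_one (f : i.LMinus →ₗ[k] tens i.P V) (f' : i.LMinus →ₗ[k] tens i.P W) :
    i.preJ f f' (Ind.one k i.pPlus) = ptens (X := tens i.P V) (Y := tens i.P W)
      (f (Ind.one k i.pPlus)) (f' (Ind.one k i.pPlus)) := by
  unfold preJ
  rw [LinearMap.comp_apply, Ind.comul_one]
  rfl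

section Equivariance

variable (hV : V.IsEquicontinuous M) (hW : W.IsEquicontinuous M)

include hV hW

theorem isEquivar_middle (Φ : LieAssociator k) (c : Bracketing) :
    (i.middle V W Φ c).IsEquivar := by
  have hP := i.isEquicontinuous_P
  cases c
  · exact (isEquivar_assocInv hP hP (isEquicontinuous_tens hV hW) Φ).comp <|
      (HSeries.IsEquivar.tensLeft i.P (isEquivar_assoc hP hV hW Φ)).comp <|
      (HSeries.IsEquivar.tensLeft i.P ((isEquivar_braidInv hP hV).tensRight W)).comp <|
      (HSeries.IsEquivar.tensLeft i.P (isEquivar_assocInv hV hP hW Φ)).comp <|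
      isEquivar_assoc hP hV (isEquicontinuous_tens hP hW) Φ
  · exact (isEquivar_assoc (isEquicontinuous_tens hP hP) hV hW Φ).comp <|
      ((isEquivar_assocInv hP hP hV Φ).tensRight W).comp <|
      ((HSeries.IsEquivar.tensLeft i.P (isEquivar_braidInv hP hV)).tensRight W).comp <|
      ((isEquivar_assoc hP hV hP Φ).tensRight W).comp <|
      isEquivar_assocInv (isEquicontinuous_tens hP hV) hP hW Φ

/-- Each coefficient is a sum of composites of g-equivariant maps, starting from i_- followed by f ⊗
f'. -/
theorem J_mem_Gam {Φ : LieAssociator k} (T : DrinfeldT M Φ) (c : Bracketing) {f : i.HomL V}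
    (hf : f ∈ i.Gam V) {f' : i.HomL W} (hf' : f' ∈ i.Gam W) :
    i.J T c f f' ∈ i.Gam (tens V W) := by
  intro n x l
  have h1 := ((i.isEquivar_iPlusVee T).tensRight (tens V W)).comp (i.isEquivar_middle hV hW Φ c)
  unfold J
  rw [LinearMap.sum_apply, LinearMap.sum_apply, map_sum]
  refine Finset.sum_congr rfl fun p _ => ?_
  rw [LinearMap.sum_apply, LinearMap.sum_apply, map_sum]
  refine Finset.sum_congr rfl fun q _ => ?_
  rw [LinearMap.comp_apply, LinearMap.comp_apply, i.preJ_lie (hf q.1) (hf' q.2)]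
  exact h1 p.1 x _

end Equivariance

/-! ### The 1-jet of the relative twist -/

section FirstOrder

variable (hV : V.IsEquicontinuous M) (hW : W.IsEquicontinuous M)

include hV in
theorem evOne_ptens (f : i.NStar) (t : V) :
    i.evOne V (ptens (X := i.P) f t) = f.1 (Ind.one k i.mMinus) • t :=
  i.slice_ev_ptens hV _ f t

/-- the operator by which the first tensor factors are paired with the generator -/
def contract (S : tens V i.P →L[k] tens i.P V) (c : Bracketing) :
    tens (tens i.P V) (tens i.P W) →L[k] tens V W :=
  (i.evOne (tens V W)).comp
    ((mapT (i.iPlusStar.comp (swapT i.P i.P)) (ContinuousLinearMap.id k (tens V W))).comp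
      (i.rebracket V W S c))

include hV hW

/-- Because i_+(1_+) = 1_+ ⊗ 1_+, evaluating the product of two functionals at 1_+ evaluates each of
them there. The functional in t meets nothing else and may be evaluated at once; only S acting on
the remaining vector of V and f' is left. The flip inside i_+^∨ is invisible at 1_+. -/
theorem contract_ptens (S : tens V i.P →L[k] tens i.P V) (c : Bracketing) (t : tens i.P V)
    (f' : i.NStar) (y : W) :
    i.contract S c (ptens (X := tens i.P V) (Y := tens i.P W) t (ptens (X := i.P) f' y)) =
      ptens (i.evOne V (S (ptens (Y := i.P) (i.evOne V t) f'))) y := by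
  have hVW := isEquicontinuous_tens hV hW
  -- What remains after S has been applied, in the inner bracketing; `key'` is the analogue for the
  -- outer one.
  have key : ∀ (f : i.NStar) (s : tens i.P V), i.evOne (tens V W)
      (mapT (i.iPlusStar.comp (swapT i.P i.P)) (ContinuousLinearMap.id k (tens V W))
        (assocInvT i.P i.P (tens V W) (ptens (X := i.P) (Y := tens i.P (tens V W)) f
          (assocT i.P V W (ptens (X := tens i.P V) s y))))) =
      f.1 (Ind.one k i.mMinus) • ptens (i.evOne V s) y := by
    intro f s
    have : (i.evOne (tens V W)).comp
        ((mapT (i.iPlusStar.comp (swapT i.P i.P)) (ContinuousLinearMap.id k (tens V W))).comp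
          ((assocInvT i.P i.P (tens V W)).comp
            ((ptensL (X := i.P) (Y := tens i.P (tens V W)) f).comp
              ((assocT i.P V W).comp (ptensR (X := tens i.P V) y))))) =
        f.1 (Ind.one k i.mMinus) • (ptensR (X := V) y).comp (i.evOne V) := by
      refine ctensor_ext fun f'' v => ?_
      simp only [ContinuousLinearMap.comp_apply, smul_apply]
      rw [ptensR_apply, ptensR_apply, ptensL_apply, assocT_ptens, assocInvT_ptens, mapT_ptens]
      refine (i.evOne_ptens hVW _ _).trans ?_
      rw [ContinuousLinearMap.comp_apply, swapT_ptens, i.iPlusStar_ptens, Ind.comul_one,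
        i.pair_tmul, i.evOne_ptens hV, ptens_smul_left, smul_smul, mul_comm]
      rfl
    exact DFunLike.congr_fun this s
  have key' : ∀ (f : i.NStar) (s : tens i.P V), i.evOne (tens V W)
      (mapT (i.iPlusStar.comp (swapT i.P i.P)) (ContinuousLinearMap.id k (tens V W))
        (assocT (tens i.P i.P) V W (ptens (X := tens (tens i.P i.P) V)
          (assocInvT i.P i.P V (ptens (X := i.P) (Y := tens i.P V) f s)) y))) =
      f.1 (Ind.one k i.mMinus) • ptens (i.evOne V s) y := by
    intro f s
    have : (i.evOne (tens V W)).comp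
        ((mapT (i.iPlusStar.comp (swapT i.P i.P)) (ContinuousLinearMap.id k (tens V W))).comp
          ((assocT (tens i.P i.P) V W).comp
            ((ptensR (X := tens (tens i.P i.P) V) y).comp
              ((assocInvT i.P i.P V).comp (ptensL (X := i.P) (Y := tens i.P V) f))))) =
        f.1 (Ind.one k i.mMinus) • (ptensR (X := V) y).comp (i.evOne V) := by
      refine ctensor_ext fun f'' v => ?_
      simp only [ContinuousLinearMap.comp_apply, smul_apply]
      rw [ptensR_apply, ptensR_apply, ptensL_apply, assocInvT_ptens, assocT_ptens, mapT_ptens]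
      refine (i.evOne_ptens hVW _ _).trans ?_
      rw [ContinuousLinearMap.comp_apply, swapT_ptens, i.iPlusStar_ptens, Ind.comul_one,
        i.pair_tmul, i.evOne_ptens hV, ptens_smul_left, smul_smul, mul_comm]
      rfl
    exact DFunLike.congr_fun this s
  have h : (i.contract S c).comp (ptensR (X := tens i.P V) (Y := tens i.P W)
      (ptens (X := i.P) f' y)) =
      (ptensR (X := V) y).comp ((i.evOne V).comp (S.comp
        ((ptensR (X := V) (Y := i.P) f').comp (i.evOne V)))) := by
    refine ctensor_ext fun f v => ?_
    simp only [ContinuousLinearMap.comp_apply]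
    rw [ptensR_apply, ptensR_apply, ptensR_apply, i.evOne_ptens hV, ptens_smul_left, map_smul,
      map_smul, ptens_smul_left]
    unfold contract rebracket
    cases c
    · simp only [ContinuousLinearMap.comp_apply]
      rw [assocT_ptens, mapT_ptens, assocInvT_ptens, mapT_ptens, mapT_ptens, mapT_ptens]
      exact key f _
    · simp only [ContinuousLinearMap.comp_apply]
      rw [assocInvT_ptens, mapT_ptens, assocT_ptens, mapT_ptens, mapT_ptens, mapT_ptens]
      exact key' f _
  exact DFunLike.congr_fun h t

theorem contract_swap (c : Bracketing) (t : tens i.P V) (t' : tens i.P W) :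
    i.contract (swapT V i.P) c (ptens (X := tens i.P V) (Y := tens i.P W) t t') =
      ptens (i.evOne V t) (i.evOne W t') := by
  have h : (i.contract (swapT V i.P) c).comp (ptensL (X := tens i.P V) (Y := tens i.P W) t) =
      (ptensL (X := V) (i.evOne V t)).comp (i.evOne W) := by
    refine ctensor_ext fun f' y => ?_
    simp only [ContinuousLinearMap.comp_apply]
    rw [ptensL_apply, ptensL_apply, i.contract_ptens hV hW, swapT_ptens, i.evOne_ptens hV,
      i.evOne_ptens hW, ptens_smul_left, ptens_smul_right]
  exact DFunLike.congr_fun h t'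

omit hW in
-- Let q represent the coefficient z ↦ (z f')(1_+). By `functional_Omega` the value is (q, p) = (p,
-- q), which is (p f')(1_+); the sign comes from the contragredient action.
theorem functional_evOne_Omega (f' : i.NStar) (x : V) (l : Module.Dual k V)
    (hl : IsOpen (LinearMap.ker l : Set V)) {p : g} (hp : ∀ z, l (V.act z x) = M.form z p) :
    l (i.evOne V (M.Omega i.P V (ptens (X := i.P) f' x))) = - f'.1 ⁅p, Ind.one k i.mMinus⁆ := by
  obtain ⟨q, hq⟩ := i.isEquicontinuous_P.exists_form_eq f' _
    (i.isOpen_ker_ev (Ind.one k i.mMinus))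
  refine (functional_Omega i.isEquicontinuous_P hV (i.isOpen_ker_ev _) hl hq hp).trans ?_
  rw [M.symm, ← hq, ev_apply]
  exact i.actNStar_apply p f' _

/-- The factor -1/2 of the inverse braiding and the sign of the contragredient action combine to
+1/2. -/
theorem slice_contract_Omega (c : Bracketing) (t : tens i.P V) (t' : tens i.P W)
    (l : Module.Dual k V) (hl : IsOpen (LinearMap.ker l : Set V)) {p : g}
    (hp : ∀ z, l (V.act z (i.evOne V t)) = M.form z p) :
    slice W l (i.contract ((-(2 : k)⁻¹ • M.Omega i.P V).comp (swapT V i.P)) c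
      (ptens (X := tens i.P V) (Y := tens i.P W) t t')) =
      (2 : k)⁻¹ • i.sliceEv hW t' ⁅p, Ind.one k i.mMinus⁆ := by
  have := hW.complete
  have := hW.separated
  have h : (slice W l).comp ((i.contract ((-(2 : k)⁻¹ • M.Omega i.P V).comp (swapT V i.P)) c).comp
      (ptensL (X := tens i.P V) (Y := tens i.P W) t)) =
      (2 : k)⁻¹ • slice W (i.ev ⁅p, Ind.one k i.mMinus⁆) := by
    refine ctensor_ext fun f' y => ?_
    simp only [ContinuousLinearMap.comp_apply, smul_apply]
    rw [ptensL_apply, i.contract_ptens hV hW, slice_ptens hW.isLinTop l hl,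
      ContinuousLinearMap.comp_apply, swapT_ptens, smul_apply, map_smul,
      map_smul, i.functional_evOne_Omega hV _ _ l hl hp, i.slice_ev_ptens hW, smul_smul,
      smul_eq_mul, neg_mul_neg]
  exact DFunLike.congr_fun h t'

/-- The operator r contributes the pairing of q with the g_+-part of p, and r_D^{21} that with i(z),
the component of p in i(g_{D,-}). -/
theorem functional_r_add_rD21 (x : V) (y : W) (l : Module.Dual k V) (m : Module.Dual k W)
    (hl : IsOpen (LinearMap.ker l : Set V)) (hm : IsOpen (LinearMap.ker m : Set W)) {p q : g}
    (hp : ∀ z, l (V.act z x) = M.form z p) (hq : ∀ z, m (W.act z y) = M.form z q) {z : gD}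
    (hz : z ∈ MD.gm) (hzp : M.pm p - i.hom z ∈ i.mMinus) :
    m (slice W l ((M.r V W + i.rD21 V W) (ptens x y))) = M.form (M.pp p + i.hom z) q := by
  rw [add_apply, map_add, map_add, functional_r hV hW hl hm hp hq, map_add,
    LinearMap.add_apply]
  congr 1
  · conv_rhs => rw [← M.pm_add_pp q]
    rw [map_add, M.isotropic_gp _ (M.pp_mem p) _ (M.pp_mem q), add_zero, M.symm]
  · obtain ⟨F₀, h1⟩ := functional_sumOp hV hW (Or.inl i.tendsZero_hom_b) x y l m hl hm
      (b := fun j => i.hom (MD.a j))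
    obtain ⟨F₁, h2⟩ := MD.gm_expand hz
    classical
    refine (h1 (F₀ ∪ F₁) Finset.subset_union_left).trans ?_
    conv_rhs => rw [h2 (F₀ ∪ F₁) Finset.subset_union_right]
    rw [map_sum, map_sum, LinearMap.sum_apply]
    refine Finset.sum_congr rfl fun j _ => ?_
    -- The form of i(b^j) with p sees only the g_--part of p, by isotropy, and that part may be
    -- replaced by i(z) since the difference lies in m_- and so is orthogonal to i(g_D).
    have h3 : M.form (i.hom (MD.b j)) p = MD.form (MD.b j) z := by
      have h4 := (i.mem_mMinus.1 hzp).2 (MD.b j)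
      rw [map_sub, sub_eq_zero, i.form_map] at h4
      rw [← h4]
      conv_lhs => rw [← M.pm_add_pp p]
      rw [map_add, M.isotropic_gp _ (i.map_gp _ (MD.b_mem j)) _ (M.pp_mem p), add_zero]
    rw [hp, hq, h3, map_smul, map_smul, LinearMap.smul_apply, smul_eq_mul]

/-- On 1_+ the m_--part of p is invisible, so p acts as p_+ + i(z), an element of p_+. Invariance of
t' then turns its action on N_+ into the action on W. -/
theorem contract_Omega (c : Bracketing) (t : tens i.P V) {t' : tens i.P W}
    (ht' : ∀ x ∈ i.pPlus, (tens i.P W).act x t' = 0) :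
    i.contract ((-(2 : k)⁻¹ • M.Omega i.P V).comp (swapT V i.P)) c
      (ptens (X := tens i.P V) (Y := tens i.P W) t t') =
      ((2 : k)⁻¹ • (M.r V W + i.rD21 V W)) (ptens (i.evOne V t) (i.evOne W t')) := by
  have := hW.complete
  have := hW.separated
  refine eq_of_functionals hW.isLinTop fun l m hl hm => ?_
  obtain ⟨p, hp⟩ := hV.exists_form_eq (i.evOne V t) l hl
  obtain ⟨q, hq⟩ := hW.exists_form_eq (i.evOne W t') m hm
  obtain ⟨z, hz, hzp⟩ := i.gm_decomp (M.pm_mem p)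
  have h1 : M.pp p + i.hom z ∈ i.pPlus := add_mem (i.gp_le_pPlus (M.pp_mem p)) (i.hom_mem_pPlus z)
  have h2 : ⁅p, Ind.one k i.mMinus⁆ = ⁅M.pp p + i.hom z, Ind.one k i.mMinus⁆ := by
    have h3 := Ind.lie_one _ hzp
    rw [sub_lie, sub_eq_zero] at h3
    conv_lhs => rw [← M.pm_add_pp p]
    rw [add_lie, add_lie, h3, add_comm]
  rw [i.slice_contract_Omega hV hW c t t' l hl hp, h2, i.sliceEv_lie hW ht' h1, i.sliceEv_one hW,
    map_smul, hq, smul_apply, map_smul, map_smul,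
    i.functional_r_add_rD21 hV hW _ _ l m hl hm hp hq hz hzp]

end FirstOrder

end SplitEmbedding

end

end RelTwist

/-! ### The relative twist modulo ħ² and its alternation -/

namespace RelTwist

noncomputable section

open scoped TensorProduct Topology
open Filter

set_option linter.unusedSectionVars false

theorem swapT_sumOp {k : Type u} {g : Type v} [Field k] [LieRing g] [LieAlgebra k g]
    {M : ManinTriple k g} {X : TMod.{u, v, w} k g} {Y : TMod.{u, v, w'} k g} {ι : Type*}
    (hX : X.IsEquicontinuous M) (hY : Y.IsEquicontinuous M) {a b : ι → g}
    (hab : M.TendsZero a ∨ M.TendsZero b) (x : X) (y : Y) :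
    swapT X Y (sumOp a b X Y (ptens x y)) = sumOp b a Y X (ptens y x) := by
  rw [sumOp_ptens hX hY hab, sumOp_ptens hY hX hab.symm]
  refine (((summable_ptens hX hY hab x y).hasSum.map (swapT X Y)
    (swapT X Y).continuous).tsum_eq.symm.trans ?_)
  exact tsum_congr fun j => swapT_ptens _ _

namespace SplitEmbedding

variable {k : Type u} {g : Type v} {gD : Type v'} [Field k] [LieRing g] [LieAlgebra k g]
  [LieRing gD] [LieAlgebra k gD] {MD : ManinTriple k gD} {M : ManinTriple k g}
  (i : SplitEmbedding MD M) {V : TMod.{u, v, w} k g} {W : TMod.{u, v, w'} k g}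
  (hV : V.IsEquicontinuous M) (hW : W.IsEquicontinuous M) {Φ : LieAssociator k}
  (T : DrinfeldT M Φ) (c : Bracketing)

theorem comp_middle_zero : HSeries.comp (HSeries.tensRight (i.iPlusVee T) (tens V W))
    (i.middle V W Φ c) 0 =
      (mapT (i.iPlusStar.comp (swapT i.P i.P)) (ContinuousLinearMap.id k (tens V W))).comp
        (i.rebracket V W (swapT V i.P) c) := by
  rw [HSeries.comp_zero, i.middle_zero, HSeries.tensRight, i.iPlusVee_zero]

theorem comp_middle_one : HSeries.comp (HSeries.tensRight (i.iPlusVee T) (tens V W))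
    (i.middle V W Φ c) 1 =
      (mapT (i.iPlusStar.comp (swapT i.P i.P)) (ContinuousLinearMap.id k (tens V W))).comp
        (i.rebracket V W ((-(2 : k)⁻¹ • M.Omega i.P V).comp (swapT V i.P)) c) := by
  rw [HSeries.comp_one, i.middle_one, HSeries.tensRight, HSeries.tensRight, i.iPlusVee_zero,
    i.iPlusVee_one, mapT_zero_left, ContinuousLinearMap.zero_comp, add_zero]

theorem alpha_J (f : i.HomL V) (f' : i.HomL W) (n : ℕ) : i.alpha (tens V W) (i.J T c f f') n =
    ∑ p ∈ Finset.HasAntidiagonal.antidiagonal n, ∑ q ∈ Finset.HasAntidiagonal.antidiagonal p.2,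
      i.evOne (tens V W) (HSeries.comp (HSeries.tensRight (i.iPlusVee T) (tens V W))
        (i.middle V W Φ c) p.1 (ptens (X := tens i.P V) (Y := tens i.P W)
          (f q.1 (Ind.one k i.pPlus)) (f' q.2 (Ind.one k i.pPlus)))) := by
  unfold alpha J
  rw [LinearMap.sum_apply, map_sum]
  refine Finset.sum_congr rfl fun p _ => ?_
  rw [LinearMap.sum_apply, map_sum]
  refine Finset.sum_congr rfl fun q _ => ?_
  rw [LinearMap.comp_apply, i.preJ_one]
  rfl

include hV hW

/-- Only f' has to be a g-morphism: its p_+-invariance is used at order ħ, while f enters through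
its evaluation at 1_+ alone. -/
theorem congr_alpha_J (f : i.HomL V) {f' : i.HomL W} (hf' : f' ∈ i.Gam W) :
    CongrModSq (i.alpha (tens V W) (i.J T c f f'))
      ((jet (ContinuousLinearMap.id k (tens V W)) ((2 : k)⁻¹ • (M.r V W + i.rD21 V W))).apply
        (hptens (i.alpha V f) (i.alpha W f'))) := by
  have e0 : ∀ t t', i.evOne (tens V W) (HSeries.comp (HSeries.tensRight (i.iPlusVee T) (tens V W))
      (i.middle V W Φ c) 0 (ptens (X := tens i.P V) (Y := tens i.P W) t t')) =
      ptens (i.evOne V t) (i.evOne W t') := fun t t' => by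
    rw [i.comp_middle_zero]
    exact i.contract_swap hV hW c t t'
  have e1 : i.evOne (tens V W) (HSeries.comp (HSeries.tensRight (i.iPlusVee T) (tens V W))
      (i.middle V W Φ c) 1 (ptens (X := tens i.P V) (Y := tens i.P W)
        (f 0 (Ind.one k i.pPlus)) (f' 0 (Ind.one k i.pPlus)))) =
      ((2 : k)⁻¹ • (M.r V W + i.rD21 V W)) (ptens (i.alpha V f 0) (i.alpha W f' 0)) := by
    rw [i.comp_middle_one]
    exact i.contract_Omega hV hW c _ fun x hx => i.gam_invariant hf' 0 hx
  intro n hn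
  rw [i.alpha_J]
  obtain rfl | rfl : n = 0 ∨ n = 1 := by omega
  · unfold HSeries.apply hptens jet
    rw [antidiagonal_zero']
    simp only [Finset.sum_singleton]
    rw [antidiagonal_zero']
    simp only [Finset.sum_singleton, e0]
    rfl
  · unfold HSeries.apply hptens jet
    rw [antidiagonal_one, Finset.sum_pair (by simp), Finset.sum_pair (by simp)]
    simp only [antidiagonal_one, antidiagonal_zero', Finset.sum_singleton, e0, e1]
    rfl

theorem congr_twist {x : ℕ → V} (hx : x ∈ i.alpha V '' i.Gam V) {y : ℕ → W}
    (hy : y ∈ i.alpha W '' i.Gam W) :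
    CongrModSq (i.twist V W T c x y)
      ((jet (ContinuousLinearMap.id k (tens V W)) ((2 : k)⁻¹ • (M.r V W + i.rD21 V W))).apply
        (hptens x y)) := by
  have h := i.congr_alpha_J hV hW T c (Function.invFunOn (i.alpha V) (i.Gam V) x)
    (Function.invFunOn_mem hy)
  rw [Function.invFunOn_eq hx, Function.invFunOn_eq hy] at h
  exact h

omit hV hW in
theorem jet_apply_zero {X : TMod.{u, v, w} k g} {Y : TMod.{u, v, w'} k g} (A B : X →L[k] Y)
    (t : ℕ → X) : (jet A B).apply t 0 = A (t 0) := by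
  unfold HSeries.apply
  rw [antidiagonal_zero', Finset.sum_singleton]
  rfl

omit hV hW in
theorem jet_apply_one {X : TMod.{u, v, w} k g} {Y : TMod.{u, v, w'} k g} (A B : X →L[k] Y)
    (t : ℕ → X) : (jet A B).apply t 1 = A (t 1) + B (t 0) := by
  unfold HSeries.apply
  rw [antidiagonal_one, Finset.sum_pair (by simp)]
  rfl

omit hV hW in
theorem swapT_hptens (x : ℕ → V) (y : ℕ → W) (n : ℕ) :
    swapT W V (hptens y x n) = hptens x y n := by
  unfold hptens
  rw [map_sum, ← Finset.Nat.sum_antidiagonal_swap]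
  exact Finset.sum_congr rfl fun p _ => swapT_ptens _ _

/-- The flip exchanges r with r^{21} and r_D^{21} with r_D. The identity terms cancel, and the terms
of order ħ give one quarter of r - r^{21} - r_D + r_D^{21}. -/
theorem congr_altTwist [CharZero k] {x : ℕ → V} (hx : x ∈ i.alpha V '' i.Gam V) {y : ℕ → W}
    (hy : y ∈ i.alpha W '' i.Gam W) :
    CongrModSq (i.altTwist V W T c x y)
      ((jet 0 ((2 : k)⁻¹ • ((2 : k)⁻¹ • (M.r V W - M.r21 V W) -
        (2 : k)⁻¹ • (i.rD V W - i.rD21 V W)))).apply (hptens x y)) := by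
  have h1 := i.congr_twist hV hW T c hx hy
  have h2 := i.congr_twist hW hV T c hy hx
  have h3 : swapT W V (M.r W V (ptens (y 0) (x 0))) = M.r21 V W (ptens (x 0) (y 0)) :=
    swapT_sumOp hW hV (Or.inr M.tendsZero_b) _ _
  have h4 : swapT W V (i.rD21 W V (ptens (y 0) (x 0))) = i.rD V W (ptens (x 0) (y 0)) :=
    swapT_sumOp hW hV (Or.inl i.tendsZero_hom_b) _ _
  have h5 : ∀ {X : TMod.{u, v, w} k g} {Y : TMod.{u, v, w'} k g} (x : ℕ → X) (y : ℕ → Y),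
      hptens x y 0 = ptens (x 0) (y 0) := fun x y => by
    unfold hptens
    rw [antidiagonal_zero', Finset.sum_singleton]
  have h6 : hptens y x 0 = ptens (y 0) (x 0) := by
    unfold hptens
    rw [antidiagonal_zero', Finset.sum_singleton]
  intro n hn
  unfold altTwist
  rw [h1 n hn, h2 n hn]
  obtain rfl | rfl : n = 0 ∨ n = 1 := by omega
  · rw [jet_apply_zero, jet_apply_zero, jet_apply_zero, ContinuousLinearMap.id_apply,
      ContinuousLinearMap.id_apply, swapT_hptens, sub_self, smul_zero]
    rfl
  · rw [jet_apply_one, jet_apply_one, jet_apply_one, ContinuousLinearMap.id_apply,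
      ContinuousLinearMap.id_apply, map_add, swapT_hptens, h5, h6]
    simp only [smul_apply, add_apply, sub_apply, zero_apply, map_smul, map_add, h3, h4]
    module

end SplitEmbedding

end

end RelTwist

theorem mainTheorem11 {k : Type u} {g : Type v} {gD : Type v'} [Field k] [CharZero k]
    [LieRing g] [LieAlgebra k g] [LieRing gD] [LieAlgebra k gD]
    (M : RelTwist.ManinTriple k g) (MD : RelTwist.ManinTriple k gD)
    (i : RelTwist.SplitEmbedding MD M)
    (Φ : RelTwist.LieAssociator k) (T : RelTwist.DrinfeldT M Φ)
    (c : RelTwist.SplitEmbedding.Bracketing)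
    (V : RelTwist.TMod.{u, v, w} k g) (W : RelTwist.TMod.{u, v, w'} k g)
    (hV : V.IsEquicontinuous M) (hW : W.IsEquicontinuous M) :
    -- the natural map `α_V` identifies `Γ(V)` with a subspace of `V[[ħ]]`
    (Set.InjOn (i.alpha V) (i.Gam V) ∧ Set.InjOn (i.alpha W) (i.Gam W)) ∧
    -- and with all of `V[[ħ]]` when `g_D` is finite-dimensional
    (Module.Finite k gD →
      Set.BijOn (i.alpha V) (i.Gam V) Set.univ ∧ Set.BijOn (i.alpha W) (i.Gam W) Set.univ) ∧
    -- `J` maps `Γ(V) ⊗ Γ(W)` to `Γ(V ⊗ W)`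
    (∀ f ∈ i.Gam V, ∀ f' ∈ i.Gam W, i.J T c f f' ∈ i.Gam (RelTwist.tens V W)) ∧
    -- the 1-jet of the relative twist and of its alternation
    (∀ x ∈ i.alpha V '' i.Gam V, ∀ y ∈ i.alpha W '' i.Gam W,
      RelTwist.CongrModSq (i.twist V W T c x y)
        ((RelTwist.jet (ContinuousLinearMap.id k (RelTwist.tens V W))
          ((2 : k)⁻¹ • (M.r V W + i.rD21 V W))).apply (RelTwist.hptens x y)) ∧
      RelTwist.CongrModSq (i.altTwist V W T c x y)
        ((RelTwist.jet 0
          ((2 : k)⁻¹ • ((2 : k)⁻¹ • (M.r V W - M.r21 V W) -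
            (2 : k)⁻¹ • (i.rD V W - i.rD21 V W)))).apply (RelTwist.hptens x y))) := by
  refine ⟨⟨i.injOn_alpha hV, i.injOn_alpha hW⟩, fun h => ⟨i.bijOn_alpha hV, i.bijOn_alpha hW⟩,
    fun f hf f' hf' => i.J_mem_Gam hV hW T c hf hf', fun x hx y hy =>
      ⟨i.congr_twist hV hW T c hx hy, i.congr_altTwist hV hW T c hx hy⟩⟩
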